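/- For an integer $h\ge 1$ and a finite simple graph $G$ with non-negative real edge weights, let $\mathcal P$ be a partition of $V(G)$ and $\preceq$ a total order on $\mathcal P$. For a real $r>0$, a part $Y\in\mathcal P$ is weakly $r$-reachable from a part $X\in\mathcal P$ if some path from a vertex of $X$ to a vertex of $Y$ in the induced subgraph $G\left[\bigcup\{Z\in\mathcal P : Y\preceq Z\}\right]$ has total weight at most $r$; and $\mathrm{wcol}_r(G,\mathcal P,\preceq)$ is the maximum over $X\in\mathcal P$ of the number of parts $Y\in\mathcal P$ that are weakly $r$-reachable from $X$ (and $0$ if $V(G)=\emptyset$). The strong diameter of $X\subseteq V(G)$ is the maximum of $\mathrm{dist}_{G[X]}(u,v)$ over $u,v\in X$ ($\infty$ if $G[X]$ is disconnected). Theorem. There is an algorithm that, given an integer $h\ge 1$, a $K_h$-minor-free graph $G$ with non-negative real edge weights, and a real $\rho>0$, computes in time polynomial in $|V(G)|$ a partition $\mathcal P$ of $V(G)$ into parts of strong diameter at most $\rho$ and a total order $\preceq$ on $\mathcal P$ such that for every real $r>\rho$ $$\mathrm{wcol}_r(G,\mathcal P,\preceq)\;\le\;\binom{h-2+2\left\lceil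 4h\frac r\rho\right\rceil}{h-1}\cdot\left(12+8\frac r\rho\right)\cdot(h-1).$$ Here an algorithm is a program for a random access machine with exact real registers whose unit-cost operations are assignments and tests built from additions, subtractions and comparisons of natural and of real numbers (with no multiplication, division or rounding). -/

import Mathlib

open scoped NNReal ENNReal

/-! ### Edge-weighted graphs, minors, distances -/

/-- `H` is a minor of `G`: there are pairwise disjoint branch sets in `G`, one for each vertex of
`H`, each inducing a connected (in particular non-empty) subgraph, such that the branch sets of
adjacent vertices of `H` are joined by an edge of `G`. -/
def IsMinorOf {W V : Type*} (H : SimpleGraph W) (G : SimpleGraph V) : Prop :=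
  ∃ B : W → Set V,
    (∀ a, (G.induce (B a)).Connected) ∧
    (∀ a b, a ≠ b → Disjoint (B a) (B b)) ∧
    (∀ a b, H.Adj a b → ∃ x ∈ B a, ∃ y ∈ B b, G.Adj x y)

/-- `G` is `K_h`-minor-free. -/
def CliqueMinorFree {V : Type*} (G : SimpleGraph V) (h : ℕ) : Prop :=
  ¬ IsMinorOf (⊤ : SimpleGraph (Fin h)) G

/-- The length of a walk with respect to edge weights `w` (only the values of `w` on edges of the
graph matter). -/
def walkLength {V : Type*} {G : SimpleGraph V} (w : Sym2 V → ℝ≥0) {u v : V} (p : G.Walk u v) :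
    ℝ≥0 :=
  (p.edges.map w).sum

/-- The distance from `u` to `v` in the induced subgraph `G[S]`: the minimum length of a path all
of whose vertices lie in `S` (and `∞` if there is none). -/
noncomputable def distIn {V : Type*} (G : SimpleGraph V) (w : Sym2 V → ℝ≥0) (S : Set V)
    (u v : V) : ℝ≥0∞ :=
  ⨅ (p : G.Walk u v) (_ : p.IsPath ∧ ∀ x ∈ p.support, x ∈ S), (walkLength w p : ℝ≥0∞)

/-- The strong diameter of `S`: the maximum distance in `G[S]` between two vertices of `S`. -/
noncomputable def strongDiam {V : Type*} (G : SimpleGraph V) (w : Sym2 V → ℝ≥0) (S : Set V) :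
    ℝ≥0∞ :=
  ⨆ (u ∈ S) (v ∈ S), distIn G w S u v

/-! ### Weak coloring numbers of ordered partitions -/

section WeakColoring

variable {V : Type*} [Fintype V] [DecidableEq V]

/-- The union of all parts `Z` of `P` with `Y ⪯ Z`. -/
def upperUnion (P : Finpartition (Finset.univ : Finset V)) (ord : LinearOrder {X // X ∈ P.parts})
    (Y : {X // X ∈ P.parts}) : Set V :=
  {x | ∃ Z : {X // X ∈ P.parts}, ord.le Y Z ∧ x ∈ Z.1}

/-- The part `Y` is weakly `r`-reachable from the part `X`: there is a path of length at most `r`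
from a vertex of `X` to a vertex of `Y` in the subgraph induced by the union of all parts `Z` with
`Y ⪯ Z`. -/
def WeaklyReachable (G : SimpleGraph V) (w : Sym2 V → ℝ≥0)
    (P : Finpartition (Finset.univ : Finset V)) (ord : LinearOrder {X // X ∈ P.parts}) (r : ℝ)
    (X Y : {X // X ∈ P.parts}) : Prop :=
  ∃ x ∈ X.1, ∃ y ∈ Y.1, ∃ p : G.Walk x y,
    p.IsPath ∧ (∀ z ∈ p.support, z ∈ upperUnion P ord Y) ∧ (walkLength w p : ℝ) ≤ r

open Classical in
/-- The set of all parts that are weakly `r`-reachable from `X`. -/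
noncomputable def wReach (G : SimpleGraph V) (w : Sym2 V → ℝ≥0)
    (P : Finpartition (Finset.univ : Finset V)) (ord : LinearOrder {X // X ∈ P.parts}) (r : ℝ)
    (X : {X // X ∈ P.parts}) : Finset {X // X ∈ P.parts} :=
  Finset.univ.filter fun Y => WeaklyReachable G w P ord r X Y

/-- The weak coloring number: the maximum of `|wReach X|` over all parts `X` (and `0` if there
are no vertices). -/
noncomputable def wcol (G : SimpleGraph V) (w : Sym2 V → ℝ≥0)
    (P : Finpartition (Finset.univ : Finset V)) (ord : LinearOrder {X // X ∈ P.parts}) (r : ℝ) :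
    ℕ :=
  Finset.univ.sup fun X : {X // X ∈ P.parts} => (wReach G w P ord r X).card

end WeakColoring

/-! ### The machine model

A random access machine over the reals, programmed by finite structured programs. The memory
consists of arrays of natural numbers and arrays of real numbers; every array is named by a natural
number and is indexed by two natural numbers. The only arithmetic is addition and
subtraction (and comparison): there is no multiplication, division or rounding, and the only
constants are natural number literals and the real number `0`. Each assignment and each evaluated
test is one step; expressions have a size that is fixed by the program. Since no multiplication is
available, a step lengthens the binary representation of numbers by at most a constant number of
bits, so unit costs do not hide superpolynomial work on integral or rational inputs. -/

namespace RAM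

/-- The contents of the memory. -/
structure State where
  /-- the arrays of natural numbers -/
  nat : ℕ → ℕ → ℕ → ℕ
  /-- the arrays of real numbers -/
  real : ℕ → ℕ → ℕ → ℝ

/-- Expressions with a natural number as value. -/
inductive NatExpr where
  | lit (k : ℕ)
  | get (a : ℕ) (i j : NatExpr)
  | add (e f : NatExpr)
  | sub (e f : NatExpr)

/-- Expressions with a real number as value. -/
inductive RealExpr where
  | zero
  | get (a : ℕ) (i j : NatExpr)
  | add (e f : RealExpr)
  | sub (e f : RealExpr)

/-- Tests. -/
inductive Test where
  | natLe (e f : NatExpr)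
  | realLe (e f : RealExpr)
  | not (b : Test)
  | and (b c : Test)

/-- Programs. -/
inductive Program where
  | skip
  | setNat (a : ℕ) (i j e : NatExpr)
  | setReal (a : ℕ) (i j : NatExpr) (e : RealExpr)
  | seq (c d : Program)
  | cond (b : Test) (c d : Program)
  | loop (b : Test) (c : Program)

/-- The value of an expression (`sub` is truncated subtraction of natural numbers). -/
def NatExpr.eval (s : State) : NatExpr → ℕ
  | .lit k => k
  | .get a i j => s.nat a (i.eval s) (j.eval s)
  | .add e f => e.eval s + f.eval s
  | .sub e f => e.eval s - f.eval s

/-- The value of an expression. -/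
noncomputable def RealExpr.eval (s : State) : RealExpr → ℝ
  | .zero => 0
  | .get a i j => s.real a (i.eval s) (j.eval s)
  | .add e f => e.eval s + f.eval s
  | .sub e f => e.eval s - f.eval s

/-- The test succeeds. -/
def Test.Holds (s : State) : Test → Prop
  | .natLe e f => e.eval s ≤ f.eval s
  | .realLe e f => e.eval s ≤ f.eval s
  | .not b => ¬ b.Holds s
  | .and b c => b.Holds s ∧ c.Holds s

/-- Overwrite the entry `(i, j)` of the natural number array `a` by `x`. -/
def State.writeNat (s : State) (a i j x : ℕ) : State :=
  { s with nat := fun a' i' j' => if a' = a ∧ i' = i ∧ j' = j then x else s.nat a' i' j' }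

/-- Overwrite the entry `(i, j)` of the real number array `a` by `x`. -/
noncomputable def State.writeReal (s : State) (a i j : ℕ) (x : ℝ) : State :=
  { s with real := fun a' i' j' => if a' = a ∧ i' = i ∧ j' = j then x else s.real a' i' j' }

/-- `Runs c s t s'`: started with memory `s`, the program `c` halts after exactly `t` steps with
memory `s'`. -/
inductive Runs : Program → State → ℕ → State → Prop
  | skip (s : State) : Runs .skip s 1 s
  | setNat (s : State) (a : ℕ) (i j e : NatExpr) :
      Runs (.setNat a i j e) s 1 (s.writeNat a (i.eval s) (j.eval s) (e.eval s))
  | setReal (s : State) (a : ℕ) (i j : NatExpr) (e : RealExpr) :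
      Runs (.setReal a i j e) s 1 (s.writeReal a (i.eval s) (j.eval s) (e.eval s))
  | seq {c d : Program} {s s' s'' : State} {t t' : ℕ} :
      Runs c s t s' → Runs d s' t' s'' → Runs (.seq c d) s (t + t') s''
  | condTrue {b : Test} {c d : Program} {s s' : State} {t : ℕ} :
      b.Holds s → Runs c s t s' → Runs (.cond b c d) s (t + 1) s'
  | condFalse {b : Test} {c d : Program} {s s' : State} {t : ℕ} :
      ¬ b.Holds s → Runs d s t s' → Runs (.cond b c d) s (t + 1) s'
  | loopTrue {b : Test} {c : Program} {s s' s'' : State} {t t' : ℕ} :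
      b.Holds s → Runs c s t s' → Runs (.loop b c) s' t' s'' →
      Runs (.loop b c) s (t + t' + 1) s''
  | loopFalse {b : Test} {c : Program} {s : State} :
      ¬ b.Holds s → Runs (.loop b c) s 1 s

open Classical in
/-- The memory that holds the input `(h, G, w, ρ)`, where `G` has vertex set `{0, …, n - 1}`:
the natural number array `0` holds `n` and `h` in its entries `(0, 0)` and `(0, 1)`, the natural
number array `1` holds the adjacency matrix of `G`, the real number array `0` holds `ρ` in its
entry `(0, 0)`, and the real number array `1` holds the matrix of edge weights. All other entries
are `0`. -/
noncomputable def input (h : ℕ) {n : ℕ} (G : SimpleGraph (Fin n)) (w : Sym2 (Fin n) → ℝ≥0)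
    (ρ : ℝ) : State where
  nat a i j :=
    if a = 0 ∧ i = 0 ∧ j = 0 then n
    else if a = 0 ∧ i = 0 ∧ j = 1 then h
    else if e : i < n ∧ j < n then
      if a = 1 ∧ G.Adj ⟨i, e.1⟩ ⟨j, e.2⟩ then 1 else 0
    else 0
  real a i j :=
    if a = 0 ∧ i = 0 ∧ j = 0 then ρ
    else if e : i < n ∧ j < n then
      if a = 1 ∧ G.Adj ⟨i, e.1⟩ ⟨j, e.2⟩ then (w s(⟨i, e.1⟩, ⟨j, e.2⟩) : ℝ) else 0
    else 0

/-- The memory `s` holds the partition `P` and the total order `ord` on its parts as output: the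
entry `(v, 0)` of the natural number array `2` is a label of the part of the vertex `v`, and the
labels are ordered as the parts are. (So two vertices have the same label if and only if they lie
in the same part.) -/
def IsOutput {n : ℕ} (s : State) (P : Finpartition (Finset.univ : Finset (Fin n)))
    (ord : LinearOrder {X // X ∈ P.parts}) : Prop :=
  ∀ X Y : {X // X ∈ P.parts}, ∀ u ∈ X.1, ∀ v ∈ Y.1,
    ord.le X Y ↔ s.nat 2 u 0 ≤ s.nat 2 v 0

end RAM

/-! ### Programs with bounded loops -/

namespace RAM

/-- Programs whose only loops run a counter from `0` to the input size `n`. -/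
inductive Cmd where
  | skip
  | setNat (a : ℕ) (i j e : NatExpr)
  | setReal (a : ℕ) (i j : NatExpr) (e : RealExpr)
  | seq (c d : Cmd)
  | cond (b : Test) (c d : Cmd)
  | forN (a : ℕ) (c : Cmd)

/-- The scalar variable stored in the array `a`. -/
def var (a : ℕ) : NatExpr := .get a (.lit 0) (.lit 0)

/-- The strict comparison of natural numbers. -/
def Test.natLt (e f : NatExpr) : Test := .not (.natLe f e)

/-- The equality test for natural numbers. -/
def Test.natEq (e f : NatExpr) : Test := .and (.natLe e f) (.natLe f e)

/-- The strict comparison of real numbers. -/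
def Test.realLt (e f : RealExpr) : Test := .not (.realLe f e)

/-- The translation of bounded-loop programs to programs. -/
def Cmd.toProgram : Cmd → Program
  | .skip => .skip
  | .setNat a i j e => .setNat a i j e
  | .setReal a i j e => .setReal a i j e
  | .seq c d => .seq c.toProgram d.toProgram
  | .cond b c d => .cond b c.toProgram d.toProgram
  | .forN a c => .seq (.setNat a (.lit 0) (.lit 0) (.lit 0))
      (.loop (.natLt (var a) (var 0))
        (.seq c.toProgram (.setNat a (.lit 0) (.lit 0) (.add (var a) (.lit 1)))))

/-- `k` iterations of `f`, with the counter `a` running from `0`. -/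
def iterCount (f : State → State) (a : ℕ) (s : State) : ℕ → State
  | 0 => s.writeNat a 0 0 0
  | k + 1 => (f (iterCount f a s k)).writeNat a 0 0 (k + 1)

open Classical in
/-- The memory after the execution of a bounded-loop program. -/
noncomputable def Cmd.run : Cmd → State → State
  | .skip, s => s
  | .setNat a i j e, s => s.writeNat a (i.eval s) (j.eval s) (e.eval s)
  | .setReal a i j e, s => s.writeReal a (i.eval s) (j.eval s) (e.eval s)
  | .seq c d, s => d.run (c.run s)
  | .cond b c d, s => if b.Holds s then c.run s else d.run s
  | .forN a c, s => iterCount c.run a s (s.nat 0 0 0)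

/-- The program may write to the natural number array `b`. -/
def Cmd.natWrites : Cmd → ℕ → Bool
  | .skip, _ => false
  | .setNat a _ _ _, b => a == b
  | .setReal _ _ _ _, _ => false
  | .seq c d, b => c.natWrites b || d.natWrites b
  | .cond _ c d, b => c.natWrites b || d.natWrites b
  | .forN a c, b => a == b || c.natWrites b

/-- The program may write to the real number array `b`. -/
def Cmd.realWrites : Cmd → ℕ → Bool
  | .skip, _ => false
  | .setNat _ _ _ _, _ => false
  | .setReal a _ _ _, b => a == b
  | .seq c d, b => c.realWrites b || d.realWrites b
  | .cond _ c d, b => c.realWrites b || d.realWrites b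
  | .forN _ c, b => c.realWrites b

/-- No loop changes its own counter or the input size. -/
def Cmd.wf : Cmd → Bool
  | .seq c d => c.wf && d.wf
  | .cond _ c d => c.wf && d.wf
  | .forN a c => c.wf && !(a == 0) && !c.natWrites a && !c.natWrites 0
  | _ => true

/-- A bound for the running time in terms of the input size. -/
noncomputable def Cmd.cost : Cmd → Polynomial ℕ
  | .seq c d => c.cost + d.cost
  | .cond _ c d => c.cost + d.cost + 1
  | .forN _ c => Polynomial.X * (c.cost + 2) + 2
  | _ => 1

section Simp

@[simp] theorem writeNat_nat_same (s : State) (a i j x : ℕ) :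
    (s.writeNat a i j x).nat a i j = x := by
  simp [State.writeNat]

theorem writeNat_nat (s : State) (a i j x i' j' : ℕ) :
    (s.writeNat a i j x).nat a i' j' = if i' = i ∧ j' = j then x else s.nat a i' j' := by
  simp [State.writeNat]

theorem writeNat_nat_ne (s : State) {a b : ℕ} (i j x : ℕ) (h : b ≠ a) :
    (s.writeNat a i j x).nat b = s.nat b := by
  ext; simp [State.writeNat, h]

@[simp] theorem writeNat_real (s : State) (a i j x : ℕ) : (s.writeNat a i j x).real = s.real := rfl

@[simp] theorem writeReal_nat (s : State) (a i j : ℕ) (x : ℝ) :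
    (s.writeReal a i j x).nat = s.nat := rfl

theorem writeReal_real (s : State) (a i j i' j' : ℕ) (x : ℝ) :
    (s.writeReal a i j x).real a i' j' = if i' = i ∧ j' = j then x else s.real a i' j' := by
  simp [State.writeReal]

theorem writeReal_real_ne (s : State) {a b : ℕ} (i j : ℕ) (x : ℝ) (h : b ≠ a) :
    (s.writeReal a i j x).real b = s.real b := by
  ext; simp [State.writeReal, h]

@[simp] theorem eval_lit (s : State) (k : ℕ) : (NatExpr.lit k).eval s = k := rfl
@[simp] theorem eval_get (s : State) (a : ℕ) (i j : NatExpr) :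
    (NatExpr.get a i j).eval s = s.nat a (i.eval s) (j.eval s) := rfl
@[simp] theorem eval_add (s : State) (e f : NatExpr) :
    (NatExpr.add e f).eval s = e.eval s + f.eval s := rfl
@[simp] theorem eval_var (s : State) (a : ℕ) : (var a).eval s = s.nat a 0 0 := rfl
@[simp] theorem evalR_zero (s : State) : RealExpr.zero.eval s = 0 := rfl
@[simp] theorem evalR_get (s : State) (a : ℕ) (i j : NatExpr) :
    (RealExpr.get a i j).eval s = s.real a (i.eval s) (j.eval s) := rfl
@[simp] theorem evalR_add (s : State) (e f : RealExpr) :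
    (RealExpr.add e f).eval s = e.eval s + f.eval s := rfl
@[simp] theorem evalR_sub (s : State) (e f : RealExpr) :
    (RealExpr.sub e f).eval s = e.eval s - f.eval s := rfl
@[simp] theorem holds_natLe (s : State) (e f : NatExpr) :
    (Test.natLe e f).Holds s ↔ e.eval s ≤ f.eval s := Iff.rfl
@[simp] theorem holds_realLe (s : State) (e f : RealExpr) :
    (Test.realLe e f).Holds s ↔ e.eval s ≤ f.eval s := Iff.rfl
@[simp] theorem holds_and (s : State) (b c : Test) :
    (Test.and b c).Holds s ↔ b.Holds s ∧ c.Holds s := Iff.rfl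
@[simp] theorem holds_not (s : State) (b : Test) : (Test.not b).Holds s ↔ ¬ b.Holds s := Iff.rfl
@[simp] theorem holds_natLt (s : State) (e f : NatExpr) :
    (Test.natLt e f).Holds s ↔ e.eval s < f.eval s := by simp [Test.natLt]
@[simp] theorem holds_natEq (s : State) (e f : NatExpr) :
    (Test.natEq e f).Holds s ↔ e.eval s = f.eval s := by simp [Test.natEq, le_antisymm_iff]
@[simp] theorem holds_realLt (s : State) (e f : RealExpr) :
    (Test.realLt e f).Holds s ↔ e.eval s < f.eval s := by simp [Test.realLt]

@[simp] theorem run_skip (s : State) : Cmd.skip.run s = s := rfl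
@[simp] theorem run_setNat (s : State) (a : ℕ) (i j e : NatExpr) :
    (Cmd.setNat a i j e).run s = s.writeNat a (i.eval s) (j.eval s) (e.eval s) := rfl
@[simp] theorem run_setReal (s : State) (a : ℕ) (i j : NatExpr) (e : RealExpr) :
    (Cmd.setReal a i j e).run s = s.writeReal a (i.eval s) (j.eval s) (e.eval s) := rfl
@[simp] theorem run_seq (s : State) (c d : Cmd) : (Cmd.seq c d).run s = d.run (c.run s) := rfl
theorem run_cond_pos {s : State} {b : Test} (h : b.Holds s) (c d : Cmd) :
    (Cmd.cond b c d).run s = c.run s := by simp [Cmd.run, h]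
theorem run_cond_neg {s : State} {b : Test} (h : ¬ b.Holds s) (c d : Cmd) :
    (Cmd.cond b c d).run s = d.run s := by simp [Cmd.run, h]

end Simp

theorem Cmd.run_nat {c : Cmd} {b : ℕ} (h : c.natWrites b = false) (s : State) :
    (c.run s).nat b = s.nat b := by
  induction c generalizing s with
  | skip => rfl
  | setNat a i j e =>
    simp only [Cmd.natWrites, beq_eq_false_iff_ne] at h
    exact writeNat_nat_ne _ _ _ _ h.symm
  | setReal a i j e => rfl
  | seq c d hc hd =>
    simp only [Cmd.natWrites, Bool.or_eq_false_iff] at h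
    rw [run_seq, hd h.2, hc h.1]
  | cond t c d hc hd =>
    simp only [Cmd.natWrites, Bool.or_eq_false_iff] at h
    by_cases ht : t.Holds s
    · rw [run_cond_pos ht, hc h.1]
    · rw [run_cond_neg ht, hd h.2]
  | forN a c hc =>
    simp only [Cmd.natWrites, Bool.or_eq_false_iff, beq_eq_false_iff_ne] at h
    have : ∀ k, (iterCount c.run a s k).nat b = s.nat b := by
      intro k
      induction k with
      | zero => exact writeNat_nat_ne _ _ _ _ h.1.symm
      | succ k ih => rw [iterCount, writeNat_nat_ne _ _ _ _ h.1.symm, hc h.2, ih]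
    exact this _

theorem Cmd.run_real {c : Cmd} {b : ℕ} (h : c.realWrites b = false) (s : State) :
    (c.run s).real b = s.real b := by
  induction c generalizing s with
  | skip => rfl
  | setNat a i j e => rfl
  | setReal a i j e =>
    simp only [Cmd.realWrites, beq_eq_false_iff_ne] at h
    exact writeReal_real_ne _ _ _ _ h.symm
  | seq c d hc hd =>
    simp only [Cmd.realWrites, Bool.or_eq_false_iff] at h
    rw [run_seq, hd h.2, hc h.1]
  | cond t c d hc hd =>
    simp only [Cmd.realWrites, Bool.or_eq_false_iff] at h
    by_cases ht : t.Holds s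
    · rw [run_cond_pos ht, hc h.1]
    · rw [run_cond_neg ht, hd h.2]
  | forN a c hc =>
    simp only [Cmd.realWrites] at h
    have : ∀ k, (iterCount c.run a s k).real b = s.real b := by
      intro k
      induction k with
      | zero => rfl
      | succ k ih => rw [iterCount, writeNat_real, hc h, ih]
    exact this _

theorem iterCount_counter (f : State → State) (a : ℕ) (s : State) (k : ℕ) :
    (iterCount f a s k).nat a 0 0 = k := by
  cases k <;> simp [iterCount]

/-- A property that holds initially and is preserved by the body of a bounded loop holds when the
loop has ended. -/
theorem Cmd.forN_induct {a : ℕ} {c : Cmd} {s : State} {n : ℕ} (hn : s.nat 0 0 0 = n)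
    (I : ℕ → State → Prop) (base : I 0 (s.writeNat a 0 0 0))
    (step : ∀ k < n, ∀ s' : State, (∀ b, (Cmd.forN a c).natWrites b = false → s'.nat b = s.nat b) →
      (∀ b, c.realWrites b = false → s'.real b = s.real b) → s'.nat a 0 0 = k → I k s' →
      I (k + 1) ((c.run s').writeNat a 0 0 (k + 1))) :
    I n ((Cmd.forN a c).run s) := by
  have key : ∀ k ≤ n, I k (iterCount c.run a s k) ∧
      (∀ b, (Cmd.forN a c).natWrites b = false → (iterCount c.run a s k).nat b = s.nat b) ∧
      (∀ b, c.realWrites b = false → (iterCount c.run a s k).real b = s.real b) := by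
    intro k
    induction k with
    | zero =>
      refine fun _ => ⟨base, fun b hb => ?_, fun b _ => rfl⟩
      simp only [Cmd.natWrites, Bool.or_eq_false_iff, beq_eq_false_iff_ne] at hb
      exact writeNat_nat_ne _ _ _ _ hb.1.symm
    | succ k ih =>
      intro hk
      obtain ⟨h1, h2, h3⟩ := ih (by omega)
      refine ⟨step k hk _ h2 h3 (iterCount_counter _ _ _ _) h1, fun b hb => ?_, fun b hb => ?_⟩
      · rw [← h2 b hb]
        simp only [Cmd.natWrites, Bool.or_eq_false_iff, beq_eq_false_iff_ne] at hb
        rw [iterCount, writeNat_nat_ne _ _ _ _ hb.1.symm, Cmd.run_nat hb.2]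
      · rw [iterCount, writeNat_real, Cmd.run_real hb, h3 b hb]
  have := (key n le_rfl).1
  rwa [← hn] at this ⊢

/-- Bounded-loop programs run in polynomial time. -/
theorem Cmd.runs {c : Cmd} (hc : c.wf = true) (h0 : c.natWrites 0 = false) (s : State) :
    ∃ t, Runs c.toProgram s t (c.run s) ∧ t ≤ c.cost.eval (s.nat 0 0 0) := by
  induction c generalizing s with
  | skip => exact ⟨1, .skip s, by simp [Cmd.cost]⟩
  | setNat a i j e => exact ⟨1, .setNat s a i j e, by simp [Cmd.cost]⟩
  | setReal a i j e => exact ⟨1, .setReal s a i j e, by simp [Cmd.cost]⟩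
  | seq c d ihc ihd =>
    simp only [Cmd.wf, Bool.and_eq_true] at hc
    simp only [Cmd.natWrites, Bool.or_eq_false_iff] at h0
    obtain ⟨t, ht, ht'⟩ := ihc hc.1 h0.1 s
    obtain ⟨u, hu, hu'⟩ := ihd hc.2 h0.2 (c.run s)
    rw [Cmd.run_nat h0.1] at hu'
    exact ⟨t + u, .seq ht hu, by simp only [Cmd.cost, Polynomial.eval_add]; omega⟩
  | cond t c d ihc ihd =>
    simp only [Cmd.wf, Bool.and_eq_true] at hc
    simp only [Cmd.natWrites, Bool.or_eq_false_iff] at h0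
    by_cases h : t.Holds s
    · obtain ⟨t, ht, ht'⟩ := ihc hc.1 h0.1 s
      rw [run_cond_pos h]
      exact ⟨t + 1, .condTrue h ht, by
        simp only [Cmd.cost, Polynomial.eval_add, Polynomial.eval_one]; omega⟩
    · obtain ⟨t, ht, ht'⟩ := ihd hc.2 h0.2 s
      rw [run_cond_neg h]
      exact ⟨t + 1, .condFalse h ht, by
        simp only [Cmd.cost, Polynomial.eval_add, Polynomial.eval_one]; omega⟩
  | forN a c ih =>
    simp only [Cmd.wf, Bool.and_eq_true, Bool.not_eq_true', beq_eq_false_iff_ne] at hc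
    simp only [Cmd.natWrites, Bool.or_eq_false_iff] at h0
    obtain ⟨⟨⟨hwf, ha⟩, hca⟩, hc0⟩ := hc
    set n := s.nat 0 0 0 with hn
    have h0' : ∀ k, (iterCount c.run a s k).nat 0 = s.nat 0 := by
      intro k
      induction k with
      | zero => exact writeNat_nat_ne _ _ _ _ ha.symm
      | succ k ihk => rw [iterCount, writeNat_nat_ne _ _ _ _ ha.symm, Cmd.run_nat hc0, ihk]
    have key : ∀ j k, j + k = n → ∃ t, Runs (.loop (.natLt (var a) (var 0))
        (.seq c.toProgram (.setNat a (.lit 0) (.lit 0) (.add (var a) (.lit 1)))))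
        (iterCount c.run a s k) t (iterCount c.run a s n) ∧ t ≤ j * (c.cost.eval n + 2) + 1 := by
      intro j
      induction j with
      | zero =>
        intro k hk
        obtain rfl : k = n := by omega
        refine ⟨1, .loopFalse ?_, by omega⟩
        rw [holds_natLt, eval_var, eval_var, iterCount_counter, h0', ← hn]
        omega
      | succ j ihj =>
        intro k hk
        obtain ⟨t, ht, ht'⟩ := ihj (k + 1) (by omega)
        obtain ⟨u, hu, hu'⟩ := ih hwf hc0 (iterCount c.run a s k)
        rw [h0', ← hn] at hu'
        have h1 := Runs.setNat (c.run (iterCount c.run a s k)) a (.lit 0) (.lit 0)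
          (.add (var a) (.lit 1))
        simp only [eval_lit, eval_add, eval_var, Cmd.run_nat hca, iterCount_counter] at h1
        refine ⟨u + 1 + t + 1, .loopTrue ?_ (.seq hu h1) ht, ?_⟩
        · rw [holds_natLt, eval_var, eval_var, iterCount_counter, h0', ← hn]
          omega
        · rw [add_mul]; omega
    obtain ⟨t, ht, ht'⟩ := key n 0 (by omega)
    refine ⟨1 + t, .seq (.setNat s a _ _ _) ht, ?_⟩
    simp only [Cmd.cost, Polynomial.eval_add, Polynomial.eval_mul, Polynomial.eval_X,
      Polynomial.eval_ofNat]
    omega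

end RAM

/-! ### Walks inside vertex sets -/

/-- There is a walk of length `l` from the first to the second vertex with all vertices in `T`. -/
inductive WalkIn {V : Type*} (G : SimpleGraph V) (w : Sym2 V → ℝ≥0) (T : Set V) :
    V → V → ℝ → Prop
  | refl {x : V} (hx : x ∈ T) : WalkIn G w T x x 0
  | cons {x y z : V} {l : ℝ} (hx : x ∈ T) (h : G.Adj x y) (p : WalkIn G w T y z l) :
      WalkIn G w T x z (w s(x, y) + l)

namespace WalkIn

variable {V : Type*} {G : SimpleGraph V} {w : Sym2 V → ℝ≥0} {S T : Set V} {x y z : V} {l l' : ℝ}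

theorem mono (h : WalkIn G w S x y l) (hST : S ⊆ T) : WalkIn G w T x y l := by
  induction h with
  | refl hx => exact .refl (hST hx)
  | cons hx h _ ih => exact .cons (hST hx) h ih

theorem left_mem (h : WalkIn G w S x y l) : x ∈ S := by cases h <;> assumption

theorem right_mem (h : WalkIn G w S x y l) : y ∈ S := by
  induction h with
  | refl hx => exact hx
  | cons _ _ _ ih => exact ih

theorem nonneg (h : WalkIn G w S x y l) : 0 ≤ l := by
  induction h with
  | refl hx => exact le_rfl
  | cons _ _ _ ih => positivity

theorem append (h : WalkIn G w S x y l) (h' : WalkIn G w S y z l') :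
    WalkIn G w S x z (l + l') := by
  induction h with
  | refl hx => simpa using h'
  | cons hx h _ ih => rw [add_assoc]; exact .cons hx h (ih h')

theorem single (hx : x ∈ S) (hy : y ∈ S) (h : G.Adj x y) : WalkIn G w S x y (w s(x, y)) := by
  simpa using WalkIn.cons hx h (.refl hy)

theorem concat (h : WalkIn G w S x y l) (hz : z ∈ S) (hyz : G.Adj y z) :
    WalkIn G w S x z (l + w s(y, z)) := h.append (.single h.right_mem hz hyz)

theorem symm (h : WalkIn G w S x y l) : WalkIn G w S y x l := by
  induction h with
  | refl hx => exact .refl hx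
  | cons hx h p ih =>
    rw [add_comm, Sym2.eq_swap]
    exact ih.concat hx h.symm

/-- Either a walk from a vertex of `A` ends in `A`, or it can be split at its first vertex
outside `A`. -/
theorem split (A : Set V) (h : WalkIn G w S x y l) (hx : x ∈ A) :
    y ∈ A ∨ ∃ a ∈ A, ∃ b ∉ A, G.Adj a b ∧ ∃ l₁ l₂, l = l₁ + w s(a, b) + l₂ ∧
      WalkIn G w (S ∩ A) x a l₁ ∧ WalkIn G w S b y l₂ := by
  induction h with
  | refl h => exact .inl hx
  | @cons x y z l h hxy p ih =>
    by_cases hy : y ∈ A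
    · rcases ih hy with h' | ⟨a, ha, b, hb, hab, l₁, l₂, rfl, h₁, h₂⟩
      · exact .inl h'
      · exact .inr ⟨a, ha, b, hb, hab, _, l₂, by ring, .cons ⟨h, hx⟩ hxy h₁, h₂⟩
    · exact .inr ⟨x, hx, y, hy, hxy, 0, l, by ring, .refl ⟨h, hx⟩, p⟩

theorem of_walk (p : G.Walk x y) (hp : ∀ z ∈ p.support, z ∈ S) :
    WalkIn G w S x y (walkLength w p) := by
  induction p with
  | nil => exact .refl (hp _ (by simp))
  | cons h p ih =>
    simp only [SimpleGraph.Walk.support_cons, List.mem_cons, forall_eq_or_imp] at hp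
    have := WalkIn.cons hp.1 h (ih hp.2)
    simpa [walkLength] using this

theorem exists_walk (h : WalkIn G w S x y l) :
    ∃ p : G.Walk x y, (∀ z ∈ p.support, z ∈ S) ∧ (walkLength w p : ℝ) = l := by
  induction h with
  | @refl x hx => exact ⟨.nil, by simpa using hx, by simp [walkLength]⟩
  | cons hx h _ ih =>
    obtain ⟨p, hp, rfl⟩ := ih
    exact ⟨.cons h p, by simpa using ⟨hx, hp⟩, by simp [walkLength]⟩

theorem distIn_le (h : WalkIn G w S x y l) : distIn G w S x y ≤ ENNReal.ofReal l := by
  classical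
  obtain ⟨p, hp, rfl⟩ := h.exists_walk
  refine (iInf₂_le p.bypass ⟨p.bypass_isPath,
    fun z hz => hp z (p.support_bypass_subset_support hz)⟩).trans ?_
  rw [ENNReal.ofReal_coe_nnreal, ENNReal.coe_le_coe]
  exact (p.edges_bypass_sublist_edges.map w).sum_le_sum (by simp)

end WalkIn

theorem connected_induce_of_walkIn {V : Type*} {G : SimpleGraph V} {w : Sym2 V → ℝ≥0} {S : Set V}
    {r : V} (hr : r ∈ S) (h : ∀ x ∈ S, ∃ l, WalkIn G w S x r l) : (G.induce S).Connected := by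
  have key : ∀ x y l, WalkIn G w S x y l → ∀ (hx : x ∈ S) (hy : y ∈ S),
      (G.induce S).Reachable ⟨x, hx⟩ ⟨y, hy⟩ := by
    intro x y l h
    induction h with
    | refl => exact fun _ _ => .refl _
    | cons hx hxy p ih =>
      intro _ hz
      refine SimpleGraph.Reachable.trans ?_ (ih p.left_mem hz)
      exact SimpleGraph.Adj.reachable (by simpa using hxy)
  have : Nonempty S := ⟨⟨r, hr⟩⟩
  refine ⟨fun x y => ?_⟩
  obtain ⟨_, hx⟩ := h x x.2
  obtain ⟨_, hy⟩ := h y y.2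
  exact (key _ _ _ hx x.2 hr).trans (key _ _ _ hy y.2 hr).symm

/-! ### Partial buffered decompositions -/

/-- A partial decomposition: every vertex `v` with `lab v ≠ 0` belongs to the supernode `lab v` and
to its piece `pc v`. The supernodes are numbered from `1` to `m`, and the pieces from `1` to `p`.
For an unassigned vertex `x` the walks from `x` that avoid the supernodes up to `low x u` are
known to be long when they leave the domain of the supernode `u`. -/
structure PartialDecomp (V : Type*) where
  lab : V → ℕ
  pc : V → ℕ
  low : V → ℕ → ℕ
  m : ℕ
  p : ℕ

namespace PartialDecomp

variable {V : Type*}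

/-- The unassigned vertices. -/
def free (s : PartialDecomp V) : Set V := {v | s.lab v = 0}

/-- The vertices outside of the supernodes `1, …, b`. -/
def above (s : PartialDecomp V) (b : ℕ) : Set V := {v | s.lab v = 0 ∨ b < s.lab v}

end PartialDecomp

/-- The component of `r` in the unassigned vertices is adjacent to the supernode `j`. -/
def SeesLabel {V : Type*} (G : SimpleGraph V) (w : Sym2 V → ℝ≥0) (s : PartialDecomp V) (r : V)
    (j : ℕ) : Prop :=
  j ≠ 0 ∧ ∃ x l y, WalkIn G w s.free r x l ∧ G.Adj x y ∧ s.lab y = j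

/-- The history of a partial decomposition: the domains of the supernodes, the sets of older
supernodes that they see, the centers of the pieces, the skeleton path of each piece, the
distance functions that define the skeletons, and for each vertex the set of supernodes that
account for its distance to the skeleton. -/
structure History (V : Type*) where
  dom : ℕ → Set V
  sees : ℕ → Finset ℕ
  cen : ℕ → V
  path : ℕ → ℕ
  dist : ℕ → V → ℝ
  cov : V → Finset ℕ

/-- The invariants of the construction. All lengths that are compared with `ρ` are scaled by
`4 * c`. -/
structure Valid {V : Type*} (G : SimpleGraph V) (w : Sym2 V → ℝ≥0) (ρ : ℝ) (c : ℕ)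
    (s : PartialDecomp V) (H : History V) : Prop where
  lab_le : ∀ v, s.lab v ≤ s.m
  pc_le : ∀ v, s.lab v ≠ 0 → s.pc v ≤ s.p
  pc_mono : ∀ v v', s.lab v ≠ 0 → s.lab v < s.lab v' → s.pc v < s.pc v'
  mem_dom : ∀ v, s.lab v ≠ 0 → v ∈ H.dom (s.lab v)
  sees_lt : ∀ i, 1 ≤ i → i ≤ s.m → ∀ j ∈ H.sees i, 1 ≤ j ∧ j < i
  sees_card : ∀ i, 1 ≤ i → i ≤ s.m → (H.sees i).card + 1 ≤ c
  free_mem : ∀ i, 1 ≤ i → i ≤ s.m → ∀ x ∈ H.dom i, ∀ y, G.Adj x y → s.lab y = 0 → y ∈ H.dom i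
  mem_sees : ∀ i, 1 ≤ i → i ≤ s.m → ∀ x ∈ H.dom i, s.lab x ≠ 0 → s.lab x < i →
    s.lab x ∈ H.sees i
  adj_sees : ∀ i, 1 ≤ i → i ≤ s.m → ∀ x ∈ H.dom i, ∀ y, G.Adj x y → s.lab y ≠ 0 → s.lab y < i →
    s.lab y ∈ H.sees i
  boundary_lt : ∀ i, 1 ≤ i → i ≤ s.m → ∀ x ∈ H.dom i, ∀ y, G.Adj x y → y ∉ H.dom i → s.lab y < i
  nested : ∀ i j, 1 ≤ j → j < i → i ≤ s.m → ∀ x ∈ H.dom i, x ∈ H.dom j → H.dom i ⊆ H.dom j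
  buffer : ∀ i, 1 ≤ i → i ≤ s.m → ∀ u ∈ H.sees i, ∀ b < u, (∀ j ∈ H.sees i, j ≤ b ∨ u ≤ j) →
    ∀ x ∈ H.dom i, ∀ y ∉ H.dom u, ∀ l, WalkIn G w (s.above b) x y l → ρ < 4 * c * l
  sees_dom : ∀ i, 1 ≤ i → i ≤ s.m → ∀ u ∈ H.sees i, H.dom i ⊆ H.dom u ∧
    ∃ x ∈ H.dom i, ∃ y, G.Adj x y ∧ s.lab y = u
  connected : ∀ x y, s.lab x ≠ 0 → s.lab y = s.lab x →
    ∃ l, WalkIn G w {v | s.lab v = s.lab x} x y l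
  surj : ∀ i, 1 ≤ i → i ≤ s.m → ∃ x, s.lab x = i
  touch : ∀ x y l, WalkIn G w s.free x y l → ∀ x' y', G.Adj x x' → G.Adj y y' → s.lab x' ≠ 0 →
    s.lab y' ≠ 0 → s.lab x' ≠ s.lab y' →
    ∃ a b, G.Adj a b ∧ s.lab a = s.lab x' ∧ s.lab b = s.lab y'
  cov_subset : ∀ z, s.lab z ≠ 0 → H.cov z ⊆ H.sees (s.lab z)
  cov_lost : ∀ z, s.lab z ≠ 0 → ∀ x, G.Adj z x → ∀ j, SeesLabel G w s x j → j ∉ H.cov z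
  low_spec : ∀ x u, s.lab x = 0 → SeesLabel G w s x u → ∀ y ∉ H.dom u, ∀ l,
    WalkIn G w (s.above (s.low x u)) x y l → ρ < 4 * c * l
  low_le : ∀ z, s.lab z ≠ 0 → ∀ x, G.Adj z x → ∀ u, SeesLabel G w s x u → u ≤ s.lab z → ∀ b < u,
    (b = 0 ∨ SeesLabel G w s x b) → (∀ j ∈ H.sees (s.lab z), b < j → j < u → j ∈ H.cov z) →
    s.low x u ≤ b
  low_eq : ∀ x y l, WalkIn G w s.free x y l → ∀ u, s.low x u = s.low y u
  radius : ∀ z, s.lab z ≠ 0 →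
    ∃ l, WalkIn G w {v | s.lab v ≠ 0 ∧ s.pc v = s.pc z} z (H.cen (s.pc z)) l ∧
      4 * c * l ≤ c * ρ + (H.cov z).card * ρ
  lipschitz : ∀ i, 1 ≤ i → i ≤ s.m → ∀ x ∈ H.dom i, ∀ y ∈ H.dom i, G.Adj x y →
    H.dist i x ≤ H.dist i y + w s(x, y)
  path_mem : ∀ z, s.lab z ≠ 0 → H.path (s.pc z) = 0 ∨ H.path (s.pc z) ∈ H.sees (s.lab z)
  spaced : ∀ z z', s.lab z ≠ 0 → s.lab z' = s.lab z → H.path (s.pc z) = H.path (s.pc z') →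
    s.pc z ≠ s.pc z' →
    ρ < 4 * |H.dist (s.lab z) (H.cen (s.pc z)) - H.dist (s.lab z) (H.cen (s.pc z'))|

/-- The assignment `s'` arises from `s` by growing supernodes with numbers larger than `b` into the
component of `r` in the unassigned vertices; `off x` is the scaled distance up to which the
supernodes have been grown at `x`. -/
structure IsGrowth {V : Type*} (G : SimpleGraph V) (w : Sym2 V → ℝ≥0) (ρ : ℝ) (c : ℕ)
    (s s' : PartialDecomp V) (r : V) (b : ℕ) (off : V → ℝ) : Prop where
  m_eq : s'.m = s.m
  p_eq : s'.p = s.p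
  old : ∀ x, s.lab x ≠ 0 → s'.lab x = s.lab x ∧ s'.pc x = s.pc x ∧ off x = 0
  new : ∀ x, s.lab x = 0 → s'.lab x ≠ 0 → (∃ l, WalkIn G w s.free r x l) ∧ 0 ≤ off x ∧ off x ≤ ρ ∧
    ∃ z a l l', s.lab z ≠ 0 ∧ b < s.lab z ∧ G.Adj z a ∧ WalkIn G w s.free r a l' ∧
      s'.lab x = s.lab z ∧ s'.pc x = s.pc z ∧
      WalkIn G w {v | s'.lab v = s.lab z ∧ s'.pc v = s.pc z} x z l ∧ 4 * c * l ≤ off x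
  off_le : ∀ x, s.lab x = 0 → s'.lab x ≠ 0 → ∀ y, (¬ ∃ l, WalkIn G w s.free r y l) → ∀ l,
    WalkIn G w (s.above b) x y l → off x ≤ 4 * c * l

namespace SeesLabel

variable {V : Type*} {G : SimpleGraph V} {w : Sym2 V → ℝ≥0} {s : PartialDecomp V} {x y : V}
  {j : ℕ} {l : ℝ}

theorem of_walk (h : SeesLabel G w s x j) (hl : WalkIn G w s.free y x l) : SeesLabel G w s y j := by
  obtain ⟨h0, a, l', z, ha, haz, hz⟩ := h
  exact ⟨h0, a, _, z, hl.append ha, haz, hz⟩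

theorem of_adj (hx : s.lab x = 0) (h : G.Adj x y) (hy : s.lab y ≠ 0) :
    SeesLabel G w s x (s.lab y) := ⟨hy, x, 0, y, .refl hx, h, rfl⟩

theorem free (h : SeesLabel G w s x j) : s.lab x = 0 := by
  obtain ⟨-, a, l', z, ha, -⟩ := h
  exact ha.left_mem

end SeesLabel

namespace IsGrowth

variable {V : Type*} {G : SimpleGraph V} {w : Sym2 V → ℝ≥0} {ρ : ℝ} {c : ℕ}
  {s s₁ s₂ : PartialDecomp V} {r : V} {b : ℕ} {off off' : V → ℝ}

theorem refl (hoff : ∀ x, off x = 0) : IsGrowth G w ρ c s s r b off :=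
  ⟨rfl, rfl, fun x _ => ⟨rfl, rfl, hoff x⟩, fun _ h h' => absurd h h', fun _ h h' => absurd h h'⟩

theorem cases (h : IsGrowth G w ρ c s s₁ r b off) {x : V} (hx : s₁.lab x ≠ 0) :
    (s.lab x ≠ 0 ∧ s₁.lab x = s.lab x ∧ s₁.pc x = s.pc x ∧ off x = 0) ∨
    (s.lab x = 0 ∧ (∃ l, WalkIn G w s.free r x l)) := by
  by_cases h0 : s.lab x = 0
  · exact .inr ⟨h0, (h.new x h0 hx).1⟩
  · exact .inl ⟨h0, h.old x h0⟩

theorem free_subset (h : IsGrowth G w ρ c s s₁ r b off) : s₁.free ⊆ s.free := by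
  intro x hx
  by_contra h0
  exact h0 ((h.old x h0).1.symm.trans hx)

theorem off_nonneg (h : IsGrowth G w ρ c s s₁ r b off) {x : V} (hx : s₁.lab x ≠ 0) :
    0 ≤ off x := by
  rcases h.cases hx with h1 | h1
  · exact h1.2.2.2.ge
  · exact (h.new x h1.1 hx).2.1

/-- Every walk that avoids the supernodes up to `b` and leads from an unassigned vertex out of the
component of `r` passes through an edge into the grown region. -/
theorem le_of_leaves (h : IsGrowth G w ρ c s s₁ r b off) {x y : V} {l : ℝ}
    (hx : ∃ l, WalkIn G w s.free r x l) (hx0 : s₁.lab x = 0) (hy : ¬ ∃ l, WalkIn G w s.free r y l)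
    (hl : WalkIn G w (s.above b) x y l) :
    ∃ a v, (∃ l, WalkIn G w s.free r a l) ∧ s₁.lab a = 0 ∧ s₁.lab v ≠ 0 ∧ b < s₁.lab v ∧
      G.Adj v a ∧ off v + 4 * c * w s(v, a) ≤ 4 * c * l := by
  rcases hl.split {v | (∃ l, WalkIn G w s.free r v l) ∧ s₁.lab v = 0} ⟨hx, hx0⟩ with
    h' | ⟨a, ⟨⟨l₀, ha⟩, ha0⟩, v, hv, hav, l₁, l₂, rfl, hl₁, hl₂⟩
  · exact absurd h'.1 hy
  have h1 : 0 ≤ 4 * c * l₁ := by have := hl₁.nonneg; positivity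
  have h2 : 0 ≤ 4 * c * l₂ := by have := hl₂.nonneg; positivity
  have hs : s(v, a) = s(a, v) := Sym2.eq_swap
  by_cases hvR : ∃ l, WalkIn G w s.free r v l
  · have hv0 : s.lab v = 0 := hvR.choose_spec.right_mem
    have hv1 : s₁.lab v ≠ 0 := fun h => hv ⟨hvR, h⟩
    obtain ⟨-, -, -, z, -, -, -, -, hbz, -, -, hz, -⟩ := h.new v hv0 hv1
    refine ⟨a, v, ⟨l₀, ha⟩, ha0, hv1, hz ▸ hbz, hav.symm, ?_⟩
    have := h.off_le v hv0 hv1 y hy l₂ hl₂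
    rw [hs]
    linarith
  · have hv0 : s.lab v ≠ 0 := fun h => hvR ⟨_, ha.concat h hav⟩
    obtain ⟨e1, -, e2⟩ := h.old v hv0
    refine ⟨a, v, ⟨l₀, ha⟩, ha0, e1 ▸ hv0, ?_, hav.symm, ?_⟩
    · rw [e1]; exact hl₂.left_mem.resolve_left hv0
    · rw [hs, e2]
      linarith

/-- A supernode grows by a vertex at minimum distance. -/
theorem step [DecidableEq V] (h : IsGrowth G w ρ c s s₁ r b off) {a z : V}
    (har : ∃ l, WalkIn G w s.free r a l) (ha : s₁.lab a = 0) (hz : s₁.lab z ≠ 0)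
    (hbz : b < s₁.lab z) (hza : G.Adj z a)
    (hmin : ∀ x y, (∃ l, WalkIn G w s.free r x l) → s₁.lab x = 0 → s₁.lab y ≠ 0 →
      b < s₁.lab y → G.Adj y x → off z + 4 * c * w s(z, a) ≤ off y + 4 * c * w s(y, x))
    (hle : off z + 4 * c * w s(z, a) ≤ ρ)
    (hlab : s₂.lab = Function.update s₁.lab a (s₁.lab z))
    (hpc : s₂.pc = Function.update s₁.pc a (s₁.pc z)) (hm : s₂.m = s₁.m) (hp : s₂.p = s₁.p)
    (hoff : off' = Function.update off a (off z + 4 * c * w s(z, a))) :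
    IsGrowth G w ρ c s s₂ r b off' := by
  have la : s₂.lab a = s₁.lab z := by simp [hlab]
  have pa : s₂.pc a = s₁.pc z := by simp [hpc]
  have oa : off' a = off z + 4 * c * w s(z, a) := by simp [hoff]
  have ln : ∀ x, x ≠ a → s₂.lab x = s₁.lab x := fun x hx => by simp [hlab, hx]
  have pn : ∀ x, x ≠ a → s₂.pc x = s₁.pc x := fun x hx => by simp [hpc, hx]
  have on : ∀ x, x ≠ a → off' x = off x := fun x hx => by simp [hoff, hx]
  have hoz := h.off_nonneg hz
  have ha0 : s.lab a = 0 := h.free_subset ha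
  have sub : ∀ i q, i ≠ 0 → {v | s₁.lab v = i ∧ s₁.pc v = q} ⊆
      {v | s₂.lab v = i ∧ s₂.pc v = q} := by
    rintro i q hi v ⟨rfl, rfl⟩
    have : v ≠ a := by rintro rfl; exact hi ha
    exact ⟨ln v this, pn v this⟩
  refine ⟨hm.trans h.m_eq, hp.trans h.p_eq, ?_, ?_, ?_⟩
  · intro x hx
    have : x ≠ a := by rintro rfl; exact hx ha0
    rw [ln x this, pn x this, on x this]
    exact h.old x hx
  · intro x hx hx2
    by_cases hxa : x = a
    · subst hxa
      rw [oa, la, pa]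
      refine ⟨har, by positivity, hle, ?_⟩
      have hw : (w s(x, z) : ℝ) = w s(z, x) := by rw [Sym2.eq_swap]
      rcases h.cases hz with ⟨h1, h2, h3, h4⟩ | ⟨h1, -⟩
      · obtain ⟨l', har⟩ := har
        refine ⟨z, x, _, l', h1, h2 ▸ hbz, hza, har, h2, h3,
          .single ⟨la.trans h2, pa.trans h3⟩ ?_ hza.symm, ?_⟩
        · have : z ≠ x := hza.ne
          exact ⟨(ln z this).trans h2, (pn z this).trans h3⟩
        · rw [hw, h4, zero_add]
      · obtain ⟨-, -, -, z₀, a₀, l, l', h2, h3, h4, h5, h6, h7, h8, h9⟩ := h.new z h1 hz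
        refine ⟨z₀, a₀, _, l', h2, h3, h4, h5, h6, h7,
          .cons ⟨la.trans h6, pa.trans h7⟩ hza.symm (h8.mono (sub _ _ h2)), ?_⟩
        rw [hw]
        linarith
    · rw [ln x hxa] at hx2
      rw [ln x hxa, pn x hxa, on x hxa]
      obtain ⟨h1, h2, h3, z₀, a₀, l, l', h4, h5, h6, h7, h8, h9, h10, h11⟩ := h.new x hx hx2
      exact ⟨h1, h2, h3, z₀, a₀, l, l', h4, h5, h6, h7, h8, h9, h10.mono (sub _ _ h4), h11⟩
  · intro x hx hx2 y hy l hl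
    by_cases hxa : x = a
    · subst hxa
      rw [oa]
      obtain ⟨a', v, h1, h2, h3, h4, h5, h6⟩ := h.le_of_leaves har ha hy hl
      exact (hmin a' v h1 h2 h3 h4 h5).trans h6
    · rw [ln x hxa] at hx2
      rw [on x hxa]
      exact h.off_le x hx hx2 y hy l hl

end IsGrowth

namespace Valid

variable {V : Type*} {G : SimpleGraph V} {w : Sym2 V → ℝ≥0} {ρ : ℝ} {c : ℕ}
  {s s' : PartialDecomp V} {H : History V}

theorem walk_mem_dom (hs : Valid G w ρ c s H) {i : ℕ} (h1 : 1 ≤ i) (hm : i ≤ s.m) {x y : V} {l : ℝ}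
    (h : WalkIn G w s.free x y l) (hx : x ∈ H.dom i) : y ∈ H.dom i := by
  induction h with
  | refl => exact hx
  | cons _ hxy p ih => exact ih (hs.free_mem i h1 hm _ hx _ hxy p.left_mem)

theorem seesLabel_range (hs : Valid G w ρ c s H) {r : V} {j : ℕ} (h : SeesLabel G w s r j) :
    1 ≤ j ∧ j ≤ s.m := by
  obtain ⟨h0, x, l, y, -, -, rfl⟩ := h
  exact ⟨Nat.one_le_iff_ne_zero.2 h0, hs.lab_le y⟩

theorem mem_dom_of_sees (hs : Valid G w ρ c s H) {r : V} {j : ℕ} (h : SeesLabel G w s r j) :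
    r ∈ H.dom j := by
  obtain ⟨h1, hm⟩ := hs.seesLabel_range h
  obtain ⟨h0, x, l, y, hx, hxy, rfl⟩ := h
  exact hs.walk_mem_dom h1 hm hx.symm
    (hs.free_mem _ h1 hm y (hs.mem_dom y h0) x hxy.symm hx.right_mem)

theorem mem_sees_of_sees (hs : Valid G w ρ c s H) {r : V} {i j : ℕ} (hi : SeesLabel G w s r i)
    (hj : SeesLabel G w s r j) (hji : j < i) : j ∈ H.sees i := by
  have hr := hs.mem_dom_of_sees hi
  obtain ⟨h1, hm⟩ := hs.seesLabel_range hi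
  obtain ⟨h0, x, l, y, hx, hxy, rfl⟩ := hj
  exact hs.adj_sees i h1 hm x (hs.walk_mem_dom h1 hm hx hr) y hxy h0 hji

/-- The assignment after all vertices of a component have been added to supernodes that can be
reached within scaled distance `ρ` without passing through supernodes up to `b`. Here `b` and `u`
are consecutive in the set of supernodes seen by the component. -/
theorem grow (hs : Valid G w ρ c s H) (hρ : 0 ≤ ρ) {r : V} (hr : s.lab r = 0) {b u : ℕ}
    (hu : SeesLabel G w s r u) (hb : b = 0 ∨ SeesLabel G w s r b) (hbu : b < u)
    (hgap : ∀ j, SeesLabel G w s r j → j ≤ b ∨ u ≤ j) (hlow : b < s.low r u) {off : V → ℝ}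
    (hg : IsGrowth G w ρ c s s' r b off)
    (hend : ∀ x z, (∃ l, WalkIn G w s.free r x l) → s'.lab x = 0 → s'.lab z ≠ 0 → b < s'.lab z →
      G.Adj z x → ρ < off z + 4 * c * w s(z, x))
    (hin : ∀ x, (∃ l, WalkIn G w s.free r x l) → ∀ v, s'.low x v = if v = u then b else s.low x v)
    (hout : ∀ x, (¬ ∃ l, WalkIn G w s.free r x l) → s'.low x = s.low x) :
    ∃ H', Valid G w ρ c s' H' := by
  classical
  have fsub := hg.free_subset
  set R : Set V := {v | ∃ l, WalkIn G w s.free r v l} with hR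
  have hRr : r ∈ R := ⟨0, .refl hr⟩
  have hRfree : ∀ x ∈ R, s.lab x = 0 := fun x ⟨l, h⟩ => h.right_mem
  have hRsees : ∀ x ∈ R, ∀ j, SeesLabel G w s x j ↔ SeesLabel G w s r j :=
    fun x ⟨l, h⟩ j => ⟨fun hj => hj.of_walk h, fun hj => hj.of_walk h.symm⟩
  have hRwalk : ∀ x y l, WalkIn G w s.free x y l → x ∈ R → y ∈ R :=
    fun x y l h ⟨l', h'⟩ => ⟨_, h'.append h⟩
  have hRlow : ∀ x ∈ R, ∀ v, s.low x v = s.low r v := fun x ⟨l, h⟩ v => (hs.low_eq _ _ _ h v).symm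
  have lo : ∀ x, s.lab x ≠ 0 → s'.lab x = s.lab x := fun x hx => (hg.old x hx).1
  have po : ∀ x, s.lab x ≠ 0 → s'.pc x = s.pc x := fun x hx => (hg.old x hx).2.1
  -- every assigned vertex is represented by a previously assigned vertex
  have rep : ∀ x, s'.lab x ≠ 0 → ∃ z, s.lab z ≠ 0 ∧ s'.lab x = s.lab z ∧ s'.pc x = s.pc z ∧
      (x = z ∨ (x ∈ R ∧ u ≤ s.lab z ∧ (∃ a ∈ R, G.Adj z a) ∧
        ∃ l, WalkIn G w {v | s'.lab v = s.lab z ∧ s'.pc v = s.pc z} x z l ∧ 4 * c * l ≤ ρ)) := by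
    intro x hx
    by_cases h0 : s.lab x = 0
    · obtain ⟨h1, h2, h3, z, a, l, l', h4, h5, h6, h7, h8, h9, h10, h11⟩ := hg.new x h0 hx
      refine ⟨z, h4, h8, h9, .inr ⟨h1, ?_, ⟨a, ⟨l', h7⟩, h6⟩, l, h10, h11.trans h3⟩⟩
      have := (SeesLabel.of_adj h7.right_mem h6.symm h4).of_walk h7
      exact (hgap _ this).resolve_left (by omega)
    · exact ⟨x, h0, lo x h0, po x h0, .inl rfl⟩
  choose! f hf0 hfl hfp hf using rep
  have fo : ∀ x, s.lab x ≠ 0 → f x = x := by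
    intro x hx
    rcases hf x (by rw [lo x hx]; exact hx) with h | h
    · exact h.symm
    · exact absurd (hRfree x h.1) hx
  have fsees : ∀ x, s'.lab x ≠ 0 → s.lab x = 0 → SeesLabel G w s r (s.lab (f x)) := by
    intro x hx h0
    rcases hf x hx with h | ⟨-, -, ⟨a, ha, hza⟩, -⟩
    · exact absurd (h ▸ h0) (hf0 x hx)
    · exact (hRsees a ha _).1 (SeesLabel.of_adj (hRfree a ha) hza.symm (hf0 x hx))
  have newR : ∀ x, s'.lab x ≠ 0 → s.lab x = 0 → x ∈ R := fun x hx h0 => (hg.new x h0 hx).1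
  have sees' : ∀ x j, SeesLabel G w s' x j → SeesLabel G w s x j := by
    rintro x j ⟨h0, y, l, z, hl, hyz, rfl⟩
    have hl := hl.mono fsub
    by_cases hz : s.lab z = 0
    · rw [hfl z h0]
      obtain ⟨l', hzR⟩ := newR z h0 hz
      refine SeesLabel.of_walk ?_ (hl.concat hz hyz)
      exact (hRsees z ⟨l', hzR⟩ _).2 (fsees z h0 hz)
    · rw [lo z hz]
      exact (SeesLabel.of_adj hl.right_mem hyz hz).of_walk hl
  have asub : ∀ b, s'.above b ⊆ s.above b := by
    rintro b x hx
    by_cases h0 : s.lab x = 0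
    · exact .inl h0
    · have hx : s'.lab x = 0 ∨ b < s'.lab x := hx
      rw [lo x h0] at hx
      exact hx
  have hm := hg.m_eq
  have hudom : R ⊆ H.dom u := fun x hx => hs.mem_dom_of_sees ((hRsees x hx u).2 hu)
  let H' : History V := { H with
    cov := fun x => if s.lab x = 0 then
      H.cov (f x) ∪ (H.sees (s.lab (f x))).filter (fun j => b < j ∧ j < u) else H.cov x }
  have covo : ∀ x, s.lab x ≠ 0 → H'.cov x = H.cov x := fun x hx => if_neg hx
  have covn : ∀ x, s.lab x = 0 → H'.cov x =
      H.cov (f x) ∪ (H.sees (s.lab (f x))).filter (fun j => b < j ∧ j < u) := fun x hx => if_pos hx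
  refine ⟨H', ?_⟩
  constructor
  · intro v
    by_cases h : s'.lab v = 0
    · omega
    · rw [hfl v h, hm]; exact hs.lab_le _
  · intro v hv
    rw [hfp v hv, hg.p_eq]; exact hs.pc_le _ (hf0 v hv)
  · intro v v' hv hvv'
    have hv' : s'.lab v' ≠ 0 := by omega
    rw [hfl v hv, hfl v' hv'] at hvv'
    rw [hfp v hv, hfp v' hv']
    exact hs.pc_mono _ _ (hf0 v hv) hvv'
  · intro v hv
    by_cases h0 : s.lab v = 0
    · have h1 := (hRsees v (newR v hv h0) _).2 (fsees v hv h0)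
      rw [hfl v hv]
      exact hs.mem_dom_of_sees h1
    · rw [lo v h0]; exact hs.mem_dom v h0
  · rw [hm]; exact hs.sees_lt
  · rw [hm]; exact hs.sees_card
  · rw [hm]
    exact fun i h1 hi x hx y hxy hy => hs.free_mem i h1 hi x hx y hxy (fsub hy)
  · rw [hm]
    intro i h1 hi x hx hx0 hxi
    by_cases h0 : s.lab x = 0
    · rw [hfl x hx0] at hxi ⊢
      obtain ⟨-, a, l, y, ha, hay, hy⟩ := (hRsees x (newR x hx0 h0) _).2 (fsees x hx0 h0)
      rw [← hy] at hxi ⊢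
      exact hs.adj_sees i h1 hi a (hs.walk_mem_dom h1 hi ha hx) y hay
        (by rw [hy]; exact hf0 x hx0) hxi
    · rw [lo x h0] at hxi ⊢
      exact hs.mem_sees i h1 hi x hx h0 hxi
  · rw [hm]
    intro i h1 hi x hx y hxy hy0 hyi
    by_cases h0 : s.lab y = 0
    · rw [hfl y hy0] at hyi ⊢
      obtain ⟨-, a, l, v, ha, hav, hv⟩ := (hRsees y (newR y hy0 h0) _).2 (fsees y hy0 h0)
      rw [← hv] at hyi ⊢
      exact hs.adj_sees i h1 hi a (hs.walk_mem_dom h1 hi ha (hs.free_mem i h1 hi x hx y hxy h0))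
        v hav (by rw [hv]; exact hf0 y hy0) hyi
    · rw [lo y h0] at hyi ⊢
      exact hs.adj_sees i h1 hi x hx y hxy h0 hyi
  · rw [hm]
    intro i h1 hi x hx y hxy hy
    by_cases h0 : s.lab y = 0
    · exact absurd (hs.free_mem i h1 hi x hx y hxy h0) hy
    · rw [lo y h0]; exact hs.boundary_lt i h1 hi x hx y hxy hy
  · rw [hm]; exact hs.nested
  · rw [hm]
    exact fun i h1 hi v hv b' hb' hj x hx y hy l hl =>
      hs.buffer i h1 hi v hv b' hb' hj x hx y hy l (hl.mono (asub _))
  · rw [hm]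
    intro i h1 hi v hv
    obtain ⟨h2, x, hx, y, hxy, rfl⟩ := hs.sees_dom i h1 hi v hv
    refine ⟨h2, x, hx, y, hxy, lo y ?_⟩
    have := hs.sees_lt i h1 hi _ hv
    omega
  · intro x y hx hxy
    have key : ∀ x, s'.lab x ≠ 0 → ∃ l, WalkIn G w {v | s'.lab v = s'.lab x} x (f x) l := by
      intro x hx
      rcases hf x hx with h | ⟨-, -, -, l, h, -⟩
      · exact ⟨0, by rw [← h]; exact .refl rfl⟩
      · exact ⟨l, h.mono fun v hv => hv.1.trans (hfl x hx).symm⟩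
    have hy : s'.lab y ≠ 0 := by omega
    obtain ⟨l₁, h₁⟩ := key x hx
    obtain ⟨l₂, h₂⟩ := key y hy
    rw [hxy] at h₂
    obtain ⟨l₃, h₃⟩ := hs.connected (f x) (f y) (hf0 x hx) (by rw [← hfl x hx, ← hfl y hy, hxy])
    refine ⟨_, (h₁.append (h₃.mono fun v hv => ?_)).append h₂.symm⟩
    rw [Set.mem_ofPred_eq] at hv
    rw [Set.mem_ofPred_eq, lo v (hv ▸ hf0 x hx), hv, hfl x hx]
  · rw [hm]
    intro i h1 hi
    obtain ⟨x, rfl⟩ := hs.surj i h1 hi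
    exact ⟨x, lo x (by omega)⟩
  · intro x y l hl x' y' hxx' hyy' hx' hy' hne
    have s1 : SeesLabel G w s x (s'.lab x') :=
      sees' _ _ ⟨hx', x, 0, x', .refl hl.left_mem, hxx', rfl⟩
    have s2 : SeesLabel G w s y (s'.lab y') :=
      sees' _ _ ⟨hy', y, 0, y', .refl hl.right_mem, hyy', rfl⟩
    obtain ⟨-, a, l₁, a', h1, h2, h3⟩ := s1
    obtain ⟨-, b, l₂, b', h4, h5, h6⟩ := s2
    rw [← h3, ← h6] at hne ⊢
    rw [← h3] at hx'
    rw [← h6] at hy'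
    obtain ⟨v, v', hv, h7, h8⟩ := hs.touch a b _ ((h1.symm.append (hl.mono fsub)).append h4) a' b'
      h2 h5 hx' hy' hne
    exact ⟨v, v', hv, (lo v (by omega)).trans h7, (lo v' (by omega)).trans h8⟩
  · intro z hz
    rw [hfl z hz]
    by_cases h0 : s.lab z = 0
    · rw [covn z h0]
      exact Finset.union_subset (hs.cov_subset _ (hf0 z hz)) (Finset.filter_subset _ _)
    · rw [covo z h0, fo z h0]
      exact hs.cov_subset z h0
  · intro z hz x hzx j hj
    have hj' := sees' x j hj
    by_cases h0 : s.lab z = 0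
    · have hxR : x ∈ R := hRwalk z x _ (.single h0 hj'.free hzx) (newR z hz h0)
      have hjr := (hRsees x hxR j).1 hj'
      rw [covn z h0, Finset.mem_union, Finset.mem_filter]
      rcases hf z hz with h | ⟨-, -, ⟨a, ha, hza⟩, -⟩
      · exact absurd (h ▸ h0) (hf0 z hz)
      rintro (h | h)
      · exact hs.cov_lost _ (hf0 z hz) a hza j ((hRsees a ha j).2 hjr) h
      · have := hgap j hjr
        omega
    · rw [covo z h0]
      exact hs.cov_lost z h0 x hzx j hj'
  · intro x v hx hv y hy l hl
    have hv' := sees' x v hv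
    by_cases hxR : x ∈ R
    · rw [hin x hxR] at hl
      split_ifs at hl with hvu
      · subst hvu
        obtain ⟨a, z, h1, h2, h3, h4, h5, h6⟩ :=
          hg.le_of_leaves hxR hx (fun h => hy (hudom h)) (hl.mono (asub _))
        exact (hend a z h1 h2 h3 h4 h5).trans_le h6
      · exact hs.low_spec x v (fsub hx) hv' y hy l (hl.mono (asub _))
    · rw [hout x hxR] at hl
      exact hs.low_spec x v (fsub hx) hv' y hy l (hl.mono (asub _))
  · intro z hz x hzx v hv hvz b' hb' hb0 hj
    have hv' := sees' x v hv
    have hb0' := hb0.imp id (sees' x b')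
    rw [hfl z hz] at hvz hj
    by_cases hxR : x ∈ R
    · have hvr := (hRsees x hxR v).1 hv'
      have hb0r := hb0'.imp id (hRsees x hxR b').1
      rw [hin x hxR]
      -- some assigned neighbor of the component stands for `z`
      obtain ⟨a, ha, hza⟩ : ∃ a ∈ R, G.Adj (f z) a := by
        rcases hf z hz with h | ⟨-, -, h, -⟩
        · exact ⟨x, hxR, h ▸ hzx⟩
        · exact h
      have hfr : SeesLabel G w s r (s.lab (f z)) :=
        (hRsees a ha _).1 (SeesLabel.of_adj (hRfree a ha) hza.symm (hf0 z hz))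
      have hlost : ∀ j, SeesLabel G w s r j → b' < j → j < v → False := by
        intro j hjr h1 h2
        have hjc := hj j (hs.mem_sees_of_sees hfr hjr (by omega)) h1 h2
        by_cases h0 : s.lab z = 0
        · rw [covn z h0, Finset.mem_union, Finset.mem_filter] at hjc
          rcases hjc with h | h
          · exact hs.cov_lost _ (hf0 z hz) a hza j ((hRsees a ha j).2 hjr) h
          · have := hgap j hjr
            omega
        · rw [covo z h0, ← fo z h0] at hjc
          exact hs.cov_lost _ (hf0 z hz) a hza j ((hRsees a ha j).2 hjr) hjc
      split_ifs with hvu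
      · subst hvu
        rcases hb with rfl | hb
        · exact Nat.zero_le _
        · by_contra h
          exact hlost b hb (by omega) hbu
      · rw [hRlow x hxR, ← hRlow a ha]
        refine hs.low_le (f z) (hf0 z hz) a hza v ((hRsees a ha v).2 hvr) hvz b' hb'
          (hb0r.imp id (hRsees a ha b').2) fun j hjs h1 h2 => ?_
        have hjc := hj j hjs h1 h2
        by_cases h0 : s.lab z = 0
        · rw [covn z h0, Finset.mem_union, Finset.mem_filter] at hjc
          refine hjc.resolve_right fun h => ?_
          -- the intervals `(b', v)` and `(b, u)` overlap, hence agree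
          have h3 : v ≤ u := by
            by_contra h'
            exact hlost u hu (by omega) (by omega)
          have h4 := (hgap v hvr)
          omega
        · rw [covo z h0, ← fo z h0] at hjc
          exact hjc
    · have hz0 : s.lab z ≠ 0 := fun h0 => hxR
        (hRwalk z x _ (.single h0 hv'.free hzx) (newR z hz h0))
      rw [hout x hxR]
      rw [fo z hz0] at hvz hj
      rw [covo z hz0] at hj
      exact hs.low_le z hz0 x hzx v hv' hvz b' hb' hb0' hj
  · intro x y l hl v
    have hl := hl.mono fsub
    by_cases hxR : x ∈ R
    · rw [hin x hxR, hin y (hRwalk x y l hl hxR), hs.low_eq x y l hl]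
    · have hyR : y ∉ R := fun h => hxR (hRwalk y x l hl.symm h)
      rw [hout x hxR, hout y hyR, hs.low_eq x y l hl]
  · intro z hz
    obtain ⟨l, hl, hle⟩ := hs.radius (f z) (hf0 z hz)
    rw [hfp z hz]
    have sub : {v | s.lab v ≠ 0 ∧ s.pc v = s.pc (f z)} ⊆
        {v | s'.lab v ≠ 0 ∧ s'.pc v = s.pc (f z)} :=
      fun v hv => ⟨by rw [lo v hv.1]; exact hv.1, (po v hv.1).trans hv.2⟩
    by_cases h0 : s.lab z = 0
    · rcases hf z hz with h | ⟨-, huz, ⟨a, ha, hza⟩, l', hl', hle'⟩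
      · exact absurd (h ▸ h0) (hf0 z hz)
      have hl'' : WalkIn G w {v | s'.lab v ≠ 0 ∧ s'.pc v = s.pc (f z)} z (f z) l' :=
        hl'.mono fun v hv => ⟨by rw [hv.1]; exact hf0 z hz, hv.2⟩
      refine ⟨_, hl''.append (hl.mono sub), ?_⟩
      obtain ⟨j, hj, hbj, hju, hjc⟩ : ∃ j ∈ H.sees (s.lab (f z)), b < j ∧ j < u ∧
          j ∉ H.cov (f z) := by
        by_contra! hcon
        have := hs.low_le (f z) (hf0 z hz) a hza u ((hRsees a ha u).2 hu) huz b hbu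
          (hb.imp id (hRsees a ha b).2) hcon
        rw [hRlow a ha] at this
        omega
      have hcard : (H.cov (f z)).card + 1 ≤ (H'.cov z).card := by
        rw [Nat.add_one_le_iff]
        apply Finset.card_lt_card
        rw [covn z h0, Finset.ssubset_iff_of_subset Finset.subset_union_left]
        exact ⟨j, Finset.mem_union_right _ (Finset.mem_filter.2 ⟨hj, hbj, hju⟩), hjc⟩
      have h3 : (((H.cov (f z)).card : ℝ) + 1) * ρ ≤ (H'.cov z).card * ρ := by
        gcongr
        exact_mod_cast hcard
      change _ ≤ c * ρ + (H'.cov z).card * ρ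
      linarith
    · rw [fo z h0] at hl hle sub ⊢
      rw [covo z h0]
      exact ⟨l, hl.mono sub, hle⟩
  · rw [hm]; exact hs.lipschitz
  · intro v hv
    rw [hfl v hv, hfp v hv]
    exact hs.path_mem _ (hf0 v hv)
  · intro v v' hv hvv'
    have hv' : s'.lab v' ≠ 0 := by omega
    rw [hfl v hv, hfl v' hv'] at hvv'
    rw [hfp v hv, hfp v' hv', hfl v hv]
    exact hs.spaced _ _ (hf0 v hv) hvv'

end Valid

/-- The assignment `s'` arises from `s` by the creation of a skeleton inside the component of the
unassigned vertices that contains `r`, as a connected set of pieces of skeleton paths. -/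
structure IsSkeleton {V : Type*} (G : SimpleGraph V) (w : Sym2 V → ℝ≥0) (ρ : ℝ)
    (s s' : PartialDecomp V) (r : V) (dist : V → ℝ) (cen : ℕ → V) (path : ℕ → ℕ) : Prop where
  m_eq : s'.m = s.m + 1
  p_le : s.p ≤ s'.p
  old : ∀ x, s.lab x ≠ 0 → s'.lab x = s.lab x ∧ s'.pc x = s.pc x
  new : ∀ x, s.lab x = 0 → s'.lab x ≠ 0 → s'.lab x = s.m + 1 ∧ (∃ l, WalkIn G w s.free r x l) ∧
    s.p < s'.pc x ∧ s'.pc x ≤ s'.p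
  root : s'.lab r = s.m + 1
  connected : ∀ x, s'.lab x = s.m + 1 → ∃ l, WalkIn G w {v | s'.lab v = s.m + 1} x r l
  radius : ∀ x, s'.lab x = s.m + 1 →
    ∃ l, WalkIn G w {v | s'.lab v = s.m + 1 ∧ s'.pc v = s'.pc x} x (cen (s'.pc x)) l ∧ 4 * l ≤ ρ
  path_mem : ∀ x, s'.lab x = s.m + 1 → path (s'.pc x) = 0 ∨
    ∃ y l z, WalkIn G w s.free r y l ∧ G.Adj y z ∧ s.lab z = path (s'.pc x) ∧ s.lab z ≠ 0
  spaced : ∀ x y, s'.lab x = s.m + 1 → s'.lab y = s.m + 1 → path (s'.pc x) = path (s'.pc y) →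
    s'.pc x ≠ s'.pc y → ρ < 4 * |dist (cen (s'.pc x)) - dist (cen (s'.pc y))|

namespace Valid

variable {V : Type*} {G : SimpleGraph V} {w : Sym2 V → ℝ≥0} {ρ : ℝ} {c : ℕ}
  {s s' : PartialDecomp V} {H : History V}

open Classical in
/-- The labels of the supernodes adjacent to the component of `r` in the unassigned vertices. -/
noncomputable def seenLabels (G : SimpleGraph V) (w : Sym2 V → ℝ≥0) (s : PartialDecomp V) (r : V) :
    Finset ℕ :=
  (Finset.range (s.m + 1)).filter (SeesLabel G w s r)

theorem mem_seenLabels (hs : Valid G w ρ c s H) {r : V} {j : ℕ} :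
    j ∈ seenLabels G w s r ↔ SeesLabel G w s r j := by
  classical
  rw [seenLabels, Finset.mem_filter, Finset.mem_range, and_iff_right_iff_imp]
  exact fun h => Nat.lt_succ_of_le (hs.seesLabel_range h).2

/-- In a graph without `K_h`-minor, a component of the unassigned vertices sees at most `h - 2`
supernodes. -/
theorem card_seenLabels [Fintype V] (hs : Valid G w ρ c s H) {r : V} (hr : s.lab r = 0) {h : ℕ}
    (hh : 0 < h) (hG : CliqueMinorFree G h) :
    (seenLabels G w s r).card + 1 ≤ min (h - 1) (Fintype.card V) := by
  classical
  have hex : ∀ j ∈ seenLabels G w s r, ∃ x l y, WalkIn G w s.free r x l ∧ G.Adj x y ∧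
      s.lab y = j := fun j hj => (hs.mem_seenLabels.1 hj).2
  have : Nonempty V := ⟨r⟩
  choose! x l y hl hxy hy using hex
  have hne : ∀ j ∈ seenLabels G w s r, j ≠ 0 := fun j hj => (hs.mem_seenLabels.1 hj).1
  refine le_min ?_ ?_
  · by_contra hcard
    obtain ⟨h, rfl⟩ : ∃ k, h = k + 1 := ⟨h - 1, by omega⟩
    have hcard : h ≤ (seenLabels G w s r).card := by omega
    obtain ⟨S, hS, hSc⟩ := Finset.exists_subset_card_eq hcard
    let f := S.equivFin.symm
    have hf : ∀ a : Fin S.card, (f a : ℕ) ∈ seenLabels G w s r := fun a => hS (f a).2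
    subst hSc
    apply hG
    refine ⟨Fin.cons {v | ∃ l, WalkIn G w s.free r v l} (fun a => {v | s.lab v = f a}), ?_, ?_, ?_⟩
    · intro a
      refine Fin.cases ?_ (fun a => ?_) a
      · refine connected_induce_of_walkIn (w := w) (r := r) ⟨0, .refl hr⟩ ?_
        have key : ∀ u v l, WalkIn G w s.free u v l → (∃ l, WalkIn G w s.free r u l) →
            ∃ l, WalkIn G w {v | ∃ l, WalkIn G w s.free r v l} u v l := by
          intro u v l h
          induction h with
          | refl _ => exact fun h => ⟨0, .refl h⟩
          | cons hx hxy p ih =>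
            rintro ⟨l, h⟩
            obtain ⟨l', h'⟩ := ih ⟨_, h.concat p.left_mem hxy⟩
            exact ⟨_, .cons ⟨l, h⟩ hxy h'⟩
        rintro v ⟨l, hv⟩
        obtain ⟨l', h'⟩ := key _ _ _ hv ⟨0, .refl hr⟩
        exact ⟨l', h'.symm⟩
      · refine connected_induce_of_walkIn (w := w) (r := y (f a)) (hy _ (hf a)) ?_
        intro v hv
        have hv : s.lab v = f a := hv
        obtain ⟨l, h⟩ := hs.connected v (y (f a)) (hv ▸ hne _ (hf a)) ((hy _ (hf a)).trans hv.symm)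
        exact ⟨l, h.mono fun z hz => Eq.trans hz hv⟩
    · intro a b
      refine Fin.cases ?_ (fun a => ?_) a <;> refine Fin.cases ?_ (fun b => ?_) b <;> intro hab
      · exact absurd rfl hab
      · refine Set.disjoint_left.2 ?_
        rintro v ⟨l, hv⟩ hv'
        exact hne _ (hf b) ((Eq.symm hv').trans hv.right_mem)
      · refine Set.disjoint_left.2 ?_
        rintro v hv' ⟨l, hv⟩
        exact hne _ (hf a) ((Eq.symm hv').trans hv.right_mem)
      · refine Set.disjoint_left.2 fun v hv hv' => hab ?_
        have : f a = f b := Subtype.ext ((Eq.symm hv).trans hv')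
        rw [f.injective this]
    · intro a b hab
      have hab : a ≠ b := hab
      revert hab
      refine Fin.cases ?_ (fun a => ?_) a <;> refine Fin.cases ?_ (fun b => ?_) b <;> intro hab
      · exact absurd rfl hab
      · exact ⟨_, ⟨_, hl _ (hf b)⟩, _, hy _ (hf b), hxy _ (hf b)⟩
      · exact ⟨_, hy _ (hf a), _, ⟨_, hl _ (hf a)⟩, (hxy _ (hf a)).symm⟩
      · have hne' : (f a : ℕ) ≠ f b := fun h => hab (by rw [f.injective (Subtype.ext h)])
        obtain ⟨u, v, huv, hu, hv⟩ := hs.touch _ _ _ ((hl _ (hf a)).symm.append (hl _ (hf b))) _ _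
          (hxy _ (hf a)) (hxy _ (hf b)) (by rw [hy _ (hf a)]; exact hne _ (hf a))
          (by rw [hy _ (hf b)]; exact hne _ (hf b)) (by rwa [hy _ (hf a), hy _ (hf b)])
        exact ⟨u, hu.trans (hy _ (hf a)), v, hv.trans (hy _ (hf b)), huv⟩
  · have h1 : (seenLabels G w s r).card ≤ (Finset.univ.erase r).card := by
      refine Finset.card_le_card_of_injOn y (fun j hj => ?_) (fun j hj j' hj' h => ?_)
      · refine Finset.mem_coe.2 (Finset.mem_erase.2 ⟨fun h => hne j hj ?_, Finset.mem_univ _⟩)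
        rw [← hy j hj, h, hr]
      · rw [← hy j hj, ← hy j' hj', h]
    rw [Finset.card_erase_of_mem (Finset.mem_univ _), Finset.card_univ] at h1
    have : 0 < Fintype.card V := Fintype.card_pos_iff.2 ⟨r⟩
    omega

/-- A new supernode is created. -/
theorem create [Fintype V] (hs : Valid G w ρ c s H) {r : V} (hr : s.lab r = 0) {h : ℕ}
    (hh : 0 < h) (hG : CliqueMinorFree G h) (hc : c = min (h - 1) (Fintype.card V))
    {dist : V → ℝ} {cen : ℕ → V} {path : ℕ → ℕ} (sk : IsSkeleton G w ρ s s' r dist cen path)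
    (hlip : ∀ x l y, WalkIn G w s.free r x l → G.Adj x y → s.lab y = 0 →
      dist x ≤ dist y + w s(x, y))
    (htouch : ∀ x l y, WalkIn G w s.free r x l → G.Adj x y → s.lab y ≠ 0 →
      ∃ a b, G.Adj a b ∧ s'.lab a = s.m + 1 ∧ s.lab b = s.lab y)
    (hscan : ∀ u, SeesLabel G w s r u → ∀ b < u, (∀ j, SeesLabel G w s r j → j ≤ b ∨ u ≤ j) →
      s.low r u ≤ b) {top : ℕ} (htop : top = 0 ∨ SeesLabel G w s r top)
    (hmax : ∀ j, SeesLabel G w s r j → j ≤ top)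
    (hin : ∀ x, (∃ l, WalkIn G w s.free r x l) → ∀ v,
      s'.low x v = if v = s.m + 1 then top else s.low x v)
    (hout : ∀ x, (¬ ∃ l, WalkIn G w s.free r x l) → s'.low x = s.low x) :
    ∃ H', Valid G w ρ c s' H' := by
  classical
  have hcard := hs.card_seenLabels hr hh hG
  rw [← hc] at hcard
  have hmem := fun j => hs.mem_seenLabels (r := r) (j := j)
  set S := seenLabels G w s r
  set R : Set V := {v | ∃ l, WalkIn G w s.free r v l} with hR
  have hRfree : ∀ x ∈ R, s.lab x = 0 := fun x ⟨l, h⟩ => h.right_mem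
  have hRr : r ∈ R := ⟨0, .refl hr⟩
  have hRstep : ∀ x ∈ R, ∀ y, G.Adj x y → s.lab y = 0 → y ∈ R :=
    fun x ⟨l, h⟩ y hxy hy => ⟨_, h.concat hy hxy⟩
  have hSm : ∀ j ∈ S, 1 ≤ j ∧ j ≤ s.m := fun j hj => hs.seesLabel_range ((hmem j).1 hj)
  have hRsees : ∀ x ∈ R, ∀ j, SeesLabel G w s x j ↔ SeesLabel G w s r j :=
    fun x ⟨l, h⟩ j => ⟨fun hj => hj.of_walk h, fun hj => hj.of_walk h.symm⟩
  have hRlow : ∀ x ∈ R, ∀ v, s.low x v = s.low r v := fun x ⟨l, h⟩ v => (hs.low_eq _ _ _ h v).symm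
  have hRdom : ∀ j ∈ S, R ⊆ H.dom j :=
    fun j hj x hx => hs.mem_dom_of_sees ((hRsees x hx j).2 ((hmem j).1 hj))
  let H' : History V :=
    { dom := Function.update H.dom (s.m + 1) R
      sees := Function.update H.sees (s.m + 1) S
      cen := fun q => if q ≤ s.p then H.cen q else cen q
      path := fun q => if q ≤ s.p then H.path q else path q
      dist := Function.update H.dist (s.m + 1) dist
      cov := fun x => if s.lab x = 0 then ∅ else H.cov x }
  have dn : H'.dom (s.m + 1) = R := Function.update_self ..
  have sn : H'.sees (s.m + 1) = S := Function.update_self ..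
  have tn : H'.dist (s.m + 1) = dist := Function.update_self ..
  have dl : ∀ i, i ≤ s.m → H'.dom i = H.dom i := fun i hi => Function.update_of_ne (by omega) ..
  have sl : ∀ i, i ≤ s.m → H'.sees i = H.sees i := fun i hi => Function.update_of_ne (by omega) ..
  have tl : ∀ i, i ≤ s.m → H'.dist i = H.dist i := fun i hi => Function.update_of_ne (by omega) ..
  have covo : ∀ x, s.lab x ≠ 0 → H'.cov x = H.cov x := fun x hx => if_neg hx
  have covn : ∀ x, s.lab x = 0 → H'.cov x = ∅ := fun x hx => if_pos hx
  have lo : ∀ x, s.lab x ≠ 0 → s'.lab x = s.lab x := fun x hx => (sk.old x hx).1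
  have fsub : s'.free ⊆ s.free := by
    intro x hx
    by_contra h
    exact h ((lo x h).symm.trans hx)
  have cases : ∀ x, s'.lab x ≠ 0 → (s.lab x ≠ 0 ∧ s'.lab x = s.lab x ∧ s.lab x ≤ s.m) ∨
      (s.lab x = 0 ∧ s'.lab x = s.m + 1 ∧ x ∈ R) := by
    intro x hx
    by_cases h0 : s.lab x = 0
    · exact .inr ⟨h0, (sk.new x h0 hx).1, (sk.new x h0 hx).2.1⟩
    · exact .inl ⟨h0, lo x h0, hs.lab_le x⟩
  have new : ∀ x, s'.lab x = s.m + 1 → s.lab x = 0 ∧ x ∈ R ∧ s.p < s'.pc x ∧ s'.pc x ≤ s'.p := by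
    intro x hx
    rcases cases x (by omega) with h | h
    · omega
    · exact ⟨h.1, (sk.new x h.1 (by omega)).2⟩
  have hfree : ∀ x, s'.lab x = 0 → s.lab x = 0 := fun x hx => fsub hx
  have hm := sk.m_eq
  have range : ∀ i, i ≤ s'.m → i = s.m + 1 ∨ i ≤ s.m := by intro i hi; omega
  have asub : ∀ b, s'.above b ⊆ s.above b := by
    rintro b x hx
    by_cases h0 : s.lab x = 0
    · exact .inl h0
    · have hx : s'.lab x = 0 ∨ b < s'.lab x := hx
      rw [lo x h0] at hx
      exact hx
  have sees' : ∀ x j, SeesLabel G w s' x j → (j = s.m + 1 ∧ x ∈ R) ∨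
      (j ≤ s.m ∧ SeesLabel G w s x j) := by
    rintro x j ⟨h0, y, l, z, hl, hyz, rfl⟩
    have hl := hl.mono fsub
    rcases cases z h0 with h | h
    · rw [h.2.1]
      exact .inr ⟨h.2.2, (SeesLabel.of_adj hl.right_mem hyz h.1).of_walk hl⟩
    · obtain ⟨l', hy⟩ := hRstep z h.2.2 y hyz.symm hl.right_mem
      exact .inl ⟨h.2.1, _, hy.append hl.symm⟩
  have low' : ∀ x v, v ≤ s.m → s'.low x v = s.low x v := by
    intro x v hv
    by_cases hx : x ∈ R
    · rw [hin x hx, if_neg (by omega)]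
    · rw [hout x hx]
  refine ⟨H', ?_⟩
  constructor
  · intro v
    by_cases h : s'.lab v = 0
    · omega
    · rcases cases v h with h | h <;> omega
  · intro v hv
    rcases cases v hv with h | h
    · rw [(sk.old v h.1).2]
      exact (hs.pc_le v h.1).trans sk.p_le
    · exact (new v h.2.1).2.2.2
  · intro v v' hv hvv'
    rcases cases v hv with h | h <;> rcases cases v' (by omega) with h' | h'
    · rw [(sk.old v h.1).2, (sk.old v' h'.1).2]
      exact hs.pc_mono _ _ h.1 (by omega)
    · rw [(sk.old v h.1).2]
      exact (hs.pc_le v h.1).trans_lt (new v' h'.2.1).2.2.1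
    · omega
    · omega
  · intro v hv
    rcases cases v hv with h | h
    · rw [h.2.1, dl _ h.2.2]; exact hs.mem_dom v h.1
    · rw [h.2.1, dn]; exact h.2.2
  · intro i h1 hi j hj
    rcases range i hi with rfl | hi
    · rw [sn] at hj
      have := hSm j hj
      omega
    · rw [sl i hi] at hj
      exact hs.sees_lt i h1 hi j hj
  · intro i h1 hi
    rcases range i hi with rfl | hi
    · rw [sn]; exact hcard
    · rw [sl i hi]; exact hs.sees_card i h1 hi
  · intro i h1 hi x hx y hxy hy
    rcases range i hi with rfl | hi
    · rw [dn] at hx ⊢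
      exact hRstep x hx y hxy (hfree y hy)
    · rw [dl i hi] at hx ⊢
      exact hs.free_mem i h1 hi x hx y hxy (hfree y hy)
  · intro i h1 hi x hx hx0 hxi
    rcases cases x hx0 with h | h
    · rcases range i hi with rfl | hi
      · rw [dn] at hx
        exact absurd (hRfree x hx) h.1
      · rw [dl i hi] at hx
        rw [sl i hi, h.2.1]
        exact hs.mem_sees i h1 hi x hx h.1 (by omega)
    · omega
  · intro i h1 hi x hx y hxy hy0 hyi
    rcases cases y hy0 with h | h
    · rcases range i hi with rfl | hi
      · rw [dn] at hx
        rw [sn, h.2.1, hmem]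
        obtain ⟨l, hx⟩ := hx
        exact ⟨h.1, x, l, y, hx, hxy, rfl⟩
      · rw [dl i hi] at hx
        rw [sl i hi, h.2.1]
        exact hs.adj_sees i h1 hi x hx y hxy h.1 (by omega)
    · omega
  · intro i h1 hi x hx y hxy hy
    rcases range i hi with rfl | hi
    · rw [dn] at hx hy
      have : s.lab y ≠ 0 := fun h => hy (hRstep x hx y hxy h)
      rw [lo y this]
      exact Nat.lt_succ_of_le (hs.lab_le y)
    · rw [dl i hi] at hx hy
      by_cases h0 : s'.lab y = 0
      · omega
      · rcases cases y h0 with h | h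
        · rw [h.2.1]; exact hs.boundary_lt i h1 hi x hx y hxy hy
        · exact absurd (hs.free_mem i h1 hi x hx y hxy h.1) hy
  · intro i j hj hji hi x hxi hxj
    rw [dl j (by omega)] at hxj ⊢
    rcases range i hi with rfl | hi
    · rw [dn] at hxi ⊢
      obtain ⟨l, hx⟩ := hxi
      rintro v ⟨l', hv⟩
      exact hs.walk_mem_dom hj (by omega) (hx.symm.append hv) hxj
    · rw [dl i hi] at hxi ⊢
      exact hs.nested i j hj hji hi x hxi hxj
  · intro i h1 hi u hu b hbu hgap x hx y hy l hl
    rcases range i hi with rfl | hi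
    · rw [sn] at hu hgap
      rw [dl u (hSm u hu).2] at hy
      rw [dn] at hx
      have hu' := (hmem u).1 hu
      refine hs.low_spec x u (hRfree x hx) ((hRsees x hx u).2 hu') y hy l (hl.mono ?_)
      have := hscan u hu' b hbu fun j hj => hgap j ((hmem j).2 hj)
      rw [hRlow x hx]
      exact (asub b).trans fun v hv => hv.imp id fun h => by omega
    · rw [sl i hi] at hu hgap
      rw [dl i hi] at hx
      rw [dl u (by have := hs.sees_lt i h1 hi u hu; omega)] at hy
      exact hs.buffer i h1 hi u hu b hbu hgap x hx y hy l (hl.mono (asub b))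
  · intro i h1 hi u hu
    rcases range i hi with rfl | hi
    · rw [sn] at hu
      rw [dn, dl u (hSm u hu).2]
      refine ⟨hRdom u hu, ?_⟩
      obtain ⟨h0, x, l, y, hx, hxy, rfl⟩ := (hmem u).1 hu
      exact ⟨x, ⟨l, hx⟩, y, hxy, lo y h0⟩
    · rw [sl i hi] at hu
      have hui := hs.sees_lt i h1 hi u hu
      rw [dl i hi, dl u (by omega)]
      obtain ⟨h2, x, hx, y, hxy, rfl⟩ := hs.sees_dom i h1 hi u hu
      exact ⟨h2, x, hx, y, hxy, lo y (by omega)⟩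
  · intro x y hx hxy
    rcases cases x hx with h | h
    · obtain ⟨l, hl⟩ := hs.connected x y h.1 (by
        rcases cases y (by omega) with h' | h' <;> omega)
      refine ⟨l, hl.mono fun v hv => ?_⟩
      rw [Set.mem_ofPred_eq] at hv ⊢
      rw [lo v (by omega), hv, h.2.1]
    · rw [h.2.1] at hxy
      obtain ⟨l, hl⟩ := sk.connected x h.2.1
      obtain ⟨l', hl'⟩ := sk.connected y hxy
      rw [h.2.1]
      exact ⟨_, hl.append hl'.symm⟩
  · intro i h1 hi
    rcases range i hi with rfl | hi
    · exact ⟨r, sk.root⟩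
    · obtain ⟨x, rfl⟩ := hs.surj i h1 hi
      exact ⟨x, lo x (by omega)⟩
  · intro x y l hl x' y' hxx' hyy' hx' hy' hne
    have hl := hl.mono fsub
    rcases cases x' hx' with h | h <;> rcases cases y' hy' with h' | h'
    · rw [h.2.1, h'.2.1] at hne ⊢
      obtain ⟨a, b, hab, h1, h2⟩ := hs.touch x y l hl x' y' hxx' hyy' h.1 h'.1 hne
      exact ⟨a, b, hab, (lo a (by omega)).trans h1, (lo b (by omega)).trans h2⟩
    · obtain ⟨l', hR⟩ := hRstep y' h'.2.2 y hyy'.symm hl.right_mem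
      obtain ⟨a, b, hab, h1, h2⟩ := htouch x _ x' (hR.append hl.symm) hxx' h.1
      exact ⟨b, a, hab.symm, by rw [lo b (by omega)]; omega, by omega⟩
    · obtain ⟨l', hR⟩ := hRstep x' h.2.2 x hxx'.symm hl.left_mem
      obtain ⟨a, b, hab, h1, h2⟩ := htouch y _ y' (hR.append hl) hyy' h'.1
      exact ⟨a, b, hab, by omega, by rw [lo b (by omega)]; omega⟩
    · omega
  · intro z hz
    rcases cases z hz with h | h
    · rw [covo z h.1, h.2.1, sl _ h.2.2]
      exact hs.cov_subset z h.1
    · rw [covn z h.1]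
      exact Finset.empty_subset _
  · intro z hz x hzx j hj
    rcases cases z hz with h | h
    · rw [covo z h.1]
      intro hjc
      have := hs.sees_lt _ (Nat.one_le_iff_ne_zero.2 h.1) h.2.2 j (hs.cov_subset z h.1 hjc)
      rcases sees' x j hj with h' | h'
      · omega
      · exact hs.cov_lost z h.1 x hzx j h'.2 hjc
    · rw [covn z h.1]
      exact Finset.notMem_empty _
  · intro x u hx hu y hy l hl
    rcases sees' x u hu with ⟨rfl, hxR⟩ | ⟨hum, hu⟩
    · rw [hin x hxR, if_pos rfl] at hl
      rw [dn] at hy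
      rcases hl.split R hxR with h | ⟨a, ha, b, hb, hab, l₁, l₂, -, -, hl₂⟩
      · exact absurd h hy
      · exfalso
        have hb0 : s.lab b ≠ 0 := fun h => hb (hRstep a ha b hab h)
        have h1 := hmax _ ((hRsees a ha _).1 (SeesLabel.of_adj (hRfree a ha) hab hb0))
        have h2 := (asub _ hl₂.left_mem).resolve_left hb0
        omega
    · rw [dl u hum] at hy
      rw [low' x u hum] at hl
      exact hs.low_spec x u (hfree x hx) hu y hy l (hl.mono (asub _))
  · intro z hz x hzx u hu huz b hbu hb hj
    rcases cases z hz with h | h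
    · rw [h.2.1] at huz hj
      rw [sl _ h.2.2, covo z h.1] at hj
      rw [low' x u (by omega)]
      refine hs.low_le z h.1 x hzx u ?_ huz b hbu (hb.imp id fun hb => ?_) hj
      · exact ((sees' x u hu).resolve_left (by omega)).2
      · exact ((sees' x b hb).resolve_left (by omega)).2
    · rw [h.2.1] at huz hj
      rw [sn, covn z h.1] at hj
      have hx0 : s.lab x = 0 := hfree x hu.free
      have hxR : x ∈ R := hRstep z h.2.2 x hzx hx0
      have hgap : ∀ j, SeesLabel G w s r j → j ≤ b ∨ u ≤ j := by
        intro j hjr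
        by_contra hcon
        exact absurd (hj j ((hmem j).2 hjr) (by omega) (by omega)) (Finset.notMem_empty _)
      rw [hin x hxR]
      split_ifs with hum
      · rcases htop with h0 | h0
        · omega
        · have := hgap top h0
          have := hs.seesLabel_range h0
          omega
      · rw [hRlow x hxR]
        exact hscan u ((hRsees x hxR u).1 ((sees' x u hu).resolve_left (by omega)).2) b hbu hgap
  · intro x y l hl v
    have hl := hl.mono fsub
    by_cases hx : x ∈ R
    · obtain ⟨l', h'⟩ := hx
      rw [hin x ⟨l', h'⟩, hin y ⟨_, h'.append hl⟩, hs.low_eq x y l hl]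
    · have hy : ¬ ∃ l, WalkIn G w s.free r y l := fun ⟨l', h'⟩ => hx ⟨_, h'.append hl.symm⟩
      rw [hout x hx, hout y hy, hs.low_eq x y l hl]
  · intro z hz
    rcases cases z hz with h | h
    · obtain ⟨l, hl, hle⟩ := hs.radius z h.1
      have hcen : H'.cen (s.pc z) = H.cen (s.pc z) := if_pos (hs.pc_le z h.1)
      rw [(sk.old z h.1).2, hcen, covo z h.1]
      exact ⟨l, hl.mono fun v hv => ⟨lo v hv.1 ▸ hv.1, (sk.old v hv.1).2.trans hv.2⟩, hle⟩
    · obtain ⟨-, -, h1, h2⟩ := new z h.2.1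
      obtain ⟨l, hl, hle⟩ := sk.radius z h.2.1
      have hcen : H'.cen (s'.pc z) = cen (s'.pc z) := if_neg (by omega)
      rw [hcen, covn z h.1, Finset.card_empty, Nat.cast_zero, zero_mul, add_zero]
      refine ⟨l, hl.mono fun v hv => ⟨by rw [hv.1]; omega, hv.2⟩, ?_⟩
      calc 4 * c * l = c * (4 * l) := by ring
        _ ≤ c * ρ := by gcongr
  · intro i h1 hi x hx y hy hxy
    rcases range i hi with rfl | hi
    · rw [dn] at hx hy
      rw [tn]
      obtain ⟨l, hx⟩ := hx
      exact hlip x l y hx hxy (hRfree y hy)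
    · rw [dl i hi] at hx hy
      rw [tl i hi]
      exact hs.lipschitz i h1 hi x hx y hy hxy
  · intro z hz
    rcases cases z hz with h | h
    · have hp : H'.path (s.pc z) = H.path (s.pc z) := if_pos (hs.pc_le z h.1)
      rw [(sk.old z h.1).2, hp, h.2.1, sl _ h.2.2]
      exact hs.path_mem z h.1
    · have hp : H'.path (s'.pc z) = path (s'.pc z) := if_neg (by have := new z h.2.1; omega)
      rw [hp, h.2.1, sn, hmem]
      refine (sk.path_mem z h.2.1).imp id ?_
      rintro ⟨y, l, v, h1, h2, h3, h4⟩
      exact ⟨h3 ▸ h4, y, l, v, h1, h2, h3⟩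
  · intro z z' hz hzz' hp hne
    rcases cases z hz with h | h
    · have h' : s.lab z' ≠ 0 ∧ s'.lab z' = s.lab z' := by
        rcases cases z' (by omega) with h' | h'
        · exact ⟨h'.1, h'.2.1⟩
        · omega
      have e1 : H'.path (s.pc z) = H.path (s.pc z) := if_pos (hs.pc_le z h.1)
      have e2 : H'.path (s.pc z') = H.path (s.pc z') := if_pos (hs.pc_le z' h'.1)
      have e3 : H'.cen (s.pc z) = H.cen (s.pc z) := if_pos (hs.pc_le z h.1)
      have e4 : H'.cen (s.pc z') = H.cen (s.pc z') := if_pos (hs.pc_le z' h'.1)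
      rw [(sk.old z h.1).2, (sk.old z' h'.1).2] at hp hne ⊢
      rw [e1, e2] at hp
      rw [e3, e4, h.2.1, tl _ h.2.2]
      exact hs.spaced z z' h.1 (by omega) hp hne
    · have hz' : s'.lab z' = s.m + 1 := by omega
      have n1 : ¬ s'.pc z ≤ s.p := by have := new z h.2.1; omega
      have n2 : ¬ s'.pc z' ≤ s.p := by have := new z' hz'; omega
      have e1 : H'.path (s'.pc z) = path (s'.pc z) := if_neg n1
      have e2 : H'.path (s'.pc z') = path (s'.pc z') := if_neg n2
      have e3 : H'.cen (s'.pc z) = cen (s'.pc z) := if_neg n1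
      have e4 : H'.cen (s'.pc z') = cen (s'.pc z') := if_neg n2
      rw [e1, e2] at hp
      rw [e3, e4, h.2.1, tn]
      exact sk.spaced z z' h.2.1 hz' hp hne

end Valid

/-! ### Counting reachable supernodes and pieces -/

namespace Valid

variable {V : Type*} {G : SimpleGraph V} {w : Sym2 V → ℝ≥0} {ρ : ℝ} {c : ℕ}
  {s : PartialDecomp V} {H : History V}

/-- The supernode `y` can be reached from the domain of `i` through supernodes that are not older
than `y`, by a walk of scaled length less than `k * ρ`. -/
def OpenReach (G : SimpleGraph V) (w : Sym2 V → ℝ≥0) (ρ : ℝ) (c : ℕ) (s : PartialDecomp V)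
    (H : History V) (k i y : ℕ) : Prop :=
  1 ≤ y ∧ y ≤ i ∧ H.dom i ⊆ H.dom y ∧
    ∃ x ∈ H.dom i, ∃ z l, WalkIn G w {v | y ≤ s.lab v} x z l ∧ s.lab z = y ∧ 4 * c * l < k * ρ

/-- The supernode `y` is `i`, or is seen by `i`, or can be reached from a supernode seen by `i`
through supernodes that are not older than `y`, by a walk of scaled length less than `k * ρ`. -/
def ClosedReach (G : SimpleGraph V) (w : Sym2 V → ℝ≥0) (ρ : ℝ) (c : ℕ) (s : PartialDecomp V)
    (H : History V) (k i y : ℕ) : Prop :=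
  1 ≤ y ∧ y ≤ i ∧ H.dom i ⊆ H.dom y ∧ (y = i ∨ y ∈ H.sees i ∨
    ∃ b z l, s.lab b ∈ H.sees i ∧ WalkIn G w {v | y ≤ s.lab v} b z l ∧ s.lab z = y ∧
      4 * c * l < k * ρ)

/-- A walk through supernodes that are not older than `y` stays in the domain of `y`, and the
distance function of `y` changes along it by at most its length. -/
theorem walk_dist (hs : Valid G w ρ c s H) {y : ℕ} (h1 : 1 ≤ y) (hm : y ≤ s.m) {a b : V} {l : ℝ}
    (h : WalkIn G w {v | y ≤ s.lab v} a b l) (ha : a ∈ H.dom y) :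
    b ∈ H.dom y ∧ |H.dist y a - H.dist y b| ≤ l := by
  induction h with
  | refl => exact ⟨ha, by simp⟩
  | @cons a v b l hx hxy p ih =>
    have hv : v ∈ H.dom y := by
      by_contra h
      exact absurd (hs.boundary_lt y h1 hm a ha v hxy h) (not_lt.2 p.left_mem)
    obtain ⟨hb, hd⟩ := ih hv
    refine ⟨hb, ?_⟩
    have h2 := hs.lipschitz y h1 hm a ha v hv hxy
    have h3 := hs.lipschitz y h1 hm v hv a ha hxy.symm
    rw [Sym2.eq_swap] at h3
    rw [abs_le] at hd ⊢
    constructor <;> linarith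

/-- A supernode reachable from inside a domain `H.dom j` belongs to the supernodes seen by `j`, or
the walk passes through such a supernode outside of the domain. -/
theorem reach_split (hs : Valid G w ρ c s H) (hall : ∀ v, s.lab v ≠ 0) {j y : ℕ} (h1 : 1 ≤ j)
    (hm : j ≤ s.m) (hyj : y < j) {x z : V} {l : ℝ} (h : WalkIn G w {v | y ≤ s.lab v} x z l)
    (hx : x ∈ H.dom j) (hz : s.lab z = y) :
    y ∈ H.sees j ∨ ∃ b ∉ H.dom j, s.lab b ∈ H.sees j ∧ y ≤ s.lab b ∧ ∃ l₁ l₂, l = l₁ + l₂ ∧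
      WalkIn G w {v | y ≤ s.lab v} x b l₁ ∧ WalkIn G w {v | y ≤ s.lab v} b z l₂ := by
  rcases h.split (H.dom j) hx with h | ⟨a, ha, b, hb, hab, l₁, l₂, rfl, h₁, h₂⟩
  · left
    rw [← hz]
    exact hs.mem_sees j h1 hm z h (hall z) (by omega)
  · refine .inr ⟨b, hb, ?_, h₂.left_mem, _, l₂, rfl,
      (h₁.mono Set.inter_subset_left).concat h₂.left_mem hab, h₂⟩
    exact hs.adj_sees j h1 hm a ha b hab (hall b) (hs.boundary_lt j h1 hm a ha b hab hb)

theorem OpenReach.eq_of_sees_lt (hs : Valid G w ρ c s H) (hall : ∀ v, s.lab v ≠ 0) {k i y b : ℕ}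
    (hi : i ≤ s.m) (h : OpenReach G w ρ c s H k i y) (hb : b < y) (hT : ∀ u ∈ H.sees i, u ≤ b) :
    y = i := by
  obtain ⟨h1, hyi, -, x, hx, z, l, hl, hz, -⟩ := h
  refine hyi.eq_or_lt.resolve_right fun hlt => ?_
  rcases hs.reach_split hall (by omega) hi hlt hl hx hz with h | ⟨v, -, hv, hyv, -⟩
  · have := hT y h; omega
  · have := hT _ hv; omega

theorem ClosedReach.eq_of_sees_lt {k i y b : ℕ} (h : ClosedReach G w ρ c s H k i y) (hb : b < y)
    (hT : ∀ u ∈ H.sees i, u ≤ b) : y = i := by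
  obtain ⟨h1, hyi, -, rfl | h | ⟨v, z, l, hv, hl, -⟩⟩ := h
  · rfl
  · have := hT _ h; omega
  · have := hT _ hv
    have : y ≤ s.lab v := hl.left_mem
    omega

/-- A supernode that `i` can reach and that is not younger than the oldest supernode `u` among those
seen by `i` which are younger than `b`. -/
theorem OpenReach.closedReach (hs : Valid G w ρ c s H) (hall : ∀ v, s.lab v ≠ 0) {k i y b u : ℕ}
    (h1 : 1 ≤ i) (hi : i ≤ s.m) (h : OpenReach G w ρ c s H (k + 1) i y) (hb : b < y)
    (hu : u ∈ H.sees i) (hmin : ∀ j ∈ H.sees i, b < j → u ≤ j) (hyu : y ≤ u) :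
    ClosedReach G w ρ c s H k u y := by
  obtain ⟨hy1, hyi, hdom, x, hx, z, l, hl, hz, hlk⟩ := h
  have hui := hs.sees_lt i h1 hi u hu
  obtain ⟨x₀, hx₀⟩ : ∃ x, x ∈ H.dom i := ⟨x, hx⟩
  have hiu := (hs.sees_dom i h1 hi u hu).1
  have huy : H.dom u ⊆ H.dom y := by
    rcases hyu.eq_or_lt with rfl | h
    · exact subset_rfl
    · exact hs.nested u y hy1 h (by omega) x₀ (hiu hx₀) (hdom hx₀)
  refine ⟨hy1, hyu, huy, ?_⟩
  rcases hyu.eq_or_lt with rfl | hlt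
  · exact .inl rfl
  rcases hs.reach_split hall hui.1 (by omega) hlt hl (hiu hx) hz with
    h | ⟨v, hv, hvu, hyv, l₁, l₂, rfl, hl₁, hl₂⟩
  · exact .inr (.inl h)
  · refine .inr (.inr ⟨v, z, l₂, hvu, hl₂, hz, ?_⟩)
    have key : ρ < 4 * c * l₁ := by
      refine hs.buffer i h1 hi u hu b (by omega) (fun j hj => ?_) x hx v hv l₁
        (hl₁.mono fun z hz => .inr (hb.trans_le hz))
      by_cases hbj : b < j
      · exact .inr (hmin j hj hbj)
      · exact .inl (by omega)
    push_cast at hlk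
    linarith

theorem ClosedReach.openReach (hs : Valid G w ρ c s H) (hall : ∀ v, s.lab v ≠ 0) (hρ : 0 < ρ)
    {k i y b u : ℕ} (h1 : 1 ≤ i) (hi : i ≤ s.m) (h : ClosedReach G w ρ c s H (k + 1) i y)
    (hb : b < y) (hu : u ∈ H.sees i) (hmin : ∀ j ∈ H.sees i, b < j → u ≤ j) (hyu : y ≤ u) :
    OpenReach G w ρ c s H (k + 1) u y := by
  obtain ⟨hy1, hyi, hdom, h⟩ := h
  have hui := hs.sees_lt i h1 hi u hu
  obtain ⟨x₀, hx₀⟩ : ∃ x, x ∈ H.dom i := by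
    obtain ⟨x, hx⟩ := hs.surj i h1 hi
    exact ⟨x, hx ▸ hs.mem_dom x (hall x)⟩
  have hiu := (hs.sees_dom i h1 hi u hu).1
  have huy : H.dom u ⊆ H.dom y := by
    rcases hyu.eq_or_lt with rfl | h
    · exact subset_rfl
    · exact hs.nested u y hy1 h (by omega) x₀ (hiu hx₀) (hdom hx₀)
  have self : y = u → OpenReach G w ρ c s H (k + 1) u y := by
    rintro rfl
    obtain ⟨x, hx⟩ := hs.surj y hy1 (by omega)
    exact ⟨hy1, hyu, huy, x, hx ▸ hs.mem_dom x (hall x), x, 0, .refl hx.ge, hx, by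
      rw [mul_zero]; positivity⟩
  rcases h with rfl | h | ⟨v, z, l, hv, hl, hz, hlk⟩
  · omega
  · exact self (le_antisymm hyu (hmin y h hb))
  · have hyv : y ≤ s.lab v := hl.left_mem
    have huv := hmin _ hv (by omega)
    have hvi := hs.sees_lt i h1 hi _ hv
    refine ⟨hy1, hyu, huy, v, ?_, z, l, hl, hz, hlk⟩
    have hvv := hs.mem_dom v (hall v)
    rcases huv.eq_or_lt with h | h
    · exact h ▸ hvv
    · exact hs.nested _ u hui.1 h (by omega) x₀ ((hs.sees_dom i h1 hi _ hv).1 hx₀) (hiu hx₀) hvv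

/-- Open reachability for even and closed reachability for odd indices. -/
def AltReach (G : SimpleGraph V) (w : Sym2 V → ℝ≥0) (ρ : ℝ) (c : ℕ) (s : PartialDecomp V)
    (H : History V) (K i y : ℕ) : Prop :=
  if Even K then OpenReach G w ρ c s H (K / 2) i y else ClosedReach G w ρ c s H (K / 2) i y

theorem AltReach.range {K i y : ℕ} (h : AltReach G w ρ c s H K i y) :
    1 ≤ y ∧ y ≤ i := by
  unfold AltReach at h
  split_ifs at h
  · exact ⟨h.1, h.2.1⟩
  · exact ⟨h.1, h.2.1⟩

theorem AltReach.pred (hs : Valid G w ρ c s H) (hall : ∀ v, s.lab v ≠ 0) (hρ : 0 < ρ)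
    {K i y b u : ℕ} (h1 : 1 ≤ i) (hi : i ≤ s.m) (h : AltReach G w ρ c s H (K + 2) i y)
    (hb : b < y) (hu : u ∈ H.sees i) (hmin : ∀ j ∈ H.sees i, b < j → u ≤ j) (hyu : y ≤ u) :
    AltReach G w ρ c s H (K + 1) u y := by
  unfold AltReach at h ⊢
  rcases Nat.even_or_odd' K with ⟨k, rfl | rfl⟩
  · rw [if_pos (by simp [parity_simps]), show (2 * k + 2) / 2 = k + 1 by omega] at h
    rw [if_neg (by simp [parity_simps]), show (2 * k + 1) / 2 = k by omega]
    exact h.closedReach hs hall h1 hi hb hu hmin hyu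
  · rw [if_neg (by simp [parity_simps]), show (2 * k + 1 + 2) / 2 = k + 1 by omega] at h
    rw [if_pos (by simp [parity_simps]), show (2 * k + 1 + 1) / 2 = k + 1 by omega]
    exact h.openReach hs hall hρ h1 hi hb hu hmin hyu

theorem AltReach.eq_of_sees_le (hs : Valid G w ρ c s H) (hall : ∀ v, s.lab v ≠ 0) {K i y b : ℕ}
    (hi : i ≤ s.m) (h : AltReach G w ρ c s H K i y) (hb : b < y) (hT : ∀ u ∈ H.sees i, u ≤ b) :
    y = i := by
  unfold AltReach at h
  split_ifs at h
  · exact h.eq_of_sees_lt hs hall hi hb hT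
  · exact h.eq_of_sees_lt hb hT

/-- The number of supernodes larger than `b` that can be reached from the supernode `i`, if every
intermediate supernode sees at most `t` supernodes larger than `b`. -/
theorem card_altReach (hs : Valid G w ρ c s H) (hall : ∀ v, s.lab v ≠ 0) (hρ : 0 < ρ) (K : ℕ) :
    ∀ t b i : ℕ, 1 ≤ i → i ≤ s.m →
      (∀ j, b < j → j ≤ i → H.dom i ⊆ H.dom j → ((H.sees j).filter (b < ·)).card ≤ t) →
      ∀ Q : Finset ℕ, (∀ y ∈ Q, b < y ∧ AltReach G w ρ c s H K i y) →
        Q.card ≤ (K + t).choose t := by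
  induction K with
  | zero =>
    intro t b i h1 hi _ Q hQ
    have : Q = ∅ := by
      refine Finset.eq_empty_of_forall_notMem fun y hy => ?_
      have h := (hQ y hy).2
      rw [AltReach, if_pos Even.zero] at h
      obtain ⟨-, -, -, x, -, z, l, hl, -, hlt⟩ := h
      have := hl.nonneg
      have : 0 ≤ 4 * c * l := by positivity
      simp at hlt
      linarith
    simp [this]
  | succ K ihK =>
    intro t
    induction t with
    | zero =>
      intro b i h1 hi hT Q hQ
      rw [Nat.choose_zero_right]
      refine Finset.card_le_one.2 ?_
      have : ∀ y ∈ Q, y = i := by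
        intro y hy
        obtain ⟨hb, h⟩ := hQ y hy
        refine h.eq_of_sees_le hs hall hi hb fun u hu => ?_
        have := hT i (by have := h.range; omega) le_rfl subset_rfl
        rw [Nat.le_zero, Finset.card_eq_zero, Finset.filter_eq_empty_iff] at this
        exact not_lt.1 (this hu)
      intro y hy y' hy'
      rw [this y hy, this y' hy']
    | succ t iht =>
      intro b i h1 hi hT Q hQ
      by_cases hne : ((H.sees i).filter (b < ·)).Nonempty
      · obtain ⟨u, hu, hmin⟩ := Finset.exists_min_image _ id hne
        rw [Finset.mem_filter] at hu
        have hmin' : ∀ j ∈ H.sees i, b < j → u ≤ j :=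
          fun j hj hbj => hmin j (Finset.mem_filter.2 ⟨hj, hbj⟩)
        have hui := hs.sees_lt i h1 hi u hu.1
        obtain ⟨hiu, x, hx, v, hxv, hv⟩ := hs.sees_dom i h1 hi u hu.1
        rw [← Finset.card_filter_add_card_filter_not (s := Q) (fun y => y ≤ u)]
        have hlow : (Q.filter (fun y => y ≤ u)).card ≤ (K + (t + 1)).choose (t + 1) := by
          rcases Nat.eq_zero_or_pos K with rfl | hK
          · rw [zero_add, Nat.choose_self]
            refine Finset.card_le_one.2 ?_
            have : ∀ y ∈ Q.filter (fun y => y ≤ u), y = u := by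
              intro y hy
              rw [Finset.mem_filter] at hy
              obtain ⟨hb, h⟩ := hQ y hy.1
              rw [AltReach, if_neg (by decide)] at h
              obtain ⟨-, -, -, rfl | h | ⟨v, z, l, -, hl, -, hlt⟩⟩ := h
              · omega
              · exact le_antisymm hy.2 (hmin' y h hb)
              · have := hl.nonneg
                have : 0 ≤ 4 * c * l := by positivity
                simp at hlt
                linarith
            intro y hy y' hy'
            rw [this y hy, this y' hy']
          · obtain ⟨K, rfl⟩ : ∃ k, K = k + 1 := ⟨K - 1, by omega⟩
            refine ihK (t + 1) b u hui.1 (by omega) (fun j hbj hju hdom => ?_) _ fun y hy => ?_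
            · exact hT j hbj (by omega) (hiu.trans hdom)
            · rw [Finset.mem_filter] at hy
              obtain ⟨hb, h⟩ := hQ y hy.1
              exact ⟨hb, h.pred hs hall hρ h1 hi hb hu.1 hmin' hy.2⟩
        have hhigh : (Q.filter (fun y => ¬ y ≤ u)).card ≤ (K + 1 + t).choose t := by
          refine iht u i h1 hi (fun j huj hji hdom => ?_) _ fun y hy => ?_
          · have hj : u ∈ H.sees j := by
              rw [← hv]
              exact hs.adj_sees j (by omega) (by omega) x (hdom hx) v hxv (hall v) (by omega)
            have h2 : (H.sees j).filter (u < ·) ⊆ ((H.sees j).filter (b < ·)).erase u := by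
              intro z hz
              rw [Finset.mem_filter] at hz
              rw [Finset.mem_erase, Finset.mem_filter]
              exact ⟨by omega, hz.1, by omega⟩
            have h3 : _ ≤ _ := Finset.card_le_card h2
            have h4 : ((H.sees j).filter (b < ·)).card ≤ t + 1 := hT j (by omega) hji hdom
            have h5 : u ∈ (H.sees j).filter (b < ·) := Finset.mem_filter.2 ⟨hj, hu.2⟩
            rw [Finset.card_erase_of_mem h5] at h3
            omega
          · rw [Finset.mem_filter] at hy
            exact ⟨by omega, (hQ y hy.1).2⟩
        have h4 : (K + 1 + (t + 1)).choose (t + 1) =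
            (K + 1 + t).choose t + (K + (t + 1)).choose (t + 1) := by
          rw [show K + 1 + (t + 1) = (K + 1 + t) + 1 by ring, Nat.choose_succ_succ,
            show K + (t + 1) = K + 1 + t by ring]
        omega
      · have h5 : Q.card ≤ 1 := by
          refine Finset.card_le_one.2 ?_
          have : ∀ y ∈ Q, y = i := by
            intro y hy
            obtain ⟨hb, h⟩ := hQ y hy
            refine h.eq_of_sees_le hs hall hi hb fun u hu => ?_
            rw [Finset.not_nonempty_iff_eq_empty, Finset.filter_eq_empty_iff] at hne
            exact not_lt.1 (hne hu)
          intro y hy y' hy'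
          rw [this y hy, this y' hy']
        exact h5.trans (Nat.choose_pos (by omega))

/-- The number of supernodes that can be reached from the supernode `i` within scaled distance less
than `k * ρ`. -/
theorem card_openReach (hs : Valid G w ρ c s H) (hall : ∀ v, s.lab v ≠ 0) (hρ : 0 < ρ) {k i : ℕ}
    (h1 : 1 ≤ i) (hi : i ≤ s.m) (Q : Finset ℕ) (hQ : ∀ y ∈ Q, OpenReach G w ρ c s H k i y) :
    Q.card ≤ (2 * k + (c - 1)).choose (c - 1) := by
  refine hs.card_altReach hall hρ (2 * k) (c - 1) 0 i h1 hi (fun j h0 hj _ => ?_) Q fun y hy => ?_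
  · have := hs.sees_card j h0 (by omega)
    have := Finset.card_filter_le (H.sees j) (0 < ·)
    omega
  · refine ⟨(hQ y hy).1, ?_⟩
    rw [AltReach, if_pos (by simp), show 2 * k / 2 = k by omega]
    exact hQ y hy

end Valid

/-- A finite set of real numbers with gaps larger than `σ` and diameter at most `L`. -/
theorem card_le_of_spaced {Q : Finset ℕ} {f : ℕ → ℝ} {σ L : ℝ} (hσ : 0 < σ)
    (hgap : ∀ p ∈ Q, ∀ q ∈ Q, p ≠ q → σ < |f p - f q|) (hdiam : ∀ p ∈ Q, ∀ q ∈ Q, f p - f q ≤ L) :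
    Q.card ≤ ⌊L / σ⌋₊ + 1 := by
  rcases Q.eq_empty_or_nonempty with rfl | hne
  · simp
  obtain ⟨q₀, hq₀, hmin⟩ := Finset.exists_min_image Q f hne
  rw [← Finset.card_range (⌊L / σ⌋₊ + 1)]
  refine Finset.card_le_card_of_injOn (fun q => ⌊(f q - f q₀) / σ⌋₊) (fun q hq => ?_) ?_
  · rw [Finset.mem_coe, Finset.mem_range, Nat.lt_succ_iff]
    apply Nat.floor_le_floor
    gcongr
    exact hdiam q hq q₀ hq₀
  · intro p hp q hq hpq
    by_contra hne
    have h1 := hgap p hp q hq hne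
    have hp0 : 0 ≤ (f p - f q₀) / σ := div_nonneg (sub_nonneg.2 (hmin p hp)) hσ.le
    have hq0 : 0 ≤ (f q - f q₀) / σ := div_nonneg (sub_nonneg.2 (hmin q hq)) hσ.le
    have a1 := Nat.floor_le hp0
    have a2 := Nat.lt_floor_add_one ((f p - f q₀) / σ)
    have a3 := Nat.floor_le hq0
    have a4 := Nat.lt_floor_add_one ((f q - f q₀) / σ)
    have hpq : (⌊(f p - f q₀) / σ⌋₊ : ℝ) = ⌊(f q - f q₀) / σ⌋₊ := by exact_mod_cast hpq
    have h2 : |(f p - f q₀) / σ - (f q - f q₀) / σ| < 1 := by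
      rw [abs_lt]; constructor <;> linarith
    rw [← sub_div, sub_sub_sub_cancel_right, abs_div, abs_of_pos hσ, div_lt_one hσ] at h2
    linarith

namespace Valid

variable {V : Type*} {G : SimpleGraph V} {w : Sym2 V → ℝ≥0} {ρ : ℝ} {c : ℕ}
  {s : PartialDecomp V} {H : History V}

theorem lab_eq_of_pc_eq (hs : Valid G w ρ c s H) {x y : V} (hx : s.lab x ≠ 0) (hy : s.lab y ≠ 0)
    (h : s.pc x = s.pc y) : s.lab x = s.lab y := by
  rcases lt_trichotomy (s.lab x) (s.lab y) with h' | h' | h'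
  · have := hs.pc_mono x y hx h'; omega
  · exact h'
  · have := hs.pc_mono y x hy h'; omega

/-- Every vertex has distance at most `ρ / 2` to the center of its piece. -/
theorem dist_center (hs : Valid G w ρ c s H) (hρ : 0 ≤ ρ) {z : V} (hz : s.lab z ≠ 0) :
    ∃ l, WalkIn G w {v | s.lab v ≠ 0 ∧ s.pc v = s.pc z} z (H.cen (s.pc z)) l ∧ l ≤ ρ / 2 := by
  obtain ⟨l, hl, hle⟩ := hs.radius z hz
  refine ⟨l, hl, ?_⟩
  have h1 := Finset.card_le_card (hs.cov_subset z hz)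
  have h2 := hs.sees_card _ (Nat.one_le_iff_ne_zero.2 hz) (hs.lab_le z)
  have h3 : ((H.cov z).card : ℝ) ≤ c := by exact_mod_cast (by omega : (H.cov z).card ≤ c)
  have h4 : (H.cov z).card * ρ ≤ c * ρ := by gcongr
  have hc : (0 : ℝ) < c := by exact_mod_cast (by omega : 0 < c)
  have : (4 * c) * l ≤ (4 * c) * (ρ / 2) := by linarith
  exact le_of_mul_le_mul_left this (by positivity)

/-- Every piece has strong diameter at most `ρ`. -/
theorem dist_piece (hs : Valid G w ρ c s H) (hρ : 0 ≤ ρ) {x y : V} (hx : s.lab x ≠ 0)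
    (hy : s.lab y ≠ 0) (hxy : s.pc x = s.pc y) :
    ∃ l, WalkIn G w {v | s.lab v ≠ 0 ∧ s.pc v = s.pc x} x y l ∧ l ≤ ρ := by
  obtain ⟨l, hl, hle⟩ := hs.dist_center hρ hx
  obtain ⟨l', hl', hle'⟩ := hs.dist_center hρ hy
  rw [← hxy] at hl'
  exact ⟨_, hl.append hl'.symm, by linarith⟩

/-- The number of pieces that can be reached from a piece within distance `r`. -/
theorem card_pieces (hs : Valid G w ρ c s H) (hall : ∀ v, s.lab v ≠ 0) (hρ : 0 < ρ) {r : ℝ}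
    {k : ℕ} (hk : 4 * c * r < k * ρ) {x₀ : V} (Q : Finset ℕ)
    (hQ : ∀ q ∈ Q, ∃ x z l, s.pc x = s.pc x₀ ∧ s.pc z = q ∧ WalkIn G w {v | q ≤ s.pc v} x z l ∧
      l ≤ r) :
    Q.card ≤ ((⌊(2 * r + 2 * ρ) / (ρ / 4)⌋₊ + 1) * c) * (2 * k + (c - 1)).choose (c - 1) := by
  have : Nonempty V := ⟨x₀⟩
  choose! x z l hx hz hl hlr using hQ
  have h1 : ∀ v, 1 ≤ s.lab v := fun v => Nat.one_le_iff_ne_zero.2 (hall v)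
  have hlx : ∀ q ∈ Q, s.lab (x q) = s.lab x₀ :=
    fun q hq => hs.lab_eq_of_pc_eq (hall _) (hall _) (hx q hq)
  have hl' : ∀ q ∈ Q, WalkIn G w {v | s.lab (z q) ≤ s.lab v} (x q) (z q) (l q) := by
    intro q hq
    refine (hl q hq).mono fun v hv => ?_
    rw [Set.mem_ofPred_eq]
    by_contra h
    rw [not_le] at h
    have := hs.pc_mono v (z q) (hall v) h
    rw [hz q hq] at this
    have hv : q ≤ s.pc v := hv
    omega
  have hxdom : ∀ q ∈ Q, x q ∈ H.dom (s.lab (z q)) := fun q hq =>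
    (hs.walk_dist (h1 _) (hs.lab_le _) (hl' q hq).symm (hs.mem_dom _ (hall _))).1
  have hle : ∀ q ∈ Q, s.lab (z q) ≤ s.lab x₀ := fun q hq => hlx q hq ▸ (hl' q hq).left_mem
  have hc : 0 < c := by have := hs.sees_card _ (h1 x₀) (hs.lab_le x₀); omega
  have hopen : ∀ q ∈ Q, OpenReach G w ρ c s H k (s.lab x₀) (s.lab (z q)) := by
    intro q hq
    have hxq : x q ∈ H.dom (s.lab x₀) := hlx q hq ▸ hs.mem_dom _ (hall _)
    refine ⟨h1 _, hle q hq, ?_, x q, hxq, z q, l q, hl' q hq, rfl, ?_⟩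
    · rcases (hle q hq).eq_or_lt with h | h
      · rw [h]
      · exact hs.nested _ _ (h1 _) h (hs.lab_le _) (x q) hxq (hxdom q hq)
    · refine lt_of_le_of_lt ?_ hk
      have := hlr q hq
      gcongr
  have step₁ := hs.card_openReach hall hρ (h1 x₀) (hs.lab_le x₀) (Q.image fun q => s.lab (z q))
    (k := k) (by
      intro y hy
      obtain ⟨q, hq, rfl⟩ := Finset.mem_image.1 hy
      exact hopen q hq)
  refine (Finset.card_le_mul_card_image (f := fun q => s.lab (z q)) Q
    ((⌊(2 * r + 2 * ρ) / (ρ / 4)⌋₊ + 1) * c) ?_).trans (Nat.mul_le_mul_left _ step₁)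
  intro y hy
  obtain ⟨q₁, hq₁, rfl⟩ := Finset.mem_image.1 hy
  set y := s.lab (z q₁)
  refine (Finset.card_le_mul_card_image_of_maps_to (f := H.path) (t := insert 0 (H.sees y)) ?_
    (⌊(2 * r + 2 * ρ) / (ρ / 4)⌋₊ + 1) ?_).trans (Nat.mul_le_mul_left _ ?_)
  · intro q hq
    rw [Finset.mem_filter] at hq
    have := hs.path_mem (z q) (hall _)
    rw [hz q hq.1, hq.2] at this
    exact Finset.mem_insert.2 this
  · intro a _
    have key : ∀ p ∈ {q ∈ {q ∈ Q | s.lab (z q) = y} | H.path q = a},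
        p ∈ Q ∧ s.lab (z p) = y ∧ H.path p = a := by
      intro p hp
      rw [Finset.mem_filter, Finset.mem_filter] at hp
      exact ⟨hp.1.1, hp.1.2, hp.2⟩
    refine card_le_of_spaced (f := fun q => H.dist y (H.cen q)) (by positivity)
      (fun p hp q hq hpq => ?_) (fun p hp q hq => ?_)
    · obtain ⟨hpQ, hpy, hpa⟩ := key p hp
      obtain ⟨hqQ, hqy, hqa⟩ := key q hq
      have := hs.spaced (z p) (z q) (hall _) (hqy.trans hpy.symm)
        (by rw [hz p hpQ, hz q hqQ, hpa, hqa]) (by rwa [hz p hpQ, hz q hqQ])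
      rw [hpy, hz p hpQ, hz q hqQ] at this
      linarith
    · obtain ⟨hpQ, hpy, -⟩ := key p hp
      obtain ⟨hqQ, hqy, -⟩ := key q hq
      have sub : ∀ v, y ≤ s.lab v → {v' | s.lab v' ≠ 0 ∧ s.pc v' = s.pc v} ⊆
          {v | y ≤ s.lab v} := by
        intro v hv v' hv'
        rwa [Set.mem_ofPred_eq, hs.lab_eq_of_pc_eq hv'.1 (hall v) hv'.2]
      obtain ⟨l₁, hl₁, hle₁⟩ := hs.dist_center hρ.le (hall (z p))
      obtain ⟨l₂, hl₂, hle₂⟩ := hs.dist_center hρ.le (hall (z q))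
      obtain ⟨l₃, hl₃, hle₃⟩ := hs.dist_piece hρ.le (hall (x p)) (hall (x q))
        ((hx p hpQ).trans (hx q hqQ).symm)
      have m₁ := hl' p hpQ
      have m₂ := hl' q hqQ
      rw [hpy] at m₁
      rw [hqy] at m₂
      have hxp : y ≤ s.lab (x p) := m₁.left_mem
      have W := ((((hl₁.mono (sub _ hpy.ge)).symm.append m₁.symm).append
        (hl₃.mono (sub _ hxp))).append m₂).append (hl₂.mono (sub _ hqy.ge))
      rw [hz p hpQ, hz q hqQ] at W
      have hcen : H.cen p ∈ H.dom y := by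
        have h := hl₁.right_mem
        rw [hz p hpQ] at h
        have h2 := hs.lab_eq_of_pc_eq h.1 (hall (z p)) (h.2.trans (hz p hpQ).symm)
        rw [hpy] at h2
        exact h2 ▸ hs.mem_dom _ h.1
      have h3 := (abs_le.1 (hs.walk_dist (h1 _) (hs.lab_le _) W hcen).2).2
      have := hlr p hpQ
      have := hlr q hqQ
      linarith
  · have h2 := hs.sees_card y (h1 _) (hs.lab_le _)
    exact (Finset.card_insert_le _ _).trans h2

end Valid

/-! ### The ordered partition of a complete decomposition -/

namespace Valid

variable {V : Type*} [Fintype V] [DecidableEq V] {G : SimpleGraph V} {w : Sym2 V → ℝ≥0} {ρ : ℝ}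
  {c : ℕ} {s : PartialDecomp V} {H : History V}

theorem exists_order {V : Type*} [Fintype V] [DecidableEq V] (f : V → ℕ) :
    ∃ (P : Finpartition (Finset.univ : Finset V)) (ord : LinearOrder {X // X ∈ P.parts}),
      (∀ X ∈ P.parts, ∀ u ∈ X, ∀ v, v ∈ X ↔ f u = f v) ∧
      ∀ X Y : {X // X ∈ P.parts}, ∀ u ∈ X.1, ∀ v ∈ Y.1, ord.le X Y ↔ f u ≤ f v := by
  classical
  let P := Finpartition.ofSetoid (Setoid.ker f)
  have key : ∀ X ∈ P.parts, ∀ u ∈ X, ∀ v, v ∈ X ↔ f u = f v := by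
    intro X hX u hu v
    rw [← P.part_eq_of_mem hX hu, Finpartition.mem_part_ofSetoid_iff_rel]
    rfl
  have hne : ∀ X : {X // X ∈ P.parts}, ∃ u, u ∈ X.1 := fun X => P.nonempty_of_mem_parts X.2
  choose a ha using hne
  have hinj : Function.Injective fun X => f (a X) := by
    intro X Y h
    refine Subtype.ext ?_
    ext v
    rw [key X.1 X.2 _ (ha X), key Y.1 Y.2 _ (ha Y)]
    exact Eq.congr_left h
  refine ⟨P, LinearOrder.lift' (fun X => f (a X)) hinj, key, fun X Y u hu v hv => ?_⟩
  rw [(key X.1 X.2 u hu _).1 (ha X), (key Y.1 Y.2 v hv _).1 (ha Y)]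
  rfl

theorem choose_le_choose {t k h : ℕ} (ht : t + 2 ≤ h) (hk : h ≤ 2 * k) :
    (2 * k + t).choose t ≤ (h + 2 * k - 2).choose (h - 1) := by
  obtain ⟨g, rfl⟩ : ∃ g, h = g + 2 := ⟨h - 2, by omega⟩
  rw [show g + 2 + 2 * k - 2 = 2 * k + g by omega, show g + 2 - 1 = g + 1 by omega]
  calc (2 * k + t).choose t = (2 * k + t).choose (2 * k) := by
        rw [← Nat.choose_symm_add]
    _ ≤ (2 * k + g).choose (2 * k) := Nat.choose_le_choose _ (by omega)
    _ = (2 * k + g).choose g := by rw [← Nat.choose_symm_add]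
    _ ≤ (2 * k + g).choose (g + 1) := Nat.choose_le_succ_of_lt_half_left (by omega)

/-- The pieces of a complete decomposition form an ordered partition with small weak coloring
numbers. -/
theorem exists_partition (hs : Valid G w ρ c s H) (hall : ∀ v, s.lab v ≠ 0) (hρ : 0 < ρ) {h : ℕ}
    (hh : 0 < h) (hc : c ≤ h - 1) :
    ∃ (P : Finpartition (Finset.univ : Finset V)) (ord : LinearOrder {X // X ∈ P.parts}),
      (∀ X Y : {X // X ∈ P.parts}, ∀ u ∈ X.1, ∀ v ∈ Y.1, ord.le X Y ↔ s.pc u ≤ s.pc v) ∧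
      (∀ X ∈ P.parts, strongDiam G w (X : Set V) ≤ ENNReal.ofReal ρ) ∧
      ∀ r : ℝ, ρ < r → (wcol G w P ord r : ℝ) ≤
        ((h + 2 * ⌈4 * (h : ℝ) * (r / ρ)⌉₊ - 2).choose (h - 1) : ℝ) *
          (12 + 8 * (r / ρ)) * ((h : ℝ) - 1) := by
  classical
  obtain ⟨P, ord, hP, hord⟩ := exists_order s.pc
  refine ⟨P, ord, hord, fun X hX => ?_, fun r hr => ?_⟩
  · refine iSup₂_le fun u hu => iSup₂_le fun v hv => ?_
    have hu : u ∈ X := hu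
    have hv : v ∈ X := hv
    obtain ⟨l, hl, hle⟩ := hs.dist_piece hρ.le (hall u) (hall v) ((hP X hX u hu v).1 hv)
    refine ((hl.mono fun z hz => ?_).distIn_le).trans (ENNReal.ofReal_le_ofReal hle)
    exact (hP X hX u hu z).2 hz.2.symm
  · set k := ⌈4 * (h : ℝ) * (r / ρ)⌉₊ with hk
    have hr0 : 0 < r := hρ.trans hr
    have hh1 : (1 : ℝ) ≤ h := by exact_mod_cast hh
    have hq : 1 < r / ρ := (one_lt_div hρ).2 hr
    have hch : (c : ℝ) ≤ h - 1 := by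
      have : c + 1 ≤ h := by omega
      have : (c : ℝ) + 1 ≤ h := by exact_mod_cast this
      linarith
    have hkle : 4 * (h : ℝ) * (r / ρ) ≤ k := Nat.le_ceil _
    have hkr : 4 * c * r < k * ρ := by
      have h1 : 4 * (h : ℝ) * r ≤ k * ρ := by
        have := mul_le_mul_of_nonneg_right hkle hρ.le
        rwa [mul_assoc, div_mul_cancel₀ _ hρ.ne'] at this
      have h2 : 4 * (c : ℝ) * r < 4 * h * r := by gcongr; omega
      linarith
    have hhk : h ≤ 2 * k := by
      have : (h : ℝ) ≤ 2 * k := by nlinarith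
      exact_mod_cast this
    have bound : 0 ≤ ((h + 2 * k - 2).choose (h - 1) : ℝ) * (12 + 8 * (r / ρ)) * ((h : ℝ) - 1) :=
      mul_nonneg (by positivity) (by linarith)
    have main : ∀ X : {X // X ∈ P.parts}, ((wReach G w P ord r X).card : ℝ) ≤
        ((h + 2 * k - 2).choose (h - 1) : ℝ) * (12 + 8 * (r / ρ)) * ((h : ℝ) - 1) := by
      intro X
      obtain ⟨x₀, hx₀⟩ := P.nonempty_of_mem_parts X.2
      have hne : ∀ Y : {X // X ∈ P.parts}, ∃ u, u ∈ Y.1 := fun Y => P.nonempty_of_mem_parts Y.2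
      choose a ha using hne
      have hcard : (wReach G w P ord r X).card =
          ((wReach G w P ord r X).image fun Y => s.pc (a Y)).card := by
        refine (Finset.card_image_of_injective _ fun Y Z hYZ => ?_).symm
        refine Subtype.ext ?_
        ext v
        rw [hP Y.1 Y.2 _ (ha Y), hP Z.1 Z.2 _ (ha Z)]
        exact Eq.congr_left hYZ
      have hc1 : 1 ≤ c := by
        have := hs.sees_card _ (Nat.one_le_iff_ne_zero.2 (hall x₀)) (hs.lab_le x₀)
        omega
      have key := hs.card_pieces hall hρ hkr (x₀ := x₀)
        ((wReach G w P ord r X).image fun Y => s.pc (a Y)) (by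
          intro q hq
          obtain ⟨Y, hY, rfl⟩ := Finset.mem_image.1 hq
          rw [wReach, Finset.mem_filter] at hY
          obtain ⟨-, x, hx, y, hy, p, -, hp, hle⟩ := hY
          refine ⟨x, y, _, ((hP X.1 X.2 x₀ hx₀ x).1 hx).symm,
            ((hP Y.1 Y.2 _ (ha Y) y).1 hy).symm, WalkIn.of_walk p fun z hz => ?_, hle⟩
          obtain ⟨Z, hYZ, hzZ⟩ := hp z hz
          exact (hord Y Z _ (ha Y) z hzZ).1 hYZ)
      rw [hcard]
      have h1 : ((⌊(2 * r + 2 * ρ) / (ρ / 4)⌋₊ : ℕ) : ℝ) ≤ 8 * (r / ρ) + 8 := by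
        refine (Nat.floor_le (by positivity)).trans (le_of_eq ?_)
        field_simp
        ring
      calc (((wReach G w P ord r X).image fun Y => s.pc (a Y)).card : ℝ)
          ≤ (((⌊(2 * r + 2 * ρ) / (ρ / 4)⌋₊ + 1) * c) * (2 * k + (c - 1)).choose (c - 1) : ℕ) := by
            exact_mod_cast key
        _ = ((2 * k + (c - 1)).choose (c - 1) : ℝ) *
            ((⌊(2 * r + 2 * ρ) / (ρ / 4)⌋₊ : ℕ) + 1) * c := by push_cast; ring
        _ ≤ ((h + 2 * k - 2).choose (h - 1) : ℝ) * (12 + 8 * (r / ρ)) * ((h : ℝ) - 1) := by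
            gcongr ?_ * ?_ * ?_
            · exact_mod_cast choose_le_choose (by omega) hhk
            · linarith
    rw [wcol]
    rcases Finset.univ.eq_empty_or_nonempty (α := {X // X ∈ P.parts}) with he | hne
    · rw [he, Finset.sup_empty]
      simpa using bound
    · obtain ⟨X, -, hX⟩ := Finset.exists_mem_eq_sup Finset.univ hne
        fun X : {X // X ∈ P.parts} => (wReach G w P ord r X).card
      rw [hX]
      exact main X

end Valid

/-! ### Shortest path trees -/

/-- A shortest path tree in the set `F` with root `r` and vertex set `D`, which arises when the
closest vertex is added to the tree in each step. -/
structure ShortestTree {V : Type*} (G : SimpleGraph V) (w : Sym2 V → ℝ≥0) (F : Set V) (r : V)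
    (D : Set V) (d : V → ℝ) (par : V → V) (rk : V → ℕ) (k : ℕ) : Prop where
  root : r ∈ D
  walk : ∀ x ∈ D, ∃ l, WalkIn G w F r x l
  par : ∀ x ∈ D, x ≠ r → par x ∈ D ∧ G.Adj (par x) x ∧ d x = d (par x) + w s(par x, x) ∧
    rk (par x) < rk x
  rk_le : ∀ x ∈ D, rk x ≤ k
  lipschitz : ∀ x ∈ D, ∀ y ∈ D, G.Adj x y → d x ≤ d y + w s(x, y)
  front : ∀ z ∈ D, ∀ y ∈ D, ∀ x ∉ D, x ∈ F → G.Adj z x → d y ≤ d z + w s(z, x)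

namespace ShortestTree

variable {V : Type*} {G : SimpleGraph V} {w : Sym2 V → ℝ≥0} {F D : Set V} {r : V} {d : V → ℝ}
  {par : V → V} {rk : V → ℕ} {k : ℕ}

theorem init (hr : r ∈ F) (par : V → V) : ShortestTree G w F r {r} d par (fun _ => 0) 0 := by
  refine ⟨rfl, ?_, ?_, fun _ _ => le_rfl, ?_, ?_⟩
  · rintro x rfl
    exact ⟨0, .refl hr⟩
  · rintro x rfl h
    exact absurd rfl h
  · rintro x rfl y rfl h
    exact absurd rfl h.ne
  · rintro z rfl y rfl x _ _ _
    exact le_add_of_nonneg_right (NNReal.coe_nonneg _)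

theorem mono (h : ShortestTree G w F r D d par rk k) {k' : ℕ} (hk : k ≤ k') :
    ShortestTree G w F r D d par rk k' :=
  ⟨h.root, h.walk, h.par, fun x hx => (h.rk_le x hx).trans hk, h.lipschitz, h.front⟩

theorem step [DecidableEq V] (h : ShortestTree G w F r D d par rk k) {z x : V} (hz : z ∈ D)
    (hx : x ∉ D) (hxF : x ∈ F) (hzx : G.Adj z x)
    (hmin : ∀ z' ∈ D, ∀ x' ∉ D, x' ∈ F → G.Adj z' x' →
      d z + w s(z, x) ≤ d z' + w s(z', x')) :
    ShortestTree G w F r (insert x D) (Function.update d x (d z + w s(z, x)))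
      (Function.update par x z) (Function.update rk x (k + 1)) (k + 1) := by
  have ne : ∀ y ∈ D, y ≠ x := by rintro y hy rfl; exact hx hy
  have hzn := ne z hz
  constructor
  · exact .inr h.root
  · rintro y (rfl | hy)
    · obtain ⟨l, hl⟩ := h.walk z hz
      exact ⟨_, hl.concat hxF hzx⟩
    · exact h.walk y hy
  · rintro y (rfl | hy) hyr
    · simp only [Function.update_self, Function.update_of_ne hzn]
      exact ⟨.inr hz, hzx, trivial, Nat.lt_succ_of_le (h.rk_le z hz)⟩
    · obtain ⟨h1, h2, h3, h4⟩ := h.par y hy hyr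
      simp only [Function.update_of_ne (ne y hy), Function.update_of_ne (ne _ h1)]
      exact ⟨.inr h1, h2, h3, h4⟩
  · rintro y (rfl | hy)
    · simp
    · rw [Function.update_of_ne (ne y hy)]
      exact (h.rk_le y hy).trans (Nat.le_succ k)
  · rintro y (rfl | hy) y' (rfl | hy') hyy'
    · exact absurd rfl hyy'.ne
    · rw [Function.update_self, Function.update_of_ne (ne y' hy'), Sym2.eq_swap (a := y)]
      exact hmin y' hy' y hx hxF hyy'.symm
    · rw [Function.update_self, Function.update_of_ne (ne y hy)]
      have := h.front z hz y hy y' hx hxF hzx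
      have : (0 : ℝ) ≤ w s(y, y') := NNReal.coe_nonneg _
      linarith
    · rw [Function.update_of_ne (ne y hy), Function.update_of_ne (ne y' hy')]
      exact h.lipschitz y hy y' hy' hyy'
  · intro z' hz' y hy x' hx' hx'F hzx'
    have hx'D : x' ∉ D := fun h => hx' (.inr h)
    have h1 : (Function.update d x (d z + w s(z, x))) y ≤ d z + w s(z, x) := by
      rcases hy with rfl | hy
      · rw [Function.update_self]
      · rw [Function.update_of_ne (ne y hy)]
        exact h.front z hz y hy x hx hxF hzx
    have h2 : d z + w s(z, x) ≤ (Function.update d x (d z + w s(z, x))) z' + w s(z', x') := by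
      rcases hz' with rfl | hz'
      · rw [Function.update_self]
        exact le_add_of_nonneg_right (NNReal.coe_nonneg _)
      · rw [Function.update_of_ne (ne z' hz')]
        exact hmin z' hz' x' hx'D hx'F hzx'
    exact h1.trans h2

theorem mem_iff (h : ShortestTree G w F r D d par rk k)
    (hend : ∀ z ∈ D, ∀ x ∉ D, x ∈ F → ¬ G.Adj z x) (x : V) :
    x ∈ D ↔ ∃ l, WalkIn G w F r x l := by
  refine ⟨h.walk x, ?_⟩
  rintro ⟨l, hl⟩
  have key : ∀ a b l, WalkIn G w F a b l → a ∈ D → b ∈ D := by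
    intro a b l hl
    induction hl with
    | refl => exact id
    | cons hx hxy p ih =>
      intro ha
      refine ih ?_
      by_contra hb
      exact hend _ ha _ hb p.left_mem hxy
  exact key _ _ _ hl h.root

end ShortestTree

/-! ### Skeleton paths -/

/-- The assignment `s₂` arises from `s₁` during the addition of a skeleton path, which is followed
towards the root; `v` is the next vertex of the path, and `d₀` is the distance of the center
of the current piece. -/
structure IsTrace {V : Type*} (G : SimpleGraph V) (w : Sym2 V → ℝ≥0) (ρ : ℝ)
    (s s₁ s₂ : PartialDecomp V) (r : V) (d : V → ℝ) (rk : V → ℕ) (cen : ℕ → V) (path : ℕ → ℕ)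
    (j : ℕ) (v : V) (d₀ : ℝ) : Prop where
  m_eq : s₂.m = s.m + 1
  p_lt : s₁.p < s₂.p
  next : ∃ l, WalkIn G w s.free r v l
  old : ∀ x, s₁.lab x ≠ 0 → s₂.lab x = s₁.lab x ∧ s₂.pc x = s₁.pc x
  new : ∀ x, s₁.lab x = 0 → s₂.lab x ≠ 0 → s₂.lab x = s.m + 1 ∧
    (∃ l, WalkIn G w s.free r x l) ∧ s₁.p < s₂.pc x ∧ s₂.pc x ≤ s₂.p ∧ rk v < rk x ∧
    path (s₂.pc x) = j ∧ d₀ ≤ d (cen (s₂.pc x)) ∧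
    (s₂.pc x ≠ s₂.p → ρ < 4 * (d (cen (s₂.pc x)) - d₀)) ∧
    (∃ l, WalkIn G w (insert v {v | s₂.lab v = s.m + 1}) x v l) ∧
    ∃ l, WalkIn G w {v | s₂.lab v = s.m + 1 ∧ s₂.pc v = s₂.pc x} x (cen (s₂.pc x)) l ∧ 4 * l ≤ ρ
  spaced : ∀ x y, s₁.lab x = 0 → s₂.lab x ≠ 0 → s₁.lab y = 0 → s₂.lab y ≠ 0 →
    s₂.pc x ≠ s₂.pc y → ρ < 4 * |d (cen (s₂.pc x)) - d (cen (s₂.pc y))|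
  center : d₀ = d (cen s₂.p) ∧ path s₂.p = j
  last : cen s₂.p = v ∨
    ∃ y l, s₁.lab y = 0 ∧ s₂.lab y ≠ 0 ∧ s₂.pc y = s₂.p ∧ G.Adj v y ∧ d y = d v + w s(v, y) ∧
      WalkIn G w {v | s₂.lab v = s.m + 1 ∧ s₂.pc v = s₂.p} y (cen s₂.p) l ∧ l ≤ d₀ - d y

/-- The first vertex of a component forms a skeleton. -/
theorem IsSkeleton.init {V : Type*} [DecidableEq V] {G : SimpleGraph V} {w : Sym2 V → ℝ≥0} {ρ : ℝ}
    {s s' : PartialDecomp V} {r : V} {d : V → ℝ} (hρ : 0 ≤ ρ) (hr : s.lab r = 0)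
    (hm : s'.m = s.m + 1) (hp : s'.p = s.p + 1) (hlab : s'.lab = Function.update s.lab r (s.m + 1))
    (hpc : s'.pc = Function.update s.pc r (s.p + 1)) (hle : ∀ v, s.lab v ≤ s.m) :
    IsSkeleton G w ρ s s' r d (fun _ => r) (fun _ => 0) := by
  have lr : s'.lab r = s.m + 1 := by simp [hlab]
  have pr : s'.pc r = s.p + 1 := by simp [hpc]
  have ln : ∀ x, x ≠ r → s'.lab x = s.lab x := fun x hx => by simp [hlab, hx]
  have pn : ∀ x, x ≠ r → s'.pc x = s.pc x := fun x hx => by simp [hpc, hx]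
  have eq : ∀ x, s'.lab x = s.m + 1 → x = r := by
    intro x hx
    by_contra h
    have := hle x
    rw [ln x h] at hx
    omega
  refine ⟨hm, by omega, fun x hx => ?_, fun x hx hx' => ?_, lr, fun x hx => ?_, fun x hx => ?_,
    fun x hx => .inl rfl, fun x y hx hy _ hne => ?_⟩
  · have : x ≠ r := by rintro rfl; exact hx hr
    exact ⟨ln x this, pn x this⟩
  · have : x = r := by
      by_contra h
      exact hx' ((ln x h).trans hx)
    subst this
    exact ⟨lr, ⟨0, .refl hr⟩, by omega, by omega⟩
  · rw [eq x hx]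
    exact ⟨0, .refl lr⟩
  · rw [eq x hx]
    exact ⟨0, .refl ⟨lr, rfl⟩, by simpa using hρ⟩
  · rw [eq x hx, eq y hy] at hne
    exact absurd rfl hne

namespace IsTrace

variable {V : Type*} {G : SimpleGraph V} {w : Sym2 V → ℝ≥0} {ρ : ℝ} {s s₁ s₂ s₃ : PartialDecomp V}
  {r : V} {d : V → ℝ} {rk : V → ℕ} {cen : ℕ → V} {path : ℕ → ℕ} {j : ℕ} {v v' : V} {d₀ d₁ : ℝ}

theorem init (hm : s₁.m = s.m + 1) (hlab : s₂.lab = s₁.lab) (hpc : s₂.pc = s₁.pc)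
    (hm2 : s₂.m = s₁.m) (hp : s₂.p = s₁.p + 1) (hv : ∃ l, WalkIn G w s.free r v l)
    (hd : d₀ = d v) (hcen : cen (s₁.p + 1) = v) (hpath : path (s₁.p + 1) = j) :
    IsTrace G w ρ s s₁ s₂ r d rk cen path j v d₀ := by
  refine ⟨by omega, by omega, hv, fun x _ => by rw [hlab, hpc]; exact ⟨rfl, rfl⟩, ?_, ?_, ?_, ?_⟩
  · rw [hlab]
    exact fun x h h' => absurd h h'
  · rw [hlab]
    exact fun x y h h' => absurd h h'
  · rw [hp, hcen]
    exact ⟨hd, hpath⟩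
  · rw [hp]
    exact .inl hcen

/-- Once the path has reached the old part of the skeleton, it has become a part of the
skeleton. -/
theorem finish {cen₁ : ℕ → V} {path₁ : ℕ → ℕ} (h : IsTrace G w ρ s s₁ s₂ r d rk cen path j v d₀)
    (sk : IsSkeleton G w ρ s s₁ r d cen₁ path₁) (hcen : ∀ q ≤ s₁.p, cen q = cen₁ q)
    (hpath : ∀ q ≤ s₁.p, path q = path₁ q) (hle : ∀ x, s.lab x ≤ s.m)
    (hpathj : ∀ x, s₁.lab x = s.m + 1 → path₁ (s₁.pc x) ≠ j)
    (hj : ∃ y l z, WalkIn G w s.free r y l ∧ G.Adj y z ∧ s.lab z = j ∧ s.lab z ≠ 0)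
    (hv : s₂.lab v ≠ 0) : IsSkeleton G w ρ s s₂ r d cen path := by
  have old2 : ∀ x, s.lab x ≠ 0 → s₂.lab x = s.lab x ∧ s₂.pc x = s.pc x := by
    intro x hx
    obtain ⟨h1, h2⟩ := sk.old x hx
    obtain ⟨h3, h4⟩ := h.old x (by rwa [h1])
    exact ⟨h3.trans h1, h4.trans h2⟩
  have cases : ∀ x, s₂.lab x = s.m + 1 → (s₁.lab x = s.m + 1 ∧ s₂.pc x = s₁.pc x ∧
      s₁.pc x ≤ s₁.p) ∨ (s₁.lab x = 0 ∧ s₂.lab x ≠ 0) := by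
    intro x hx
    by_cases h1 : s₁.lab x = 0
    · exact .inr ⟨h1, by omega⟩
    · obtain ⟨h2, h3⟩ := h.old x h1
      have h0 : s.lab x = 0 := by
        by_contra h0
        have := (old2 x h0).1
        have := hle x
        omega
      exact .inl ⟨by omega, h3, (sk.new x h0 h1).2.2.2⟩
  have sub1 : {v | s₁.lab v = s.m + 1} ⊆ {v | s₂.lab v = s.m + 1} := by
    intro x hx
    rw [Set.mem_ofPred_eq] at hx ⊢
    rw [(h.old x (by omega)).1, hx]
  have hv1 : s₁.lab v = s.m + 1 := by
    have h0 : s.lab v = 0 := by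
      obtain ⟨l, hl⟩ := h.next
      exact hl.right_mem
    by_cases h1 : s₁.lab v = 0
    · exact absurd (h.new v h1 hv).2.2.2.2.1 (lt_irrefl _)
    · exact (sk.new v h0 h1).1
  refine ⟨h.m_eq, sk.p_le.trans h.p_lt.le, old2, fun x hx hx2 => ?_, sub1 sk.root,
    fun x hx => ?_, fun x hx => ?_, fun x hx => ?_, fun x y hx hy hp hne => ?_⟩
  · by_cases h1 : s₁.lab x = 0
    · obtain ⟨a1, a2, a3, a4, -⟩ := h.new x h1 hx2
      exact ⟨a1, a2, sk.p_le.trans_lt a3, a4⟩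
    · obtain ⟨a1, a2, a3, a4⟩ := sk.new x hx h1
      obtain ⟨b1, b2⟩ := h.old x h1
      rw [b1, b2]
      exact ⟨a1, a2, a3, a4.trans h.p_lt.le⟩
  · rcases cases x hx with ⟨h1, -⟩ | ⟨h1, h2⟩
    · obtain ⟨l, hl⟩ := sk.connected x h1
      exact ⟨l, hl.mono sub1⟩
    · obtain ⟨-, -, -, -, -, -, -, -, ⟨l, hl⟩, -⟩ := h.new x h1 h2
      obtain ⟨l', hl'⟩ := sk.connected v hv1
      rw [Set.insert_eq_of_mem (sub1 hv1)] at hl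
      exact ⟨_, hl.append (hl'.mono sub1)⟩
  · rcases cases x hx with ⟨h1, h2, h3⟩ | ⟨h1, h2⟩
    · obtain ⟨l, hl, hle⟩ := sk.radius x h1
      rw [h2, hcen _ h3]
      refine ⟨l, hl.mono fun y hy => ?_, hle⟩
      exact ⟨sub1 hy.1, (h.old y (by rw [hy.1]; omega)).2.trans hy.2⟩
    · obtain ⟨-, -, -, -, -, -, -, -, -, h3⟩ := h.new x h1 h2
      exact h3
  · rcases cases x hx with ⟨h1, h2, h3⟩ | ⟨h1, h2⟩
    · rw [h2, hpath _ h3]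
      exact sk.path_mem x h1
    · obtain ⟨-, -, -, -, -, h3, -⟩ := h.new x h1 h2
      rw [h3]
      exact .inr hj
  · rcases cases x hx with ⟨h1, h2, h3⟩ | ⟨h1, h2⟩ <;> rcases cases y hy with ⟨h1', h2', h3'⟩ |
      ⟨h1', h2'⟩
    · rw [h2, h2'] at hp hne ⊢
      rw [hpath _ h3, hpath _ h3'] at hp
      rw [hcen _ h3, hcen _ h3']
      exact sk.spaced x y h1 h1' hp hne
    · obtain ⟨-, -, -, -, -, h4, -⟩ := h.new y h1' h2'
      rw [h2, h4, hpath _ h3] at hp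
      exact absurd hp (hpathj x h1)
    · obtain ⟨-, -, -, -, -, h4, -⟩ := h.new x h1 h2
      rw [h2', h4, hpath _ h3'] at hp
      exact absurd hp.symm (hpathj y h1')
    · exact h.spaced x y h1 h2 h1' h2' hne

/-- The path is followed by one vertex, which is added to the current piece. -/
theorem step [DecidableEq V] (h : IsTrace G w ρ s s₁ s₂ r d rk cen path j v d₀)
    (hv1 : s₁.lab v = 0) (hv : s₂.lab v = 0)
    (hnext : ∃ l, WalkIn G w s.free r v' l) (hadj : G.Adj v' v) (hd : d v = d v' + w s(v', v))
    (hrk : rk v' < rk v) (hle : 4 * (d₀ - d v) ≤ ρ)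
    (hlab : s₃.lab = Function.update s₂.lab v (s.m + 1))
    (hpc : s₃.pc = Function.update s₂.pc v s₂.p) (hm : s₃.m = s₂.m) (hp : s₃.p = s₂.p) :
    IsTrace G w ρ s s₁ s₃ r d rk cen path j v' d₀ := by
  have lv : s₃.lab v = s.m + 1 := by simp [hlab]
  have pv : s₃.pc v = s₂.p := by simp [hpc]
  have ln : ∀ x, x ≠ v → s₃.lab x = s₂.lab x := fun x hx => by simp [hlab, hx]
  have pn : ∀ x, x ≠ v → s₃.pc x = s₂.pc x := fun x hx => by simp [hpc, hx]
  have nev : ∀ x, s₂.lab x ≠ 0 → x ≠ v := by rintro x hx rfl; exact hx hv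
  have subp : ∀ q, {x | s₂.lab x = s.m + 1 ∧ s₂.pc x = q} ⊆
      {x | s₃.lab x = s.m + 1 ∧ s₃.pc x = q} := by
    rintro q x ⟨h1, h2⟩
    have := nev x (by omega)
    exact ⟨(ln x this).trans h1, (pn x this).trans h2⟩
  have subi : insert v {x | s₂.lab x = s.m + 1} ⊆ insert v' {x | s₃.lab x = s.m + 1} := by
    rintro x (rfl | hx)
    · exact .inr lv
    · rw [Set.mem_ofPred_eq] at hx
      exact .inr ((ln x (nev x (by omega))).trans hx)
  have hstep : WalkIn G w (insert v' {x | s₃.lab x = s.m + 1}) v v' (w s(v, v')) :=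
    .single (.inr lv) (.inl rfl) hadj.symm
  -- the added vertex is close to the center of the current piece
  have hcv : ∃ l, WalkIn G w {x | s₃.lab x = s.m + 1 ∧ s₃.pc x = s₂.p} v (cen s₂.p) l ∧
      l ≤ d₀ - d v := by
    have hvm : v ∈ {x | s₃.lab x = s.m + 1 ∧ s₃.pc x = s₂.p} := ⟨lv, pv⟩
    rcases h.last with h1 | ⟨y, l, h1, h2, h3, h4, h5, h6, h7⟩
    · rw [h1, h.center.1, h1]
      exact ⟨0, .refl hvm, by simp⟩
    · exact ⟨_, .cons hvm h4 (h6.mono (subp _)), by linarith⟩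
  have hc0 : ∀ x, s₁.lab x = 0 → s₂.lab x ≠ 0 → s₂.pc x ≠ s₂.p →
      ρ < 4 * |d (cen (s₂.pc x)) - d (cen s₂.p)| := by
    intro x hx1 hx2 hne
    obtain ⟨-, -, -, -, -, -, -, h8, -⟩ := h.new x hx1 hx2
    rw [← h.center.1]
    exact (h8 hne).trans_le (by gcongr; exact le_abs_self _)
  refine ⟨hm.trans h.m_eq, hp ▸ h.p_lt, hnext, fun x hx => ?_, fun x hx1 hx3 => ?_,
    fun x y hx1 hx3 hy1 hy3 hne => ?_, hp ▸ h.center, .inr ?_⟩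
  · have : x ≠ v := by rintro rfl; exact hx hv1
    rw [ln x this, pn x this]
    exact h.old x hx
  · by_cases hxv : x = v
    · subst hxv
      rw [pv, lv, hp]
      obtain ⟨l, hl, hll⟩ := hcv
      exact ⟨rfl, h.next, h.p_lt, le_rfl, hrk, h.center.2, h.center.1.le,
        fun h => absurd rfl h, ⟨_, hstep⟩, l, hl, by linarith⟩
    · rw [ln x hxv] at hx3
      rw [ln x hxv, pn x hxv, hp]
      obtain ⟨h1, h2, h3, h4, h5, h6, h7, h8, ⟨l, hl⟩, l', hl', hle'⟩ := h.new x hx1 hx3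
      exact ⟨h1, h2, h3, h4, hrk.trans h5, h6, h7, h8, ⟨_, (hl.mono subi).append hstep⟩, l',
        hl'.mono (subp _), hle'⟩
  · by_cases hxv : x = v
    · by_cases hyv : y = v
      · rw [hxv, hyv] at hne
        exact absurd rfl hne
      · subst hxv
        rw [ln y hyv] at hy3
        rw [pv, pn y hyv] at hne ⊢
        rw [abs_sub_comm]
        exact hc0 y hy1 hy3 hne.symm
    · rw [ln x hxv] at hx3
      by_cases hyv : y = v
      · subst hyv
        rw [pv, pn x hxv] at hne ⊢
        exact hc0 x hx1 hx3 hne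
      · rw [ln y hyv] at hy3
        rw [pn x hxv, pn y hyv] at hne ⊢
        exact h.spaced x y hx1 hx3 hy1 hy3 hne
  · obtain ⟨l, hl, hll⟩ := hcv
    rw [hp]
    exact ⟨v, l, hv1, by rw [lv]; omega, pv, hadj, hd, hl, hll⟩

/-- A new piece is begun. -/
theorem cut (h : IsTrace G w ρ s s₁ s₂ r d rk cen path j v d₀) (hlt : ρ < 4 * (d₀ - d v))
    (hρ : 0 ≤ ρ) (hlab : s₃.lab = s₂.lab) (hpc : s₃.pc = s₂.pc) (hm : s₃.m = s₂.m)
    (hp : s₃.p = s₂.p + 1) (hd : d₁ = d v) {cen' : ℕ → V} {path' : ℕ → ℕ}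
    (hcen : ∀ q ≤ s₂.p, cen' q = cen q) (hpath : ∀ q ≤ s₂.p, path' q = path q)
    (hcenv : cen' (s₂.p + 1) = v) (hpathj : path' (s₂.p + 1) = j) :
    IsTrace G w ρ s s₁ s₃ r d rk cen' path' j v d₁ := by
  refine ⟨hm.trans h.m_eq, by have := h.p_lt; omega, h.next,
    fun x hx => by rw [hlab, hpc]; exact h.old x hx, fun x hx1 hx3 => ?_,
    fun x y hx1 hx3 hy1 hy3 hne => ?_, by rw [hp, hcenv]; exact ⟨hd, hpathj⟩,
    .inl (by rw [hp, hcenv])⟩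
  · rw [hlab] at hx3
    obtain ⟨h1, h2, h3, h4, h5, h6, h7, h8, h9, h10⟩ := h.new x hx1 hx3
    rw [hlab, hpc, hcen _ h4, hpath _ h4, hp, hd]
    exact ⟨h1, h2, h3, by omega, h5, h6, by linarith, fun _ => by linarith, h9, h10⟩
  · rw [hlab] at hx3 hy3
    rw [hpc] at hne ⊢
    obtain ⟨-, -, -, hx4, -⟩ := h.new x hx1 hx3
    obtain ⟨-, -, -, hy4, -⟩ := h.new y hy1 hy3
    rw [hcen _ hx4, hcen _ hy4]
    exact h.spaced x y hx1 hx3 hy1 hy3 hne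

end IsTrace

/-! ### Searching for a pair of vertices -/

namespace RAM

/-- The first `n` entries of an array of natural numbers. -/
def State.natCol (s : State) (n a : ℕ) : Fin n → ℕ := fun x => s.nat a x 0

/-- The first `n` entries of an array of real numbers. -/
def State.realCol (s : State) (n a : ℕ) : Fin n → ℝ := fun x => s.real a x 0

/-- The entry `(e, 0)` of an array of natural numbers. -/
def entry (a : ℕ) (e : NatExpr) : NatExpr := .get a e (.lit 0)

/-- The entry `(e, 0)` of an array of real numbers. -/
def realEntry (a : ℕ) (e : NatExpr) : RealExpr := .get a e (.lit 0)

section Columns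

variable {s s' : State} {n a b i j v : ℕ} {x : ℝ}

@[simp] theorem eval_entry (s : State) (a : ℕ) (e : NatExpr) :
    (entry a e).eval s = s.nat a (e.eval s) 0 := rfl

@[simp] theorem evalR_realEntry (s : State) (a : ℕ) (e : NatExpr) :
    (realEntry a e).eval s = s.real a (e.eval s) 0 := rfl

theorem natCol_congr (h : s'.nat a = s.nat a) : s'.natCol n a = s.natCol n a := by
  funext x; simp only [State.natCol, h]

theorem realCol_congr (h : s'.real a = s.real a) : s'.realCol n a = s.realCol n a := by
  funext x; simp only [State.realCol, h]

theorem natCol_writeNat_ne (h : b ≠ a) : (s.writeNat a i j v).natCol n b = s.natCol n b :=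
  natCol_congr (writeNat_nat_ne _ _ _ _ h)

theorem natCol_writeNat (y : Fin n) :
    (s.writeNat a y 0 v).natCol n a = Function.update (s.natCol n a) y v := by
  funext z
  simp [State.natCol, writeNat_nat, Function.update_apply, Fin.ext_iff]

theorem realCol_writeReal (y : Fin n) :
    (s.writeReal a y 0 x).realCol n a = Function.update (s.realCol n a) y x := by
  funext z
  simp [State.realCol, writeReal_real, Function.update_apply, Fin.ext_iff]

end Columns

/-- Record the current candidate of a search. -/
def record : Cmd :=
  .seq (.setNat 10 (.lit 0) (.lit 0) (var 31)) (.setNat 11 (.lit 0) (.lit 0) (var 30))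

/-- The examination of a candidate in a search. -/
def examine (φ lt : Test) : Cmd :=
  .cond φ (.cond (.natLe (var 0) (var 10)) record (.cond lt record .skip)) .skip

/-- Search for a pair `(z, x)` with property `φ` that is minimal with respect to `lt`. The
candidates are stored in the arrays `30` and `31`, and the best pair in the arrays `11` and
`10`. -/
def search (φ lt : Test) : Cmd :=
  .seq (.setNat 10 (.lit 0) (.lit 0) (var 0)) (.forN 30 (.forN 31 (examine φ lt)))

/-- A test that always fails. -/
def never : Test := .natLt (.lit 0) (.lit 0)

/-- The arrays that a search does not change. -/
def SameData (s s' : State) : Prop :=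
  (∀ b, b ≠ 10 → b ≠ 11 → b ≠ 30 → b ≠ 31 → s'.nat b = s.nat b) ∧ s'.real = s.real

theorem SameData.natCol {s s' : State} (h : SameData s s') (n : ℕ) {b : ℕ}
    (h1 : b ≠ 10 := by decide)
    (h2 : b ≠ 11 := by decide) (h3 : b ≠ 30 := by decide) (h4 : b ≠ 31 := by decide) :
    s'.natCol n b = s.natCol n b := natCol_congr (h.1 b h1 h2 h3 h4)

theorem SameData.realCol {s s' : State} (h : SameData s s') (n b : ℕ) :
    s'.realCol n b = s.realCol n b := realCol_congr (by rw [h.2])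

theorem search_same (φ lt : Test) (s : State) : SameData s ((search φ lt).run s) :=
  ⟨fun b h1 h2 h3 h4 => Cmd.run_nat
      (by simp [search, examine, record, Cmd.natWrites, h1.symm, h2.symm, h3.symm, h4.symm]) s,
    funext fun b => Cmd.run_real (by simp [search, examine, record, Cmd.realWrites]) s⟩

/-- The best candidate among those that satisfy `C`. -/
def IsBest {n : ℕ} (Φ C : Fin n → Fin n → Prop) (val : Fin n → Fin n → ℝ) (s : State) : Prop :=
  (s.nat 10 0 0 = n ∧ ∀ z x, C z x → ¬ Φ z x) ∨
  ∃ z x : Fin n, s.nat 10 0 0 = x ∧ s.nat 11 0 0 = z ∧ Φ z x ∧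
    ∀ z' x', C z' x' → Φ z' x' → val z x ≤ val z' x'

theorem search_spec {n : ℕ} {s : State} (hn : s.nat 0 0 0 = n) {φ lt : Test}
    (Φ : Fin n → Fin n → Prop) (val : Fin n → Fin n → ℝ)
    (hφ : ∀ s', SameData s s' → ∀ z x : Fin n, s'.nat 30 0 0 = z → s'.nat 31 0 0 = x →
      (φ.Holds s' ↔ Φ z x))
    (hlt : ∀ s', SameData s s' → ∀ z x z' x' : Fin n, s'.nat 30 0 0 = z → s'.nat 31 0 0 = x →
      s'.nat 11 0 0 = z' → s'.nat 10 0 0 = x' → (lt.Holds s' ↔ val z x < val z' x')) :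
    (((search φ lt).run s).nat 10 0 0 = n ∧ ∀ z x, ¬ Φ z x) ∨
    ∃ z x : Fin n, ((search φ lt).run s).nat 10 0 0 = x ∧
      ((search φ lt).run s).nat 11 0 0 = z ∧ Φ z x ∧
      ∀ z' x', Φ z' x' → val z x ≤ val z' x' := by
  set s₁ := (Cmd.setNat 10 (.lit 0) (.lit 0) (var 0)).run s with hs₁
  have e₁ : s₁.nat 10 0 0 = n := by simp [hs₁, hn]
  have d₁ : SameData s s₁ := ⟨fun b h1 _ _ _ => writeNat_nat_ne _ _ _ _ h1, rfl⟩
  have n0 : ∀ {s'}, SameData s s' → s'.nat 0 0 0 = n := fun h => by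
    rw [h.1 0 (by decide) (by decide) (by decide) (by decide), hn]
  have trans : ∀ {s' s'' : State}, SameData s s' → SameData s' s'' → SameData s s'' :=
    fun h h' => ⟨fun b h1 h2 h3 h4 => (h'.1 b h1 h2 h3 h4).trans (h.1 b h1 h2 h3 h4),
      h'.2.trans h.2⟩
  have w3 : ∀ (s' : State) (a v : ℕ), a = 10 ∨ a = 11 ∨ a = 30 ∨ a = 31 →
      SameData s' (s'.writeNat a 0 0 v) := fun s' a v ha =>
    ⟨fun b h1 h2 h3 h4 => writeNat_nat_ne _ _ _ _ (by omega), rfl⟩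
  have bestW : ∀ (C : Fin n → Fin n → Prop) (s' : State) (a v : ℕ), a = 30 ∨ a = 31 →
      IsBest Φ C val s' → IsBest Φ C val (s'.writeNat a 0 0 v) := by
    intro C s' a v ha h
    rw [IsBest, writeNat_nat_ne _ _ _ _ (by omega), writeNat_nat_ne _ _ _ _ (by omega)]
    exact h
  have main : SameData s ((search φ lt).run s) ∧
      IsBest Φ (fun z _ => z.1 < n) val ((search φ lt).run s) := by
    rw [search, run_seq, ← hs₁]
    refine Cmd.forN_induct (n0 d₁)
      (fun k s' => SameData s s' ∧ IsBest Φ (fun z _ => z.1 < k) val s')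
      ⟨trans d₁ (w3 _ _ _ (by omega)), bestW _ _ _ _ (by omega)
        (.inl ⟨e₁, fun z x h => absurd h (Nat.not_lt_zero _)⟩)⟩ ?_
    rintro k hk s₂ - - h30 ⟨d₂, b₂⟩
    have inner : ∀ s₃, SameData s s₃ → s₃.nat 30 0 0 = k → IsBest Φ (fun z _ => z.1 < k) val s₃ →
        SameData s ((Cmd.forN 31 (examine φ lt)).run s₃) ∧
          ((Cmd.forN 31 (examine φ lt)).run s₃).nat 30 0 0 = k ∧
          IsBest Φ (fun z x => z.1 < k ∨ z.1 = k ∧ x.1 < n) val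
            ((Cmd.forN 31 (examine φ lt)).run s₃) := by
      intro s₃ d₃ e₃ b₃
      refine Cmd.forN_induct (n0 d₃)
        (fun i s' => SameData s s' ∧ s'.nat 30 0 0 = k ∧
          IsBest Φ (fun z x => z.1 < k ∨ z.1 = k ∧ x.1 < i) val s')
        ⟨trans d₃ (w3 _ _ _ (by omega)), by rw [writeNat_nat_ne _ _ _ _ (by omega), e₃],
          bestW _ _ _ _ (by omega) (by simpa using b₃)⟩ ?_
      rintro i hi s₄ - - h31 ⟨d₄, e₄, b₄⟩
      have hφ4 := hφ s₄ d₄ ⟨k, hk⟩ ⟨i, hi⟩ e₄ h31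
      have hn4 := n0 d₄
      have new : ∀ z x : Fin n, (z.1 < k ∨ z.1 = k ∧ x.1 < i + 1) →
          (z.1 < k ∨ z.1 = k ∧ x.1 < i) ∨ (z = ⟨k, hk⟩ ∧ x = ⟨i, hi⟩) := by
        intro z x h
        rw [Fin.ext_iff, Fin.ext_iff]
        simp only
        omega
      have upd : (∀ z x : Fin n, z.1 < k ∨ z.1 = k ∧ x.1 < i → Φ z x →
            val ⟨k, hk⟩ ⟨i, hi⟩ ≤ val z x) → Φ ⟨k, hk⟩ ⟨i, hi⟩ →
          SameData s (record.run s₄) ∧ (record.run s₄).nat 30 0 0 = k ∧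
          IsBest Φ (fun z x => z.1 < k ∨ z.1 = k ∧ x.1 < i + 1) val (record.run s₄) := by
        intro hle hΦ
        refine ⟨trans (trans d₄ (w3 s₄ 10 (s₄.nat 31 0 0) (.inl rfl)))
            (w3 _ 11 _ (.inr (.inl rfl))),
          by simp [record, State.writeNat, e₄], .inr ⟨⟨k, hk⟩, ⟨i, hi⟩,
          by simp [record, State.writeNat, h31],
            by simp [record, State.writeNat, e₄], hΦ, fun z x h h' => ?_⟩⟩
        rcases new z x h with h | ⟨rfl, rfl⟩
        · exact hle z x h h'
        · exact le_rfl
      have key : ∀ t : State, SameData s t ∧ t.nat 30 0 0 = k ∧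
          IsBest Φ (fun z x => z.1 < k ∨ z.1 = k ∧ x.1 < i + 1) val t →
          SameData s (t.writeNat 31 0 0 (i + 1)) ∧ (t.writeNat 31 0 0 (i + 1)).nat 30 0 0 = k ∧
          IsBest Φ (fun z x => z.1 < k ∨ z.1 = k ∧ x.1 < i + 1) val
            (t.writeNat 31 0 0 (i + 1)) := fun t ht =>
        ⟨trans ht.1 (w3 _ _ _ (by omega)), by rw [writeNat_nat_ne _ _ _ _ (by omega), ht.2.1],
          bestW _ _ _ _ (by omega) ht.2.2⟩
      apply key
      rw [examine]
      by_cases hh : φ.Holds s₄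
      · rw [run_cond_pos hh]
        by_cases h10 : (Test.natLe (var 0) (var 10)).Holds s₄
        · rw [run_cond_pos h10]
          rcases b₄ with ⟨-, h⟩ | ⟨z, x, h1, -⟩
          · exact upd (fun z x hzx hΦ => absurd hΦ (h z x hzx)) (hφ4.1 hh)
          · have := x.2
            simp only [holds_natLe, eval_var] at h10
            omega
        · rw [run_cond_neg h10]
          rcases b₄ with ⟨h1, -⟩ | ⟨z, x, h1, h2, h3, h4⟩
          · simp only [holds_natLe, eval_var] at h10
            omega
          have hlt4 := hlt s₄ d₄ ⟨k, hk⟩ ⟨i, hi⟩ z x e₄ h31 h2 h1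
          by_cases hl : lt.Holds s₄
          · rw [run_cond_pos hl]
            exact upd (fun z' x' h h' => ((hlt4.1 hl).trans_le (h4 z' x' h h')).le) (hφ4.1 hh)
          · rw [run_cond_neg hl]
            refine ⟨d₄, e₄, .inr ⟨z, x, h1, h2, h3, fun z' x' h h' => ?_⟩⟩
            rcases new z' x' h with h | ⟨rfl, rfl⟩
            · exact h4 z' x' h h'
            · exact not_lt.1 fun h => hl (hlt4.2 h)
      · rw [run_cond_neg hh]
        refine ⟨d₄, e₄, ?_⟩
        rcases b₄ with ⟨h1, h2⟩ | ⟨z, x, h1, h2, h3, h4⟩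
        · refine .inl ⟨h1, fun z' x' h h' => ?_⟩
          rcases new z' x' h with h | ⟨rfl, rfl⟩
          · exact h2 z' x' h h'
          · exact hh (hφ4.2 h')
        · refine .inr ⟨z, x, h1, h2, h3, fun z' x' h h' => ?_⟩
          rcases new z' x' h with h | ⟨rfl, rfl⟩
          · exact h4 z' x' h h'
          · exact absurd (hφ4.2 h') hh
    obtain ⟨d, -, b⟩ := inner s₂ d₂ h30 b₂
    refine ⟨trans d (w3 _ _ _ (by omega)), bestW _ _ _ _ (by omega) ?_⟩
    have : (fun z x : Fin n => z.1 < k ∨ z.1 = k ∧ x.1 < n) = fun z _ => z.1 < k + 1 := by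
      funext z x
      have := x.2
      exact propext (by omega)
    rwa [this] at b
  have := main.2
  simpa only [IsBest, Fin.is_lt, forall_const] using this

/-- The result of a search for an arbitrary pair. -/
theorem find_spec {n : ℕ} {s : State} (hn : s.nat 0 0 0 = n) {φ : Test} (Φ : Fin n → Fin n → Prop)
    (hφ : ∀ s', SameData s s' → ∀ z x : Fin n, s'.nat 30 0 0 = z → s'.nat 31 0 0 = x →
      (φ.Holds s' ↔ Φ z x)) :
    (((search φ never).run s).nat 10 0 0 = n ∧ ∀ z x, ¬ Φ z x) ∨
    ∃ z x : Fin n, ((search φ never).run s).nat 10 0 0 = x ∧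
      ((search φ never).run s).nat 11 0 0 = z ∧ Φ z x := by
  rcases search_spec (lt := never) hn Φ (fun _ _ => 0) hφ (by simp [never]) with
    h | ⟨z, x, h1, h2, h3, -⟩
  · exact .inl h
  · exact .inr ⟨z, x, h1, h2, h3⟩

end RAM

/-! ### The shortest path tree of a component -/

namespace RAM

/-- The memory holds the input graph and the scaled edge weights. -/
structure Loaded {n : ℕ} (G : SimpleGraph (Fin n)) (w : Sym2 (Fin n) → ℝ≥0) (ρ : ℝ) (c : ℕ)
    (s : State) : Prop where
  size : s.nat 0 0 0 = n
  adj : ∀ z x : Fin n, s.nat 1 z x = 1 ↔ G.Adj z x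
  bound : s.real 0 0 0 = ρ
  weight : ∀ z x : Fin n, G.Adj z x → s.real 1 z x = w s(z, x)
  scaled : ∀ z x : Fin n, G.Adj z x → s.real 2 z x = 4 * c * w s(z, x)

theorem Loaded.congr {n : ℕ} {G : SimpleGraph (Fin n)} {w : Sym2 (Fin n) → ℝ≥0} {ρ : ℝ} {c : ℕ}
    {s t : State} (h : Loaded G w ρ c s) (h0 : t.nat 0 = s.nat 0) (h1 : t.nat 1 = s.nat 1)
    (r0 : t.real 0 = s.real 0) (r1 : t.real 1 = s.real 1) (r2 : t.real 2 = s.real 2) :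
    Loaded G w ρ c t :=
  ⟨by rw [h0, h.size], fun z x => by rw [h1, h.adj], by rw [r0, h.bound],
    fun z x hz => by rw [r1, h.weight z x hz], fun z x hz => by rw [r2, h.scaled z x hz]⟩

/-- Set the first `n` entries of an array to `0`. -/
def clearNat (a : ℕ) : Cmd := .forN 22 (.setNat a (var 22) (.lit 0) (.lit 0))

/-- Set the first `n` entries of an array to `0`. -/
def clearReal (a : ℕ) : Cmd := .forN 22 (.setReal a (var 22) (.lit 0) .zero)

theorem clearNat_spec {s : State} {n a : ℕ} (hn : s.nat 0 0 0 = n) (ha : a ≠ 22) (x : Fin n) :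
    ((clearNat a).run s).natCol n a x = 0 := by
  refine Cmd.forN_induct hn (fun k t => ∀ x : Fin n, x.1 < k → t.natCol n a x = 0)
    (fun x h => absurd h (Nat.not_lt_zero _)) (fun k hk t _ _ ht h x hx => ?_) x x.2
  rw [natCol_writeNat_ne ha, run_setNat, eval_var, ht, eval_lit]
  rw [natCol_writeNat ⟨k, hk⟩]
  by_cases hxk : x = ⟨k, hk⟩
  · simp [hxk]
  · rw [Function.update_of_ne hxk]
    refine h x ?_
    rw [Fin.ext_iff] at hxk
    simp only at hxk
    omega

theorem clearReal_spec {s : State} {n a : ℕ} (hn : s.nat 0 0 0 = n) (x : Fin n) :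
    ((clearReal a).run s).realCol n a x = 0 := by
  refine Cmd.forN_induct hn (fun k t => ∀ x : Fin n, x.1 < k → t.realCol n a x = 0)
    (fun x h => absurd h (Nat.not_lt_zero _)) (fun k hk t _ _ ht h x hx => ?_) x x.2
  rw [realCol_congr (congrFun (writeNat_real _ _ _ _ _) a), run_setReal, eval_var, ht, eval_lit,
    evalR_zero, realCol_writeReal ⟨k, hk⟩]
  by_cases hxk : x = ⟨k, hk⟩
  · simp [hxk]
  · rw [Function.update_of_ne hxk]
    refine h x ?_
    rw [Fin.ext_iff] at hxk
    simp only at hxk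
    omega

/-- The edge from `z` to `x` leads out of the tree into an unassigned vertex. -/
def treeTest : Test :=
  .and (.natEq (entry 5 (var 30)) (.lit 1)) (.and (.not (.natEq (entry 5 (var 31)) (.lit 1)))
    (.and (.natEq (entry 3 (var 31)) (.lit 0)) (.natEq (.get 1 (var 30) (var 31)) (.lit 1))))

/-- The comparison of tentative distances. -/
def treeLt : Test :=
  .realLt (.add (realEntry 4 (var 30)) (.get 1 (var 30) (var 31)))
    (.add (realEntry 4 (var 11)) (.get 1 (var 11) (var 10)))

/-- Add the vertex in the array `10` to the tree. -/
def treeInsert : Cmd :=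
  .seq (.setReal 4 (var 10) (.lit 0) (.add (realEntry 4 (var 11)) (.get 1 (var 11) (var 10))))
    (.seq (.setNat 6 (var 10) (.lit 0) (var 11)) (.setNat 5 (var 10) (.lit 0) (.lit 1)))

/-- Dijkstra's algorithm in the unassigned vertices, with the root in the array `9`. The array `5`
marks the vertices of the tree, and the arrays `4` and `6` hold the distances and the parents. -/
def buildTree : Cmd :=
  .seq (clearNat 5) (.seq (.setNat 5 (var 9) (.lit 0) (.lit 1))
    (.seq (.setReal 4 (var 9) (.lit 0) .zero)
      (.forN 22
        (.seq (search treeTest treeLt) (.cond (.natLt (var 10) (var 0)) treeInsert .skip)))))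

section

variable {n : ℕ} {G : SimpleGraph (Fin n)} {w : Sym2 (Fin n) → ℝ≥0} {ρ : ℝ} {c : ℕ} {s : State}

/-- The memory holds a shortest path tree. -/
def HoldsTree (G : SimpleGraph (Fin n)) (w : Sym2 (Fin n) → ℝ≥0) (F : Set (Fin n)) (r : Fin n)
    (par : Fin n → Fin n) (rk : Fin n → ℕ) (k : ℕ) (s : State) : Prop :=
  ShortestTree G w F r {x | s.natCol n 5 x = 1} (s.realCol n 4) par rk k ∧
    ∀ x, s.natCol n 5 x = 1 → x ≠ r → s.natCol n 6 x = par x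

theorem HoldsTree.congr {F : Set (Fin n)} {r : Fin n} {par : Fin n → Fin n} {rk : Fin n → ℕ}
    {k : ℕ} {t : State} (h : HoldsTree G w F r par rk k s) (h5 : t.natCol n 5 = s.natCol n 5)
    (h6 : t.natCol n 6 = s.natCol n 6) (r4 : t.realCol n 4 = s.realCol n 4) :
    HoldsTree G w F r par rk k t := by
  rw [HoldsTree, h5, h6, r4]
  exact h

theorem buildTree_spec (hs : Loaded G w ρ c s) {r : Fin n} (hr : s.nat 9 0 0 = r)
    (hr0 : s.natCol n 3 r = 0) :
    ∃ par rk, HoldsTree G w {x | s.natCol n 3 x = 0} r par rk n (buildTree.run s) ∧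
      ∀ x, (buildTree.run s).natCol n 5 x = 1 ↔
        ∃ l, WalkIn G w {x | s.natCol n 3 x = 0} r x l := by
  classical
  set F : Set (Fin n) := {x | s.natCol n 3 x = 0} with hF
  rw [buildTree, run_seq, run_seq, run_seq]
  set s₁ := (clearNat 5).run s with hs₁
  have c₁ : ∀ x, s₁.natCol n 5 x = 0 := clearNat_spec hs.size (by decide)
  have n₁ : ∀ b, b ≠ 5 → b ≠ 22 → s₁.nat b = s.nat b := fun b h1 h2 =>
    Cmd.run_nat (by simp [clearNat, Cmd.natWrites, h1.symm, h2.symm]) s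
  have r₁ : s₁.real = s.real := funext fun b => Cmd.run_real rfl s
  set s₂ := (Cmd.setReal 4 (var 9) (.lit 0) .zero).run
    ((Cmd.setNat 5 (var 9) (.lit 0) (.lit 1)).run s₁) with hs₂
  have n₂ : ∀ b, b ≠ 5 → b ≠ 22 → s₂.nat b = s.nat b := fun b h1 h2 =>
    (writeNat_nat_ne _ _ _ _ h1).trans (n₁ b h1 h2)
  have c₂ : s₂.natCol n 5 = Function.update (s₁.natCol n 5) r 1 := by
    have : s₁.nat 9 0 0 = r := by rw [n₁ 9 (by decide) (by decide), hr]
    rw [← natCol_writeNat, ← this]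
    rfl
  have r₂ : ∀ b, b ≠ 4 → s₂.real b = s.real b := fun b h =>
    (writeReal_real_ne _ _ _ _ h).trans (by rw [run_setNat, writeNat_real, r₁])
  have D₂ : {x | s₂.natCol n 5 x = 1} = {r} := by
    ext x
    rw [Set.mem_ofPred_eq, c₂, Set.mem_singleton_iff]
    by_cases h : x = r <;> simp [h, c₁]
  have ls₂ : Loaded G w ρ c s₂ := hs.congr (n₂ 0 (by decide) (by decide))
    (n₂ 1 (by decide) (by decide)) (r₂ 0 (by decide)) (r₂ 1 (by decide)) (r₂ 2 (by decide))
  let I : ℕ → State → Prop := fun k t => ∃ par rk, HoldsTree G w F r par rk k t ∧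
      ((∀ z x, t.natCol n 5 z = 1 → t.natCol n 5 x ≠ 1 → x ∈ F → ¬ G.Adj z x) ∨
        (Finset.univ.filter fun x => t.natCol n 5 x ≠ 1).card + k + 1 ≤ n)
  have key : I n ((Cmd.forN 22 (.seq (search treeTest treeLt)
        (.cond (.natLt (var 10) (var 0)) treeInsert .skip))).run s₂) := by
    refine Cmd.forN_induct ls₂.size I ?_ ?_
    · refine ⟨fun _ => r, fun _ => 0, ⟨?_, fun x hx hxr => ?_⟩, .inr ?_⟩
      · rw [natCol_writeNat_ne (by decide), D₂]
        exact .init (show r ∈ F from hr0) _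
      · rw [natCol_writeNat_ne (by decide)] at hx
        exact absurd (D₂.subset hx) hxr
      · rw [natCol_writeNat_ne (by decide), add_zero]
        have : (Finset.univ.filter fun x => s₂.natCol n 5 x ≠ 1).card <
            (Finset.univ : Finset (Fin n)).card :=
          Finset.card_lt_card (Finset.filter_ssubset.2 ⟨r, Finset.mem_univ _, by simp [c₂]⟩)
        rwa [Finset.card_fin] at this
    · rintro k hk s₃ hn₃ hr₃ - ⟨par, rk, hT, hd⟩
      have ls₃ : Loaded G w ρ c s₃ := ls₂.congr (hn₃ 0 (by decide)) (hn₃ 1 (by decide))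
        (hr₃ 0 (by decide)) (hr₃ 1 (by decide)) (hr₃ 2 (by decide))
      have l₃ : ∀ x, s₃.natCol n 3 x = 0 ↔ x ∈ F := fun x => by
        rw [natCol_congr ((hn₃ 3 (by decide)).trans (n₂ 3 (by decide) (by decide)))]
        rfl
      have hsame := search_same treeTest treeLt s₃
      have hb := search_spec ls₃.size (φ := treeTest) (lt := treeLt)
        (fun z x => s₃.natCol n 5 z = 1 ∧ s₃.natCol n 5 x ≠ 1 ∧ x ∈ F ∧ G.Adj z x)
        (fun z x => s₃.realCol n 4 z + s₃.real 1 z x) (by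
          intro t ht z x hz hx
          simp only [treeTest, holds_and, holds_not, holds_natEq, eval_entry, eval_var, eval_lit,
            eval_get, hz, hx, ← l₃, ← ls₃.adj, State.natCol]
          rw [ht.1 5 (by decide) (by decide) (by decide) (by decide),
            ht.1 3 (by decide) (by decide) (by decide) (by decide),
            ht.1 1 (by decide) (by decide) (by decide) (by decide)]) (by
          intro t ht z x z' x' hz hx hz' hx'
          simp only [treeLt, holds_realLt, evalR_add, evalR_realEntry, evalR_get, eval_var, hz, hx,
            hz', hx', ht.2, State.realCol])
      rw [run_seq]
      set t := (search treeTest treeLt).run s₃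
      have t0 : t.nat 0 0 0 = n := by
        rw [hsame.1 0 (by decide) (by decide) (by decide) (by decide), ls₃.size]
      rcases hb with ⟨h1, h2⟩ | ⟨z, x, h1, h2, ⟨h3, h4, h5, h6⟩, h7⟩
      · rw [run_cond_neg (by simp [h1, t0])]
        have e5 : (t.writeNat 22 0 0 (k + 1)).natCol n 5 = s₃.natCol n 5 :=
          (natCol_writeNat_ne (by decide)).trans (hsame.natCol n)
        have hT' : HoldsTree G w F r par rk (k + 1) s₃ := ⟨hT.1.mono (Nat.le_succ k), hT.2⟩
        refine ⟨par, rk, hT'.congr e5 ((natCol_writeNat_ne (by decide)).trans (hsame.natCol n))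
          (hsame.realCol n 4), .inl ?_⟩
        rw [run_skip, e5]
        exact fun z x h3 h4 h5 h6 => h2 z x ⟨h3, h4, h5, h6⟩
      · rw [run_cond_pos (by simp [h1, t0])]
        set t' := treeInsert.run t with ht'
        have e5 : (t'.writeNat 22 0 0 (k + 1)).natCol n 5 =
            Function.update (s₃.natCol n 5) x 1 := by
          rw [natCol_writeNat_ne (by decide), ← hsame.natCol n (b := 5), ← natCol_writeNat, ← h1]
          funext y
          simp [ht', treeInsert, State.writeNat, State.natCol]
        have e6 : (t'.writeNat 22 0 0 (k + 1)).natCol n 6 =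
            Function.update (s₃.natCol n 6) x z := by
          rw [natCol_writeNat_ne (by decide), ← hsame.natCol n (b := 6), ← natCol_writeNat, ← h1,
            ← h2]
          funext y
          simp [ht', treeInsert, State.writeNat, State.natCol]
        have e4 : (t'.writeNat 22 0 0 (k + 1)).realCol n 4 =
            Function.update (s₃.realCol n 4) x (s₃.realCol n 4 z + w s(z, x)) := by
          rw [← hsame.realCol n 4, ← realCol_writeReal, ← ls₃.weight z x h6, ← hsame.2]
          funext y
          simp [ht', treeInsert, State.writeNat, State.writeReal, State.realCol, h1, h2]
        refine ⟨Function.update par x z, Function.update rk x (k + 1), ⟨?_, ?_⟩, .inr ?_⟩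
        · have : {y | (t'.writeNat 22 0 0 (k + 1)).natCol n 5 y = 1} =
              insert x {y | s₃.natCol n 5 y = 1} := by
            ext y
            rw [Set.mem_ofPred_eq, e5, Set.mem_insert_iff, Set.mem_ofPred_eq]
            by_cases h : y = x <;> simp [h]
          rw [this, e4]
          exact hT.1.step h3 h4 h5 h6 fun z' hz' x' hx' hx'F hzx' => by
            have := h7 z' x' ⟨hz', hx', hx'F, hzx'⟩
            rwa [ls₃.weight _ _ h6, ls₃.weight _ _ hzx'] at this
        · rw [e5, e6]
          intro y hy hyr
          by_cases h : y = x
          · subst h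
            simp
          · rw [Function.update_of_ne h] at hy ⊢
            rw [Function.update_of_ne h]
            exact hT.2 y hy hyr
        · have hcard := hd.resolve_left fun h => h z x h3 h4 h5 h6
          rw [e5]
          have : (Finset.univ.filter fun y => Function.update (s₃.natCol n 5) x 1 y ≠ 1).card <
              (Finset.univ.filter fun y => s₃.natCol n 5 y ≠ 1).card := by
            refine Finset.card_lt_card
              (Finset.ssubset_iff_subset_ne.2 ⟨fun y hy => ?_, fun h => ?_⟩)
            · rw [Finset.mem_filter] at hy ⊢
              refine ⟨hy.1, ?_⟩
              have : y ≠ x := by rintro rfl; exact hy.2 (Function.update_self ..)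
              rw [← Function.update_of_ne this 1 (s₃.natCol n 5)]
              exact hy.2
            · have : x ∈ Finset.univ.filter fun y => s₃.natCol n 5 y ≠ 1 := by simpa using h4
              rw [← h] at this
              simp at this
          omega
  obtain ⟨par, rk, hT, hd⟩ := key
  refine ⟨par, rk, hT, fun x => hT.1.mem_iff (fun z hz x hx hxF => ?_) x⟩
  rcases hd with h | h
  · exact h z x hz hx hxF
  · omega

end
end RAM

/-! ### Growing supernodes -/

namespace RAM

/-- The partial decomposition in the memory. -/
def State.decomp (s : State) (n : ℕ) : PartialDecomp (Fin n) where
  lab := s.natCol n 3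
  pc := s.natCol n 2
  low x u := s.nat 15 x u
  m := s.nat 7 0 0
  p := s.nat 8 0 0

theorem decomp_congr {s t : State} {n : ℕ} (h2 : t.nat 2 = s.nat 2) (h3 : t.nat 3 = s.nat 3)
    (h15 : t.nat 15 = s.nat 15) (h7 : t.nat 7 = s.nat 7) (h8 : t.nat 8 = s.nat 8) :
    t.decomp n = s.decomp n := by
  simp only [State.decomp, natCol_congr h2, natCol_congr h3, h15, h7, h8]

theorem SameData.decomp {s t : State} (h : SameData s t) (n : ℕ) : t.decomp n = s.decomp n := by
  apply decomp_congr <;> exact h.1 _ (by decide) (by decide) (by decide) (by decide)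

/-- The vertex `x` is an unassigned vertex of the component, and `z` is its neighbor in a supernode
that is younger than the one in the array `14`. -/
def growTest : Test :=
  .and (.natEq (entry 5 (var 31)) (.lit 1)) (.and (.natEq (entry 3 (var 31)) (.lit 0))
    (.and (.natLt (var 14) (entry 3 (var 30))) (.natEq (.get 1 (var 30) (var 31)) (.lit 1))))

/-- The comparison of tentative scaled distances. -/
def growLt : Test :=
  .realLt (.add (realEntry 3 (var 30)) (.get 2 (var 30) (var 31)))
    (.add (realEntry 3 (var 11)) (.get 2 (var 11) (var 10)))

/-- Add the vertex in the array `10` to the piece of its neighbor in the array `11`. -/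
def growInsert : Cmd :=
  .seq (.setReal 3 (var 10) (.lit 0) (.add (realEntry 3 (var 11)) (.get 2 (var 11) (var 10))))
    (.seq (.setNat 3 (var 10) (.lit 0) (entry 3 (var 11)))
      (.seq (.setNat 2 (var 10) (.lit 0) (entry 2 (var 11)))
        (.setNat 12 (.lit 0) (.lit 0) (.lit 1))))

/-- Add one vertex within scaled distance `ρ` if there is any. -/
def growStep : Cmd :=
  .seq (search growTest growLt)
    (.cond (.and (.natLt (var 10) (var 0))
        (.realLe (.add (realEntry 3 (var 11)) (.get 2 (var 11) (var 10)))
          (.get 0 (.lit 0) (.lit 0))))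
      growInsert .skip)

/-- Add all vertices of the component within scaled distance `ρ` of the supernodes that are
younger than the one in the array `14`. The array `12` records whether there are any. -/
def grow : Cmd := .seq (clearReal 3) (.forN 22 growStep)

section

variable {n : ℕ} {G : SimpleGraph (Fin n)} {w : Sym2 (Fin n) → ℝ≥0} {ρ : ℝ} {c : ℕ} {s : State}

/-- The unassigned vertices in the memory. -/
def freeSet (n : ℕ) (s : State) : Finset (Fin n) := Finset.univ.filter fun x => s.natCol n 3 x = 0

theorem freeSet_congr {t : State} (h : t.natCol n 3 = s.natCol n 3) :
    freeSet n t = freeSet n s := by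
  simp only [freeSet, h]

theorem card_freeSet_lt {t : State} {x : Fin n} {v : ℕ} (hx : s.natCol n 3 x = 0) (hv : v ≠ 0)
    (h : t.natCol n 3 = Function.update (s.natCol n 3) x v) :
    (freeSet n t).card < (freeSet n s).card := by
  refine Finset.card_lt_card (Finset.ssubset_iff_subset_ne.2 ⟨fun y hy => ?_, fun he => ?_⟩)
  · rw [freeSet, Finset.mem_filter] at hy ⊢
    rw [h] at hy
    have : y ≠ x := by
      rintro rfl
      exact hv ((Function.update_self ..).symm.trans hy.2)
    rw [Function.update_of_ne this] at hy
    exact hy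
  · have h1 : x ∈ freeSet n s := by simpa [freeSet] using hx
    rw [← he, freeSet, Finset.mem_filter, h, Function.update_self] at h1
    exact hv h1.2

/-- No further vertex of the component of `r` is within scaled distance `ρ`. -/
def Exhausted (G : SimpleGraph (Fin n)) (w : Sym2 (Fin n) → ℝ≥0) (ρ : ℝ) (c : ℕ)
    (s : PartialDecomp (Fin n)) (r : Fin n) (b : ℕ) (t : State) : Prop :=
  ∀ x z, (∃ l, WalkIn G w s.free r x l) → t.natCol n 3 x = 0 → t.natCol n 3 z ≠ 0 →
    b < t.natCol n 3 z → G.Adj z x → ρ < t.realCol n 3 z + 4 * c * w s(z, x)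

/-- Either no vertex has been added since the state `s`, or the number of unassigned vertices has
decreased. -/
def Progress (n : ℕ) (s t : State) : Prop :=
  (t.nat 12 0 0 = 0 ∧ t.natCol n 3 = s.natCol n 3 ∧ t.natCol n 2 = s.natCol n 2) ∨
    (t.nat 12 0 0 ≠ 0 ∧ (freeSet n t).card < (freeSet n s).card)

theorem grow_spec (hs : Loaded G w ρ c s) {r : Fin n} (h12 : s.nat 12 0 0 = 0)
    (hvis : ∀ x, s.natCol n 5 x = 1 ↔ ∃ l, WalkIn G w (s.decomp n).free r x l) :
    IsGrowth G w ρ c (s.decomp n) ((grow.run s).decomp n) r (s.nat 14 0 0)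
      ((grow.run s).realCol n 3) ∧
    Exhausted G w ρ c (s.decomp n) r (s.nat 14 0 0) (grow.run s) ∧ Progress n s (grow.run s) := by
  classical
  rw [grow, run_seq]
  set s₁ := (clearReal 3).run s with hs₁
  have n₁ : ∀ b, b ≠ 22 → s₁.nat b = s.nat b := fun b h =>
    Cmd.run_nat (by simp [clearReal, Cmd.natWrites, h.symm]) s
  have r₁ : ∀ b, b ≠ 3 → s₁.real b = s.real b := fun b h =>
    Cmd.run_real (by simp [clearReal, Cmd.realWrites, h.symm]) s
  have d₁ : s₁.decomp n = s.decomp n := by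
    apply decomp_congr <;> exact n₁ _ (by decide)
  have ls₁ : Loaded G w ρ c s₁ := hs.congr (n₁ 0 (by decide)) (n₁ 1 (by decide))
    (r₁ 0 (by decide)) (r₁ 1 (by decide)) (r₁ 2 (by decide))
  let I : ℕ → State → Prop := fun k t =>
    IsGrowth G w ρ c (s.decomp n) (t.decomp n) r (s.nat 14 0 0) (t.realCol n 3) ∧
    (Exhausted G w ρ c (s.decomp n) r (s.nat 14 0 0) t ∨ (freeSet n t).card + k ≤ n) ∧
    Progress n s t
  have I_congr : ∀ k k' t t', I k t → t'.nat 2 = t.nat 2 → t'.nat 3 = t.nat 3 →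
      t'.nat 15 = t.nat 15 → t'.nat 7 = t.nat 7 → t'.nat 8 = t.nat 8 → t'.nat 12 = t.nat 12 →
      t'.real = t.real → (k' = k ∨ Exhausted G w ρ c (s.decomp n) r (s.nat 14 0 0) t) →
      I k' t' := by
    intro k k' t t' ⟨h1, h2, h3⟩ e2 e3 e15 e7 e8 e12 er hk
    simp only [I, Progress, Exhausted, freeSet, decomp_congr e2 e3 e15 e7 e8, natCol_congr e3,
      natCol_congr e2, realCol_congr (congrFun er 3), e12] at h1 h2 h3 hk ⊢
    refine ⟨h1, ?_, h3⟩
    rcases hk with rfl | hk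
    · exact h2
    · exact .inl hk
  have key : I n ((Cmd.forN 22 growStep).run s₁) := by
    refine Cmd.forN_induct ls₁.size I ?_ ?_
    · refine I_congr 0 0 s₁ _ ⟨?_, .inr ?_, .inl ?_⟩ (writeNat_nat_ne _ _ _ _ (by decide))
        (writeNat_nat_ne _ _ _ _ (by decide)) (writeNat_nat_ne _ _ _ _ (by decide))
        (writeNat_nat_ne _ _ _ _ (by decide)) (writeNat_nat_ne _ _ _ _ (by decide))
        (writeNat_nat_ne _ _ _ _ (by decide)) rfl (.inl rfl)
      · rw [d₁]
        exact .refl (clearReal_spec hs.size)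
      · exact (Finset.card_filter_le _ _).trans_eq (Finset.card_fin n)
      · rw [n₁ 12 (by decide), natCol_congr (n₁ 3 (by decide)), natCol_congr (n₁ 2 (by decide))]
        exact ⟨h12, rfl, rfl⟩
    · rintro k hk s₃ hn₃ hr₃ - hI
      have ls₃ : Loaded G w ρ c s₃ := ls₁.congr (hn₃ 0 (by decide)) (hn₃ 1 (by decide))
        (hr₃ 0 (by decide)) (hr₃ 1 (by decide)) (hr₃ 2 (by decide))
      have v₃ : ∀ x, s₃.natCol n 5 x = 1 ↔ ∃ l, WalkIn G w (s.decomp n).free r x l := fun x => by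
        rw [natCol_congr ((hn₃ 5 (by decide)).trans (n₁ 5 (by decide))), hvis]
      have t₃ : s₃.nat 14 0 0 = s.nat 14 0 0 := by
        rw [hn₃ 14 (by decide), n₁ 14 (by decide)]
      have hsame := search_same growTest growLt s₃
      have hb := search_spec ls₃.size (φ := growTest) (lt := growLt)
        (fun z x => (∃ l, WalkIn G w (s.decomp n).free r x l) ∧ s₃.natCol n 3 x = 0 ∧
          s.nat 14 0 0 < s₃.natCol n 3 z ∧ G.Adj z x)
        (fun z x => s₃.realCol n 3 z + s₃.real 2 z x) (by
          intro t ht z x hz hx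
          simp only [growTest, holds_and, holds_natLt, holds_natEq, eval_entry, eval_var, eval_lit,
            eval_get, hz, hx, ← v₃, ← ls₃.adj, State.natCol, ← t₃]
          rw [ht.1 5 (by decide) (by decide) (by decide) (by decide),
            ht.1 3 (by decide) (by decide) (by decide) (by decide),
            ht.1 14 (by decide) (by decide) (by decide) (by decide),
            ht.1 1 (by decide) (by decide) (by decide) (by decide)]) (by
          intro t ht z x z' x' hz hx hz' hx'
          simp only [growLt, holds_realLt, evalR_add, evalR_realEntry, evalR_get, eval_var, hz, hx,
            hz', hx', ht.2, State.realCol])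
      rw [growStep, run_seq]
      set t := (search growTest growLt).run s₃
      have t0 : t.nat 0 0 0 = n := by
        rw [hsame.1 0 (by decide) (by decide) (by decide) (by decide), ls₃.size]
      have halt : Exhausted G w ρ c (s.decomp n) r (s.nat 14 0 0) s₃ →
          I (k + 1) (t.writeNat 22 0 0 (k + 1)) := by
        intro h
        apply I_congr k (k + 1) s₃ _ hI
        iterate 6
          rw [writeNat_nat_ne _ _ _ _ (by decide)]
          exact hsame.1 _ (by decide) (by decide) (by decide) (by decide)
        · exact hsame.2
        · exact .inr h
      rcases hb with ⟨h1, h2⟩ | ⟨z, x, h1, h2, ⟨h3, h4, h5, h6⟩, h7⟩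
      · rw [run_cond_neg (by simp [h1, t0])]
        exact halt fun x z h3 h4 _ h5 h6 => absurd ⟨h3, h4, h5, h6⟩ (h2 z x)
      have hmin : ∀ x' z', (∃ l, WalkIn G w (s.decomp n).free r x' l) → s₃.natCol n 3 x' = 0 →
          s₃.natCol n 3 z' ≠ 0 → s.nat 14 0 0 < s₃.natCol n 3 z' → G.Adj z' x' →
          s₃.realCol n 3 z + 4 * c * w s(z, x) ≤ s₃.realCol n 3 z' + 4 * c * w s(z', x') := by
        intro x' z' h3' h4' _ h5' h6'
        have := h7 z' x' ⟨h3', h4', h5', h6'⟩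
        rwa [ls₃.scaled _ _ h6, ls₃.scaled _ _ h6'] at this
      have hval : t.real 3 z 0 + t.real 2 z x = s₃.realCol n 3 z + 4 * c * w s(z, x) := by
        rw [hsame.2, ls₃.scaled z x h6, State.realCol]
      have hbd : t.real 0 0 0 = ρ := by rw [hsame.2, ls₃.bound]
      by_cases hle : s₃.realCol n 3 z + 4 * c * w s(z, x) ≤ ρ
      · rw [run_cond_pos (by simp [h1, h2, t0, hval, hle, hbd])]
        set t' := growInsert.run t with ht'
        have e3 : (t'.writeNat 22 0 0 (k + 1)).natCol n 3 =
            Function.update (s₃.natCol n 3) x (s₃.natCol n 3 z) := by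
          rw [natCol_writeNat_ne (by decide), ← hsame.natCol n (b := 3), ← natCol_writeNat]
          funext y
          simp [ht', growInsert, State.writeNat, State.natCol, h1, h2]
        have e2 : (t'.writeNat 22 0 0 (k + 1)).natCol n 2 =
            Function.update (s₃.natCol n 2) x (s₃.natCol n 2 z) := by
          rw [natCol_writeNat_ne (by decide), ← hsame.natCol n (b := 2), ← natCol_writeNat]
          funext y
          simp [ht', growInsert, State.writeNat, State.natCol, h1, h2]
        have er : (t'.writeNat 22 0 0 (k + 1)).realCol n 3 =
            Function.update (s₃.realCol n 3) x (s₃.realCol n 3 z + 4 * c * w s(z, x)) := by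
          rw [← hval, ← hsame.realCol n 3, ← realCol_writeReal]
          funext y
          simp [ht', growInsert, State.writeNat, State.writeReal, State.realCol, h1, h2]
        have e12 : (t'.writeNat 22 0 0 (k + 1)).nat 12 0 0 = 1 := by
          simp [ht', growInsert, State.writeNat]
        have eo : ∀ b, b ≠ 2 → b ≠ 3 → b ≠ 10 → b ≠ 11 → b ≠ 12 → b ≠ 22 → b ≠ 30 → b ≠ 31 →
            (t'.writeNat 22 0 0 (k + 1)).nat b = s₃.nat b := by
          intro b h2 h3 h10 h11 h12 h22 h30 h31
          rw [← hsame.1 b h10 h11 h30 h31, writeNat_nat_ne _ _ _ _ h22]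
          exact Cmd.run_nat (by simp [growInsert, Cmd.natWrites, h2.symm, h3.symm, h12.symm]) t
        have hlt : (freeSet n (t'.writeNat 22 0 0 (k + 1))).card < (freeSet n s₃).card :=
          card_freeSet_lt h4 (by omega) e3
        obtain ⟨hg, hd, hp⟩ := hI
        refine ⟨hg.step h3 h4 (show s₃.natCol n 3 z ≠ 0 by omega) h5 h6 hmin hle e3 e2 ?_ ?_ er,
          ?_, .inr ⟨by rw [e12]; decide, ?_⟩⟩
        · exact congrFun₂ (eo 7 (by decide) (by decide) (by decide) (by decide) (by decide)
            (by decide) (by decide) (by decide)) 0 0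
        · exact congrFun₂ (eo 8 (by decide) (by decide) (by decide) (by decide) (by decide)
            (by decide) (by decide) (by decide)) 0 0
        · rcases hd with hd | hd
          · exact absurd (hd x z h3 h4 (by omega) h5 h6) hle.not_gt
          · exact .inr (by omega)
        · rcases hp with ⟨-, hp, -⟩ | ⟨-, hp⟩
          · rwa [← freeSet_congr hp]
          · exact hlt.trans hp
      · rw [run_cond_neg (by simp [h1, h2, t0, hval, hle, hbd])]
        exact halt fun x' z' h3' h4' h0' h5' h6' =>
          (not_le.1 hle).trans_le (hmin x' z' h3' h4' h0' h5' h6')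
  obtain ⟨h1, h2, h3⟩ := key
  refine ⟨h1, h2.elim id fun h x z _ hx => ?_, h3⟩
  have : x ∈ freeSet n ((Cmd.forN 22 growStep).run s₁) := by simpa [freeSet] using hx
  have := Finset.card_pos.2 ⟨x, this⟩
  omega

end
end RAM

/-! ### Scanning the supernodes that are adjacent to a component -/

theorem SeesLabel.congr {V : Type*} {G : SimpleGraph V} {w : Sym2 V → ℝ≥0} {s t : PartialDecomp V}
    (h : t.lab = s.lab) {r : V} {j : ℕ} : SeesLabel G w t r j ↔ SeesLabel G w s r j := by
  simp only [SeesLabel, PartialDecomp.free, h]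

/-- Only the assignment of the vertices matters for its growth. -/
theorem IsGrowth.congr {V : Type*} {G : SimpleGraph V} {w : Sym2 V → ℝ≥0} {ρ : ℝ} {c : ℕ}
    {s s₁ s₂ : PartialDecomp V} {r : V} {b : ℕ} {off : V → ℝ} (h : IsGrowth G w ρ c s s₁ r b off)
    (hlab : s₂.lab = s₁.lab) (hpc : s₂.pc = s₁.pc) (hm : s₂.m = s₁.m) (hp : s₂.p = s₁.p) :
    IsGrowth G w ρ c s s₂ r b off := by
  obtain ⟨h1, h2, h3, h4, h5⟩ := h
  constructor <;> simpa only [hlab, hpc, hm, hp]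

namespace RAM

/-- Set the entry `(x, e)` of the array `15` to the value in the array `14`, for all vertices `x`
of the component. -/
def setLow (e : NatExpr) : Cmd :=
  .forN 22 (.cond (.natEq (entry 5 (var 22)) (.lit 1)) (.setNat 15 (var 22) e (var 14)) .skip)

theorem setLow_spec {s : State} {n u : ℕ} {e : NatExpr} (hn : s.nat 0 0 0 = n)
    (he : ∀ t : State, (∀ b, b ≠ 15 → b ≠ 22 → t.nat b = s.nat b) → e.eval t = u) (x : Fin n)
    (v : ℕ) : ((setLow e).run s).nat 15 x v =
      if s.natCol n 5 x = 1 ∧ v = u then s.nat 14 0 0 else s.nat 15 x v := by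
  have key := Cmd.forN_induct (a := 22)
    (c := .cond (.natEq (entry 5 (var 22)) (.lit 1)) (.setNat 15 (var 22) e (var 14)) .skip) hn
    (fun k t => ∀ (x : Fin n) v, t.nat 15 x v =
      if x.1 < k ∧ s.natCol n 5 x = 1 ∧ v = u then s.nat 14 0 0 else s.nat 15 x v)
    (fun x v => by simp [State.writeNat]) (fun k hk t ht _ hk' ih x v => ?_)
  · have := key x v
    simpa [setLow] using this
  · have h1 : ∀ b, b ≠ 15 → b ≠ 22 → t.nat b = s.nat b := fun b h h' =>
      ht b (by simp [Cmd.natWrites, h.symm, h'.symm])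
    rw [writeNat_nat_ne _ _ _ _ (by decide)]
    have hkx : ∀ y : Fin n, y.1 < k + 1 ↔ y.1 < k ∨ y.1 = k := fun y => by omega
    by_cases h : (Test.natEq (entry 5 (var 22)) (.lit 1)).Holds t
    · rw [run_cond_pos h, run_setNat, eval_var, hk', eval_var, he t h1, writeNat_nat, ih,
        h1 14 (by decide) (by decide)]
      simp only [holds_natEq, eval_entry, eval_var, hk', eval_lit,
        h1 5 (by decide) (by decide)] at h
      by_cases hx : x.1 = k
      · have : s.natCol n 5 x = 1 := by rw [State.natCol, hx, h]
        simp [hx, this]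
      · simp [hx, hkx]
    · rw [run_cond_neg h, run_skip, ih]
      simp only [holds_natEq, eval_entry, eval_var, hk', eval_lit,
        h1 5 (by decide) (by decide)] at h
      by_cases hx : x.1 = k
      · have : s.natCol n 5 x ≠ 1 := by rw [State.natCol, hx]; exact h
        simp [this]
      · simp [hx, hkx]

/-- The vertex `x` belongs to the component, and its neighbor `z` to the supernode whose number is
larger by one than the value in the array `21`. -/
def seesTest : Test :=
  .and (.natEq (entry 5 (var 31)) (.lit 1)) (.and (.natEq (.get 1 (var 30) (var 31)) (.lit 1))
    (.natEq (entry 3 (var 30)) (.add (var 21) (.lit 1))))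

/-- Grow the supernodes from the next seen supernode on if the walks that avoid the previous
seen supernodes are not known to be long. -/
def scanStep : Cmd :=
  .seq (search seesTest never) (.cond (.natLt (var 10) (var 0))
    (.seq
      (.cond (.and (.natEq (var 12) (.lit 0))
          (.natLt (var 14) (.get 15 (var 9) (.add (var 21) (.lit 1)))))
        (.seq grow (setLow (.add (var 21) (.lit 1)))) .skip)
      (.setNat 14 (.lit 0) (.lit 0) (.add (var 21) (.lit 1)))) .skip)

/-- Scan the seen supernodes in increasing order, until the component has been changed. -/
def scan : Cmd :=
  .seq (.setNat 14 (.lit 0) (.lit 0) (.lit 0))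
    (.seq (.setNat 12 (.lit 0) (.lit 0) (.lit 0)) (.forN 21 scanStep))

section

variable {n : ℕ} {G : SimpleGraph (Fin n)} {w : Sym2 (Fin n) → ℝ≥0} {ρ : ℝ} {c : ℕ} {s : State}

/-- The search for a neighbor of the component in a supernode. -/
theorem sees_spec (hs : Loaded G w ρ c s) {F : Set (Fin n)} {r : Fin n}
    (hvis : ∀ x, s.natCol n 5 x = 1 ↔ ∃ l, WalkIn G w F r x l) :
    (((search seesTest never).run s).nat 10 0 0 = n ∧ ∀ z x, (∃ l, WalkIn G w F r x l) →
      G.Adj z x → s.natCol n 3 z ≠ s.nat 21 0 0 + 1) ∨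
    ∃ z x : Fin n, ((search seesTest never).run s).nat 10 0 0 = x ∧
      ((search seesTest never).run s).nat 11 0 0 = z ∧ (∃ l, WalkIn G w F r x l) ∧ G.Adj z x ∧
      s.natCol n 3 z = s.nat 21 0 0 + 1 := by
  have := find_spec hs.size (φ := seesTest) (fun z x => (∃ l, WalkIn G w F r x l) ∧ G.Adj z x ∧
      s.natCol n 3 z = s.nat 21 0 0 + 1) (by
    intro t ht z x hz hx
    simp only [seesTest, holds_and, holds_natEq, eval_entry, eval_var, eval_lit, eval_add,
      eval_get, hz, hx, ← hvis, ← hs.adj, State.natCol]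
    rw [ht.1 5 (by decide) (by decide) (by decide) (by decide),
      ht.1 3 (by decide) (by decide) (by decide) (by decide),
      ht.1 21 (by decide) (by decide) (by decide) (by decide),
      ht.1 1 (by decide) (by decide) (by decide) (by decide)])
  exact this.imp_left fun h => ⟨h.1, fun z x h1 h2 h3 => h.2 z x ⟨h1, h2, h3⟩⟩

/-- All supernodes up to `k` that are adjacent to the component of `r` have been scanned, and the
largest one of them is `top`. -/
structure Scanned (G : SimpleGraph (Fin n)) (w : Sym2 (Fin n) → ℝ≥0) (s : PartialDecomp (Fin n))
    (r : Fin n) (low : ℕ → ℕ) (top k : ℕ) : Prop where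
  seen : top = 0 ∨ SeesLabel G w s r top
  top_le : top ≤ k
  le_top : ∀ j ≤ k, SeesLabel G w s r j → j ≤ top
  low_le : ∀ u ≤ k, SeesLabel G w s r u → ∀ b < u, (∀ j, SeesLabel G w s r j → j ≤ b ∨ u ≤ j) →
    low u ≤ b

theorem Scanned.step {s : PartialDecomp (Fin n)} {r : Fin n} {low low' : ℕ → ℕ} {top k : ℕ}
    (h : Scanned G w s r low top k) (hk : SeesLabel G w s r (k + 1))
    (heq : ∀ u ≤ k, low' u = low u) (hle : low' (k + 1) ≤ top) :
    Scanned G w s r low' (k + 1) (k + 1) := by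
  refine ⟨.inr hk, le_rfl, fun j hj _ => hj, fun u hu hu' b hb hgap => ?_⟩
  rcases Nat.lt_or_eq_of_le hu with h1 | rfl
  · rw [heq u (by omega)]
    exact h.low_le u (by omega) hu' b hb hgap
  · refine hle.trans ?_
    rcases h.seen with h0 | h0
    · omega
    · have := h.top_le
      exact (hgap _ h0).resolve_right (by omega)

theorem scan_spec (hs : Loaded G w ρ c s) (hρ : 0 ≤ ρ) {r : Fin n} (hr : s.nat 9 0 0 = r)
    (hr0 : s.natCol n 3 r = 0)
    (hvis : ∀ x, s.natCol n 5 x = 1 ↔ ∃ l, WalkIn G w (s.decomp n).free r x l)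
    (hH : ∃ H, Valid G w ρ c (s.decomp n) H) :
    (∃ H, Valid G w ρ c ((scan.run s).decomp n) H) ∧
    (((scan.run s).nat 12 0 0 ≠ 0 ∧ (freeSet n (scan.run s)).card < (freeSet n s).card) ∨
    ((scan.run s).nat 12 0 0 = 0 ∧ (scan.run s).natCol n 3 = s.natCol n 3 ∧
      (scan.run s).natCol n 2 = s.natCol n 2 ∧
      Scanned G w (s.decomp n) r ((scan.run s).nat 15 r) ((scan.run s).nat 14 0 0) n)) := by
  set s₁ := (Cmd.setNat 12 (.lit 0) (.lit 0) (.lit 0)).run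
    ((Cmd.setNat 14 (.lit 0) (.lit 0) (.lit 0)).run s) with hs₁
  have n₁ : ∀ b, b ≠ 12 → b ≠ 14 → s₁.nat b = s.nat b := fun b h h' =>
    (writeNat_nat_ne _ _ _ _ h).trans (writeNat_nat_ne _ _ _ _ h')
  have r₁ : s₁.real = s.real := rfl
  have d₁ : s₁.decomp n = s.decomp n := by
    apply decomp_congr <;> exact n₁ _ (by decide) (by decide)
  have ls₁ : Loaded G w ρ c s₁ := hs.congr (n₁ 0 (by decide) (by decide))
    (n₁ 1 (by decide) (by decide)) rfl rfl rfl
  let I : ℕ → State → Prop := fun k t => (∃ H, Valid G w ρ c (t.decomp n) H) ∧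
    ((t.nat 12 0 0 ≠ 0 ∧ (freeSet n t).card < (freeSet n s).card) ∨
    (t.nat 12 0 0 = 0 ∧ t.natCol n 3 = s.natCol n 3 ∧ t.natCol n 2 = s.natCol n 2 ∧
      Scanned G w (s.decomp n) r (t.nat 15 r) (t.nat 14 0 0) k))
  have I_congr : ∀ k t t', I k t → t'.nat 2 = t.nat 2 → t'.nat 3 = t.nat 3 →
      t'.nat 15 = t.nat 15 → t'.nat 7 = t.nat 7 → t'.nat 8 = t.nat 8 → t'.nat 12 = t.nat 12 →
      t'.nat 14 = t.nat 14 → I k t' := by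
    intro k t t' h e2 e3 e15 e7 e8 e12 e14
    simp only [I, freeSet, decomp_congr e2 e3 e15 e7 e8, natCol_congr e3,
      natCol_congr e2, e12, e14, e15] at h ⊢
    exact h
  have key : I n ((Cmd.forN 21 scanStep).run s₁) := by
    refine Cmd.forN_induct ls₁.size I ?_ ?_
    · refine I_congr 0 s₁ _ ⟨by rwa [d₁], .inr ⟨?_, ?_, ?_, .inl ?_, ?_, ?_, ?_⟩⟩
        (writeNat_nat_ne _ _ _ _ (by decide))
        (writeNat_nat_ne _ _ _ _ (by decide)) (writeNat_nat_ne _ _ _ _ (by decide))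
        (writeNat_nat_ne _ _ _ _ (by decide)) (writeNat_nat_ne _ _ _ _ (by decide))
        (writeNat_nat_ne _ _ _ _ (by decide)) (writeNat_nat_ne _ _ _ _ (by decide))
      · simp [hs₁]
      · exact natCol_congr (n₁ 3 (by decide) (by decide))
      · exact natCol_congr (n₁ 2 (by decide) (by decide))
      · simp [hs₁, State.writeNat]
      · simp [hs₁, State.writeNat]
      · exact fun j hj h => absurd (Nat.le_zero.1 hj) h.1
      · exact fun j hj h => absurd (Nat.le_zero.1 hj) h.1
    · rintro k hk s₃ hn₃ hr₃ h21 hI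
      have ls₃ : Loaded G w ρ c s₃ := ls₁.congr (hn₃ 0 (by decide)) (hn₃ 1 (by decide))
        (hr₃ 0 (by decide)) (hr₃ 1 (by decide)) (hr₃ 2 (by decide))
      have v₃ : ∀ x, s₃.natCol n 5 x = 1 ↔ ∃ l, WalkIn G w (s.decomp n).free r x l := fun x => by
        rw [natCol_congr ((hn₃ 5 (by decide)).trans (n₁ 5 (by decide) (by decide))), hvis]
      have h9 : s₃.nat 9 0 0 = r := by
        rw [hn₃ 9 (by decide), n₁ 9 (by decide) (by decide), hr]
      have hsame := search_same seesTest never s₃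
      have hb := sees_spec ls₃ v₃
      rw [h21] at hb
      rw [scanStep, run_seq]
      set t := (search seesTest never).run s₃
      have tn : ∀ b, b ≠ 10 → b ≠ 11 → b ≠ 30 → b ≠ 31 → t.nat b = s₃.nat b := hsame.1
      have lt : Loaded G w ρ c t := by
        apply ls₃.congr
        · exact tn 0 (by decide) (by decide) (by decide) (by decide)
        · exact tn 1 (by decide) (by decide) (by decide) (by decide)
        all_goals rw [hsame.2]
      have t21 : t.nat 21 0 0 = k := by
        rw [tn 21 (by decide) (by decide) (by decide) (by decide), h21]
      have tI : I k t := by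
        apply I_congr k s₃ _ hI <;> exact tn _ (by decide) (by decide) (by decide) (by decide)
      have I_end : ∀ t, I (k + 1) t → I (k + 1) (t.writeNat 21 0 0 (k + 1)) := by
        intro t hI
        apply I_congr (k + 1) t _ hI <;> exact writeNat_nat_ne _ _ _ _ (by decide)
      apply I_end
      rcases hb with ⟨h1, h2⟩ | ⟨z, x, h1, h2, h3, h4, h5⟩
      · rw [run_cond_neg (by simp [h1, lt.size]), run_skip]
        obtain ⟨hH', h | ⟨h3, h4, h5, h6⟩⟩ := tI
        · exact ⟨hH', .inl h⟩
        · have hk1 : ¬ SeesLabel G w (s.decomp n) r (k + 1) := by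
            rintro ⟨-, x, l, z, hx, hxz, hz⟩
            refine h2 z x ⟨l, hx⟩ hxz.symm ?_
            rw [← hsame.natCol n, h4]
            exact hz
          have hle : ∀ j ≤ k + 1, SeesLabel G w (s.decomp n) r j → j ≤ k := by
            intro j hj hj'
            rcases Nat.lt_or_eq_of_le hj with h | rfl
            · omega
            · exact absurd hj' hk1
          exact ⟨hH', .inr ⟨h3, h4, h5, h6.seen, h6.top_le.trans (Nat.le_succ k),
            fun j hj hj' => h6.le_top j (hle j hj hj') hj',
            fun u hu hu' => h6.low_le u (hle u hu hu') hu'⟩⟩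
      · rw [run_cond_pos (by simp [h1, lt.size]), run_seq]
        have eval_k : ∀ s' : State, s'.nat 21 = t.nat 21 →
            (NatExpr.add (var 21) (.lit 1)).eval s' = k + 1 := by
          intro s' h
          rw [eval_add, eval_var, eval_lit, h, t21]
        have I_top : ∀ s' : State, s'.nat 21 = t.nat 21 → (s'.nat 12 0 0 ≠ 0 →
            (∃ H, Valid G w ρ c (s'.decomp n) H) ∧
              (freeSet n s').card < (freeSet n s).card) → (s'.nat 12 0 0 = 0 →
            (∃ H, Valid G w ρ c (s'.decomp n) H) ∧ s'.natCol n 3 = s.natCol n 3 ∧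
              s'.natCol n 2 = s.natCol n 2 ∧
              Scanned G w (s.decomp n) r (s'.nat 15 r) (k + 1) (k + 1)) →
            I (k + 1) ((Cmd.setNat 14 (.lit 0) (.lit 0) (.add (var 21) (.lit 1))).run s') := by
          intro s' e hne heq
          rw [run_setNat, eval_k s' e, eval_lit]
          have ew : ∀ b, b ≠ 14 → (s'.writeNat 14 0 0 (k + 1)).nat b = s'.nat b :=
            fun b hb => writeNat_nat_ne _ _ _ _ hb
          have ed : (s'.writeNat 14 0 0 (k + 1)).decomp n = s'.decomp n := by
            apply decomp_congr <;> exact ew _ (by decide)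
          have e3 : (s'.writeNat 14 0 0 (k + 1)).natCol n 3 = s'.natCol n 3 :=
            natCol_congr (ew 3 (by decide))
          simp only [I, ed, e3, freeSet_congr e3, natCol_congr (ew 2 (by decide)),
            ew 12 (by decide), ew 15 (by decide), writeNat_nat_same]
          by_cases h0 : s'.nat 12 0 0 = 0
          · exact ⟨(heq h0).1, .inr ⟨h0, (heq h0).2⟩⟩
          · exact ⟨(hne h0).1, .inl ⟨h0, (hne h0).2⟩⟩
        have t14 : (var 14).eval t = t.nat 14 0 0 := rfl
        have h9' : t.nat 9 0 0 = r := by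
          rw [tn 9 (by decide) (by decide) (by decide) (by decide), h9]
        obtain ⟨⟨H, hH'⟩, ⟨h6, h7⟩ | ⟨h6, h7, h8, h10⟩⟩ := tI
        · rw [run_cond_neg (by simp [h6]), run_skip]
          exact I_top t rfl (fun _ => ⟨⟨H, hH'⟩, h7⟩) fun h => absurd h h6
        have hlab : (t.decomp n).lab = (s.decomp n).lab := h7
        have hsees : SeesLabel G w (s.decomp n) r (k + 1) := by
          obtain ⟨l, hx⟩ := h3
          refine ⟨Nat.succ_ne_zero k, x, l, z, hx, h4.symm, ?_⟩
          rw [← h5, ← hsame.natCol n, h7]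
          rfl
        by_cases hlow : t.nat 14 0 0 < t.nat 15 r (k + 1)
        · rw [run_cond_pos (by simp [h6, h9', t21, hlow]), run_seq]
          have vt : ∀ x, t.natCol n 5 x = 1 ↔ ∃ l, WalkIn G w (t.decomp n).free r x l := by
            rw [PartialDecomp.free, hlab]
            intro x
            rw [hsame.natCol n]
            exact v₃ x
          obtain ⟨g1, g2, g3⟩ := grow_spec lt h6 vt
          set t₁ := grow.run t with ht₁
          have n₁ : ∀ b, grow.natWrites b = false → t₁.nat b = t.nat b := fun b hb =>
            Cmd.run_nat hb t
          have t₁0 : t₁.nat 0 0 0 = n := by rw [n₁ 0 (by decide), lt.size]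
          have e2 := fun x v => setLow_spec (e := .add (var 21) (.lit 1)) (u := k + 1) t₁0
            (fun s' hs' => eval_k s' ((hs' 21 (by decide) (by decide)).trans
              (n₁ 21 (by decide)))) (n := n) x v
          set t₂ := (setLow (.add (var 21) (.lit 1))).run t₁ with ht₂
          have n₂ : ∀ b, (setLow (.add (var 21) (.lit 1))).natWrites b = false →
              t₂.nat b = t₁.nat b := fun b hb => Cmd.run_nat hb t₁
          rw [n₁ 14 (by decide), n₁ 15 (by decide), natCol_congr (n₁ 5 (by decide))] at e2
          have r2 : t₂.realCol n 3 = t₁.realCol n 3 := realCol_congr (Cmd.run_real rfl t₁)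
          have l2 : t₂.natCol n 3 = t₁.natCol n 3 := natCol_congr (n₂ 3 (by decide))
          have p2 : t₂.natCol n 2 = t₁.natCol n 2 := natCol_congr (n₂ 2 (by decide))
          have hr0' : (t.decomp n).lab r = 0 := by rw [hlab]; exact hr0
          have g : ∃ H', Valid G w ρ c (t₂.decomp n) H' := by
            refine hH'.grow hρ hr0' ((SeesLabel.congr hlab).2 hsees) (b := t.nat 14 0 0) ?_
              (Nat.lt_succ_of_le h10.top_le) ?_ hlow
              (g1.congr l2 p2 (congrFun₂ (n₂ 7 (by decide)) 0 0) (congrFun₂ (n₂ 8 (by decide)) 0 0))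
              ?_ ?_ ?_
            · exact h10.seen.imp_right (SeesLabel.congr hlab).2
            · intro j hj
              rcases Nat.lt_or_ge k j with h | h
              · exact .inr h
              · exact .inl (h10.le_top j h ((SeesLabel.congr hlab).1 hj))
            · intro x z hx hx0 hz0 hbz hzx
              exact g2 x z hx (by rw [← l2]; exact hx0) (by rw [← l2]; exact hz0)
                (by rw [← l2]; exact hbz) hzx
            · intro x hx v
              refine (e2 x v).trans ?_
              rw [(vt x).2 hx]
              simp only [true_and]
              rfl
            · intro x hx
              funext v
              refine (e2 x v).trans (if_neg fun h => hx ((vt x).1 h.1))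
          have c2 : t₂.nat 12 0 0 = t₁.nat 12 0 0 := by rw [n₂ 12 (by decide)]
          refine I_top t₂ ((n₂ 21 (by decide)).trans (n₁ 21 (by decide))) (fun h => ⟨g, ?_⟩)
            fun h => ⟨g, ?_⟩
          · rw [c2] at h
            rcases g3 with ⟨h', -⟩ | ⟨-, h'⟩
            · exact absurd h' h
            · rwa [freeSet_congr l2, ← freeSet_congr h7]
          · rw [c2] at h
            rcases g3 with ⟨-, h', h''⟩ | ⟨h', -⟩
            · refine ⟨l2.trans (h'.trans h7), p2.trans (h''.trans h8), h10.step hsees ?_ ?_⟩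
              · intro u hu
                refine (e2 r u).trans (if_neg fun h => ?_)
                omega
              · refine ((e2 r (k + 1)).trans (if_pos ⟨(vt r).2 ⟨0, .refl hr0'⟩, rfl⟩)).le
            · exact absurd h h'
        · rw [run_cond_neg (by simp [h9', t21, not_lt.1 hlow]), run_skip]
          exact I_top t rfl (fun h => absurd h6 h) fun _ => ⟨⟨H, hH'⟩, h7, h8,
            h10.step hsees (fun _ _ => rfl) (not_lt.1 hlow)⟩
  exact key

end
end RAM

/-! ### Creating a supernode -/

namespace RAM

/-- Four times the distance between the current vertex of a skeleton path and the center of the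
current piece. -/
def traceGap : RealExpr :=
  .add (.add (.sub (.get 5 (.lit 0) (.lit 0)) (realEntry 4 (var 13)))
      (.sub (.get 5 (.lit 0) (.lit 0)) (realEntry 4 (var 13))))
    (.add (.sub (.get 5 (.lit 0) (.lit 0)) (realEntry 4 (var 13)))
      (.sub (.get 5 (.lit 0) (.lit 0)) (realEntry 4 (var 13))))

/-- Start a new piece at the current vertex. -/
def traceCut : Cmd :=
  .seq (.setNat 8 (.lit 0) (.lit 0) (.add (var 8) (.lit 1)))
    (.setReal 5 (.lit 0) (.lit 0) (realEntry 4 (var 13)))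

/-- Add the current vertex to the current piece and go to its parent. -/
def traceInsert : Cmd :=
  .seq (.setNat 3 (var 13) (.lit 0) (var 7)) (.seq (.setNat 2 (var 13) (.lit 0) (var 8))
    (.setNat 13 (.lit 0) (.lit 0) (entry 6 (var 13))))

/-- One step towards the root. -/
def traceStep : Cmd :=
  .cond (.natEq (entry 3 (var 13)) (.lit 0))
    (.seq (.cond (.realLe traceGap (.get 0 (.lit 0) (.lit 0))) .skip traceCut) traceInsert) .skip

/-- Follow the tree path from the vertex in the array `10` to the vertices of the new supernode,
cut the path into pieces and add it to the supernode. -/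
def trace : Cmd :=
  .seq (.setNat 8 (.lit 0) (.lit 0) (.add (var 8) (.lit 1)))
    (.seq (.setNat 13 (.lit 0) (.lit 0) (var 10))
      (.seq (.setReal 5 (.lit 0) (.lit 0) (realEntry 4 (var 10))) (.forN 22 traceStep)))

section

variable {n : ℕ} {G : SimpleGraph (Fin n)} {w : Sym2 (Fin n) → ℝ≥0} {ρ : ℝ} {c : ℕ} {s : State}

theorem trace_spec {S : PartialDecomp (Fin n)} {r : Fin n} {par : Fin n → Fin n} {rk : Fin n → ℕ}
    {cen₁ : ℕ → Fin n} {path₁ : ℕ → ℕ} (hs : Loaded G w ρ c s) (hρ : 0 ≤ ρ)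
    (hT : HoldsTree G w S.free r par rk n s)
    (hvis : ∀ x, s.natCol n 5 x = 1 ↔ ∃ l, WalkIn G w S.free r x l)
    (sk : IsSkeleton G w ρ S (s.decomp n) r (s.realCol n 4) cen₁ path₁)
    (hle : ∀ x, S.lab x ≤ S.m) {x z : Fin n} {j : ℕ} (h10 : s.nat 10 0 0 = x)
    (hx : ∃ l, WalkIn G w S.free r x l) (hzx : G.Adj z x) (hz : S.lab z = j) (hj : j ≠ 0)
    (hpath : ∀ y, s.natCol n 3 y = S.m + 1 → path₁ (s.natCol n 2 y) < j) :
    ∃ cen path, IsSkeleton G w ρ S ((trace.run s).decomp n) r (s.realCol n 4) cen path ∧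
      (∀ y, (trace.run s).natCol n 3 y = S.m + 1 → path ((trace.run s).natCol n 2 y) ≤ j) ∧
      (trace.run s).natCol n 3 x = S.m + 1 ∧
      ∀ y, s.natCol n 3 y ≠ 0 → (trace.run s).natCol n 3 y = s.natCol n 3 y := by
  classical
  set s₁ := s.decomp n with hs₁
  set d := s.realCol n 4 with hd
  let I : ℕ → State → Prop := fun k t => ∃ cen path v d₀,
    IsTrace G w ρ S s₁ (t.decomp n) r d rk cen path j v d₀ ∧ t.nat 13 0 0 = v ∧
    t.real 5 0 0 = d₀ ∧ (rk v + k ≤ n ∨ t.natCol n 3 v ≠ 0) ∧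
    (∀ q ≤ s₁.p, cen q = cen₁ q) ∧ (∀ q ≤ s₁.p, path q = path₁ q) ∧
    (t.natCol n 3 x ≠ 0 ∨ v = x)
  have I_congr : ∀ k t, I k t → I k (t.writeNat 22 0 0 k) := by
    rintro k t ⟨cen, path, v, d₀, h1, h2, h3, h4, h5⟩
    have e : ∀ b, b ≠ 22 → (t.writeNat 22 0 0 k).nat b = t.nat b :=
      fun b h => writeNat_nat_ne _ _ _ _ h
    have ed : (t.writeNat 22 0 0 k).decomp n = t.decomp n := by
      apply decomp_congr <;> exact e _ (by decide)
    refine ⟨cen, path, v, d₀, ?_⟩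
    rw [ed, e 13 (by decide), natCol_congr (e 3 (by decide))]
    exact ⟨h1, h2, h3, h4, h5⟩
  rw [trace, run_seq, run_seq, run_seq]
  set s₂ := (Cmd.setReal 5 (.lit 0) (.lit 0) (realEntry 4 (var 10))).run
    ((Cmd.setNat 13 (.lit 0) (.lit 0) (var 10)).run
      ((Cmd.setNat 8 (.lit 0) (.lit 0) (.add (var 8) (.lit 1))).run s)) with hs₂
  have n₂ : ∀ b, b ≠ 8 → b ≠ 13 → s₂.nat b = s.nat b := fun b h h' =>
    (writeNat_nat_ne _ _ _ _ h').trans (writeNat_nat_ne _ _ _ _ h)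
  have r₂ : ∀ b, b ≠ 5 → s₂.real b = s.real b := fun b h => writeReal_real_ne _ _ _ _ h
  have ls₂ : Loaded G w ρ c s₂ := hs.congr (n₂ 0 (by decide) (by decide))
    (n₂ 1 (by decide) (by decide)) (r₂ 0 (by decide)) (r₂ 1 (by decide)) (r₂ 2 (by decide))
  have key : I n ((Cmd.forN 22 traceStep).run s₂) := by
    refine Cmd.forN_induct ls₂.size I (I_congr 0 s₂ ?_) ?_
    · refine ⟨Function.update cen₁ (s₁.p + 1) x, Function.update path₁ (s₁.p + 1) j, x, d x,
        IsTrace.init sk.m_eq (natCol_congr (n₂ 3 (by decide) (by decide)))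
          (natCol_congr (n₂ 2 (by decide) (by decide)))
          (congrFun₂ (n₂ 7 (by decide) (by decide)) 0 0) ?_ hx rfl (by simp) (by simp), ?_, ?_,
        .inl (by simpa using hT.1.rk_le x ((hvis x).2 hx)), fun q hq => ?_, fun q hq => ?_,
        .inr rfl⟩
      · simp [hs₂, hs₁, State.decomp, State.writeNat]
      · simp [hs₂, State.writeNat, h10]
      · simp [hs₂, State.writeNat, State.writeReal, h10, hd, State.realCol]
      · rw [Function.update_of_ne (by omega)]
      · rw [Function.update_of_ne (by omega)]
    · rintro k hk s₃ hn₃ hr₃ - ⟨cen, path, v, d₀, hI, h13, h5, hrk, hcen, hpa, hxv⟩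
      have ls₃ : Loaded G w ρ c s₃ := ls₂.congr (hn₃ 0 (by decide)) (hn₃ 1 (by decide))
        (hr₃ 0 (by decide)) (hr₃ 1 (by decide)) (hr₃ 2 (by decide))
      have n56 : ∀ b, b = 5 ∨ b = 6 → s₃.nat b = s.nat b := by
        rintro b (rfl | rfl) <;> exact (hn₃ _ (by decide)).trans (n₂ _ (by decide) (by decide))
      have r4 : s₃.real 4 = s.real 4 := (hr₃ 4 (by decide)).trans (r₂ 4 (by decide))
      apply I_congr
      rw [traceStep]
      by_cases hv : s₃.natCol n 3 v = 0
      · rw [run_cond_pos (by simpa [h13, State.natCol] using hv), run_seq]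
        have hv1 : s₁.lab v = 0 := by
          by_contra h
          exact h (((hI.old v h).1).symm.trans hv)
        have hvr : v ≠ r := by
          rintro rfl
          have := sk.root
          omega
        obtain ⟨p1, p2, p3, p4⟩ := hT.1.par v ((hvis v).2 hI.next) hvr
        have p5 := hT.2 v ((hvis v).2 hI.next) hvr
        have hrk' := hrk.resolve_right (by simpa using hv)
        have insert : ∀ (t : State) cen path d₀, (∀ b, b ≠ 8 → t.nat b = s₃.nat b) →
            IsTrace G w ρ S s₁ (t.decomp n) r d rk cen path j v d₀ → t.real 5 0 0 = d₀ →
            4 * (d₀ - d v) ≤ ρ → (∀ q ≤ s₁.p, cen q = cen₁ q) → (∀ q ≤ s₁.p, path q = path₁ q) →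
            I (k + 1) (traceInsert.run t) := by
          intro t cen path d₀ tn hI h5 hle' hcen hpa
          have t13 : t.nat 13 0 0 = v := by rw [tn 13 (by decide), h13]
          have t3 : t.natCol n 3 v = 0 := by rw [natCol_congr (tn 3 (by decide)), hv]
          have e3 : (traceInsert.run t).natCol n 3 =
              Function.update (t.natCol n 3) v (S.m + 1) := by
            rw [← hI.m_eq, ← natCol_writeNat]
            funext y
            simp [traceInsert, State.writeNat, State.natCol, t13, State.decomp]
          have e2 : (traceInsert.run t).natCol n 2 =
              Function.update (t.natCol n 2) v (t.nat 8 0 0) := by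
            rw [← natCol_writeNat]
            funext y
            simp [traceInsert, State.writeNat, State.natCol, t13]
          have e13 : (traceInsert.run t).nat 13 0 0 = par v := by
            rw [← p5]
            simp [traceInsert, State.writeNat, State.natCol, t13, tn 6 (by decide),
              n56 6 (.inr rfl)]
          refine ⟨cen, path, par v, d₀, hI.step hv1 t3 ((hvis _).1 p1) p2 p3 p4 hle' e3 e2 ?_ ?_,
            e13, ?_, .inl (by omega), hcen, hpa, ?_⟩
          · exact congrFun₂ (Cmd.run_nat (c := traceInsert) (b := 7) (by decide) t) 0 0
          · exact congrFun₂ (Cmd.run_nat (c := traceInsert) (b := 8) (by decide) t) 0 0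
          · rw [← h5]
            exact congrFun₂ (Cmd.run_real (c := traceInsert) (b := 5) (by decide) t) 0 0
          · left
            rw [e3]
            by_cases hxv' : x = v
            · simp [hxv']
            · rw [Function.update_of_ne hxv', natCol_congr (tn 3 (by decide))]
              exact hxv.resolve_right fun h => hxv' h.symm
        have hgap : traceGap.eval s₃ = 4 * (d₀ - d v) := by
          simp only [traceGap, evalR_add, evalR_sub, evalR_get, evalR_realEntry, eval_lit,
            eval_var, h13, h5, r4, hd, State.realCol]
          ring
        by_cases hcut : 4 * (d₀ - d v) ≤ ρ
        · rw [run_cond_pos (by simp [hgap, ls₃.bound, hcut]), run_skip]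
          exact insert s₃ cen path d₀ (fun _ _ => rfl) hI h5 hcut hcen hpa
        · rw [run_cond_neg (by simpa [hgap, ls₃.bound] using hcut)]
          have tn : ∀ b, b ≠ 8 → (traceCut.run s₃).nat b = s₃.nat b := fun b h =>
            writeNat_nat_ne _ _ _ _ h
          have p3 := hI.p_lt
          refine insert (traceCut.run s₃) (Function.update cen (s₃.nat 8 0 0 + 1) v)
            (Function.update path (s₃.nat 8 0 0 + 1) j) (d v) tn
            (hI.cut (not_le.1 hcut) hρ (natCol_congr (tn 3 (by decide)))
              (natCol_congr (tn 2 (by decide))) (congrFun₂ (tn 7 (by decide)) 0 0) ?_ rfl ?_ ?_ ?_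
              ?_) ?_ (by simpa using hρ) ?_ ?_
          · simp [traceCut, State.decomp, State.writeNat]
          · intro q hq
            have : (s₃.decomp n).p = s₃.nat 8 0 0 := rfl
            rw [Function.update_of_ne (by omega)]
          · intro q hq
            have : (s₃.decomp n).p = s₃.nat 8 0 0 := rfl
            rw [Function.update_of_ne (by omega)]
          · exact Function.update_self ..
          · exact Function.update_self ..
          · simp [traceCut, State.writeNat, State.writeReal, h13, r4, hd, State.realCol]
          · intro q hq
            have : (s₃.decomp n).p = s₃.nat 8 0 0 := rfl
            rw [Function.update_of_ne (by omega), hcen q hq]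
          · intro q hq
            have : (s₃.decomp n).p = s₃.nat 8 0 0 := rfl
            rw [Function.update_of_ne (by omega), hpa q hq]
      · rw [run_cond_neg (by simpa [h13, State.natCol] using hv), run_skip]
        exact ⟨cen, path, v, d₀, hI, h13, h5, .inr hv, hcen, hpa, hxv⟩
  set t := (Cmd.forN 22 traceStep).run s₂
  obtain ⟨cen, path, v, d₀, hI, -, -, hrk, hcen, hpa, hxv⟩ := key
  have hv : (t.decomp n).lab v ≠ 0 := by
    rcases hrk with h | h
    · have : v = r := by
        by_contra hvr
        obtain ⟨-, -, -, p4⟩ := hT.1.par v ((hvis v).2 hI.next) hvr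
        omega
      have h1 := sk.root
      rw [this, (hI.old r (by omega)).1]
      omega
    · exact h
  obtain ⟨l, hl⟩ := hx
  have fin := hI.finish sk hcen hpa hle (fun y hy => (hpath y hy).ne)
    ⟨x, l, z, hl, hzx.symm, hz, by rwa [hz]⟩ hv
  refine ⟨cen, path, fin, fun y hy => ?_, ?_, fun y hy => (hI.old y hy).1⟩
  · by_cases h1 : s₁.lab y = 0
    · obtain ⟨-, -, -, -, -, h2, -⟩ := hI.new y h1 (show t.natCol n 3 y ≠ 0 by omega)
      exact h2.le
    · obtain ⟨h2, h3⟩ := hI.old y h1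
      have h4 : s₁.lab y = S.m + 1 := h2.symm.trans hy
      have h5 : S.lab y = 0 := by
        by_contra h5
        have := (sk.old y h5).1
        have := hle y
        omega
      change path ((t.decomp n).pc y) ≤ j
      rw [h3, hpa _ (sk.new y h5 h1).2.2.2]
      exact (hpath y h4).le
  · exact (fin.new x hl.right_mem (hxv.elim id fun h => h ▸ hv)).1

end
end RAM

namespace RAM

/-- Add the skeleton path to a seen supernode. -/
def createStep : Cmd :=
  .cond (.natLt (.add (var 21) (.lit 1)) (var 7))
    (.seq (search seesTest never) (.cond (.natLt (var 10) (var 0)) trace .skip)) .skip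

/-- Create a new supernode that contains the root. -/
def create : Cmd :=
  .seq (.setNat 7 (.lit 0) (.lit 0) (.add (var 7) (.lit 1)))
    (.seq (.setNat 8 (.lit 0) (.lit 0) (.add (var 8) (.lit 1)))
      (.seq (.setNat 3 (var 9) (.lit 0) (var 7)) (.seq (.setNat 2 (var 9) (.lit 0) (var 8))
        (.seq (.forN 21 createStep) (setLow (var 7))))))

section

variable {n : ℕ} {G : SimpleGraph (Fin n)} {w : Sym2 (Fin n) → ℝ≥0} {ρ : ℝ} {c : ℕ} {s : State}

theorem create_spec (hs : Loaded G w ρ c s) (hρ : 0 ≤ ρ) {h : ℕ} (hh : 0 < h)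
    (hG : CliqueMinorFree G h) (hc : c = min (h - 1) n) {r : Fin n} (hr : s.nat 9 0 0 = r)
    (hr0 : s.natCol n 3 r = 0) {par : Fin n → Fin n} {rk : Fin n → ℕ}
    (hT : HoldsTree G w (s.decomp n).free r par rk n s)
    (hvis : ∀ x, s.natCol n 5 x = 1 ↔ ∃ l, WalkIn G w (s.decomp n).free r x l)
    {H : History (Fin n)} (hH : Valid G w ρ c (s.decomp n) H)
    (hscan : Scanned G w (s.decomp n) r (s.nat 15 r) (s.nat 14 0 0) n) :
    (∃ H', Valid G w ρ c ((create.run s).decomp n) H') ∧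
      (freeSet n (create.run s)).card < (freeSet n s).card := by
  classical
  set S := s.decomp n with hS
  have hm : S.m ≤ n := by
    have : (Finset.Icc 1 S.m).card ≤ (Finset.univ : Finset (Fin n)).card := by
      refine Finset.card_le_card_of_surjOn S.lab fun i hi => ?_
      simp only [Finset.coe_Icc, Set.mem_Icc] at hi
      obtain ⟨x, hx⟩ := hH.surj i hi.1 hi.2
      exact ⟨x, by simp, hx⟩
    simpa using this
  have hle : ∀ x, S.lab x ≤ S.m := hH.lab_le
  rw [create, run_seq, run_seq, run_seq, run_seq, run_seq]
  set s₁ := (Cmd.setNat 2 (var 9) (.lit 0) (var 8)).run ((Cmd.setNat 3 (var 9) (.lit 0) (var 7)).run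
    ((Cmd.setNat 8 (.lit 0) (.lit 0) (.add (var 8) (.lit 1))).run
      ((Cmd.setNat 7 (.lit 0) (.lit 0) (.add (var 7) (.lit 1))).run s))) with hs₁
  have n₁ : ∀ b, b ≠ 2 → b ≠ 3 → b ≠ 7 → b ≠ 8 → s₁.nat b = s.nat b := fun b h2 h3 h7 h8 => by
    rw [hs₁, run_setNat, writeNat_nat_ne _ _ _ _ h2, run_setNat, writeNat_nat_ne _ _ _ _ h3,
      run_setNat, writeNat_nat_ne _ _ _ _ h8, run_setNat, writeNat_nat_ne _ _ _ _ h7]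
  have r₁ : s₁.real = s.real := rfl
  have m₁ : s₁.nat 7 0 0 = S.m + 1 := by simp [hs₁, hS, State.decomp, State.writeNat]
  have p₁ : s₁.nat 8 0 0 = S.p + 1 := by simp [hs₁, hS, State.decomp, State.writeNat]
  have e3 : s₁.natCol n 3 = Function.update (s.natCol n 3) r (S.m + 1) := by
    rw [← natCol_writeNat]
    funext y
    simp [hs₁, State.writeNat, State.natCol, hr, hS, State.decomp]
  have e2 : s₁.natCol n 2 = Function.update (s.natCol n 2) r (S.p + 1) := by
    rw [← natCol_writeNat]
    funext y
    simp [hs₁, State.writeNat, State.natCol, hr, hS, State.decomp]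
  have ls₁ : Loaded G w ρ c s₁ := hs.congr (n₁ 0 (by decide) (by decide) (by decide) (by decide))
    (n₁ 1 (by decide) (by decide) (by decide) (by decide)) rfl rfl rfl
  set d := s.realCol n 4 with hd
  let I : ℕ → State → Prop := fun k t => ∃ cen path,
    IsSkeleton G w ρ S (t.decomp n) r d cen path ∧
    (∀ y, t.natCol n 3 y = S.m + 1 → path (t.natCol n 2 y) ≤ k) ∧
    ∀ x y, (∃ l, WalkIn G w S.free r x l) → G.Adj x y → S.lab y ≠ 0 → S.lab y ≤ k →
      ∃ a b, G.Adj a b ∧ t.natCol n 3 a = S.m + 1 ∧ S.lab b = S.lab y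
  have I_congr : ∀ k t t', I k t → t'.nat 2 = t.nat 2 → t'.nat 3 = t.nat 3 →
      t'.nat 15 = t.nat 15 → t'.nat 7 = t.nat 7 → t'.nat 8 = t.nat 8 → I k t' := by
    intro k t t' h e2 e3 e15 e7 e8
    simp only [I, decomp_congr e2 e3 e15 e7 e8, natCol_congr e3, natCol_congr e2] at h ⊢
    exact h
  have key : I n ((Cmd.forN 21 createStep).run s₁) := by
    refine Cmd.forN_induct ls₁.size I (I_congr 0 s₁ _ ?_ (writeNat_nat_ne _ _ _ _ (by decide))
        (writeNat_nat_ne _ _ _ _ (by decide)) (writeNat_nat_ne _ _ _ _ (by decide))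
        (writeNat_nat_ne _ _ _ _ (by decide)) (writeNat_nat_ne _ _ _ _ (by decide))) ?_
    · exact ⟨fun _ => r, fun _ => 0, IsSkeleton.init hρ hr0 m₁ p₁ e3 e2 hle, fun _ _ => le_rfl,
        fun x y _ _ h0 h => absurd (Nat.le_zero.1 h) h0⟩
    · rintro k hk s₃ hn₃ hr₃ h21 ⟨cen, path, sk, hpath, htouch⟩
      have ls₃ : Loaded G w ρ c s₃ := ls₁.congr (hn₃ 0 (by decide)) (hn₃ 1 (by decide))
        (hr₃ 0 (by decide)) (hr₃ 1 (by decide)) (hr₃ 2 (by decide))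
      have v₃ : ∀ x, s₃.natCol n 5 x = 1 ↔ ∃ l, WalkIn G w S.free r x l := fun x => by
        rw [natCol_congr ((hn₃ 5 (by decide)).trans
          (n₁ 5 (by decide) (by decide) (by decide) (by decide))), hvis]
      have T₃ : HoldsTree G w S.free r par rk n s₃ := hT.congr
        (natCol_congr ((hn₃ 5 (by decide)).trans
          (n₁ 5 (by decide) (by decide) (by decide) (by decide))))
        (natCol_congr ((hn₃ 6 (by decide)).trans
          (n₁ 6 (by decide) (by decide) (by decide) (by decide))))
        (realCol_congr ((hr₃ 4 (by decide)).trans (congrFun r₁ 4)))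
      have d₃ : s₃.realCol n 4 = d := realCol_congr ((hr₃ 4 (by decide)).trans (congrFun r₁ 4))
      have m₃ : s₃.nat 7 0 0 = S.m + 1 := by rw [hn₃ 7 (by decide), m₁]
      have I_end : ∀ t, I (k + 1) t → I (k + 1) (t.writeNat 21 0 0 (k + 1)) := by
        intro t hI
        apply I_congr (k + 1) t _ hI <;> exact writeNat_nat_ne _ _ _ _ (by decide)
      have stay : (∀ x y, (∃ l, WalkIn G w S.free r x l) → G.Adj x y → S.lab y ≠ k + 1) →
          I (k + 1) s₃ := fun hno =>
        ⟨cen, path, sk, fun y hy => (hpath y hy).trans (Nat.le_succ k), fun x y hx hxy h0 hk' =>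
          htouch x y hx hxy h0 (by have := hno x y hx hxy; omega)⟩
      apply I_end
      rw [createStep]
      by_cases hkm : k + 1 < S.m + 1
      · rw [run_cond_pos (by simpa [h21, m₃] using hkm), run_seq]
        have hsame := search_same seesTest never s₃
        have hb := sees_spec ls₃ v₃
        rw [h21] at hb
        set t := (search seesTest never).run s₃
        have lt : Loaded G w ρ c t := by
          apply ls₃.congr
          · exact hsame.1 0 (by decide) (by decide) (by decide) (by decide)
          · exact hsame.1 1 (by decide) (by decide) (by decide) (by decide)
          all_goals rw [hsame.2]
        have hlab : ∀ z, s₃.natCol n 3 z = k + 1 ↔ S.lab z = k + 1 := by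
          intro z
          by_cases hz : S.lab z = 0
          · refine ⟨fun h => ?_, fun h => by omega⟩
            have := (sk.new z hz (show s₃.natCol n 3 z ≠ 0 by omega)).1
            have : s₃.natCol n 3 z = S.m + 1 := this
            omega
          · have : s₃.natCol n 3 z = S.lab z := (sk.old z hz).1
            rw [this]
        rcases hb with ⟨h1, h2⟩ | ⟨z, x, h1, h2, h3, h4, h5⟩
        · rw [run_cond_neg (by simp [h1, lt.size]), run_skip]
          have := stay fun x y hx hxy h => h2 y x hx hxy.symm ((hlab y).2 h)
          apply I_congr (k + 1) s₃ _ this <;>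
            exact hsame.1 _ (by decide) (by decide) (by decide) (by decide)
        · rw [run_cond_pos (by simp [h1, lt.size])]
          have Tt : HoldsTree G w S.free r par rk n t := T₃.congr (hsame.natCol n)
            (hsame.natCol n) (hsame.realCol n 4)
          have dt : t.realCol n 4 = d := (hsame.realCol n 4).trans d₃
          obtain ⟨cen', path', sk', hp', hx', hold⟩ := trace_spec (S := S) (r := r) (cen₁ := cen)
            (path₁ := path) lt hρ Tt (fun x => by rw [hsame.natCol n]; exact v₃ x)
            (by rw [dt, hsame.decomp n]; exact sk) hle h1 h3 h4 ((hlab z).1 h5) (Nat.succ_ne_zero k)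
            (fun y hy => by
              rw [hsame.natCol n] at hy ⊢
              exact Nat.lt_succ_of_le (hpath y hy))
          rw [dt] at sk'
          refine ⟨cen', path', sk', hp', fun a b ha hab h0 hk' => ?_⟩
          rcases Nat.lt_or_eq_of_le hk' with h | h
          · obtain ⟨a', b', h6, h7, h8⟩ := htouch a b ha hab h0 (by omega)
            refine ⟨a', b', h6, ?_, h8⟩
            rw [hold a' (by rw [hsame.natCol n]; omega), hsame.natCol n, h7]
          · exact ⟨x, z, h4.symm, hx', ((hlab z).1 h5).trans h.symm⟩
      · rw [run_cond_neg (by simpa [h21, m₃] using hkm), run_skip]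
        exact stay fun x y _ _ h => by have := hle y; omega
  set t := (Cmd.forN 21 createStep).run s₁ with ht
  obtain ⟨cen, path, sk, -, htouch⟩ := key
  have nt : ∀ b, (Cmd.forN 21 createStep).natWrites b = false → t.nat b = s₁.nat b :=
    fun b hb => Cmd.run_nat hb s₁
  have nt' : ∀ b, b ≠ 2 → b ≠ 3 → b ≠ 7 → b ≠ 8 → (Cmd.forN 21 createStep).natWrites b = false →
      t.nat b = s.nat b := fun b h2 h3 h7 h8 hb => (nt b hb).trans (n₁ b h2 h3 h7 h8)
  have t0 : t.nat 0 0 0 = n := by rw [nt 0 (by decide), ls₁.size]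
  have m_t : t.nat 7 0 0 = S.m + 1 := by rw [nt 7 (by decide), m₁]
  have e15 := fun x v => setLow_spec (e := var 7) (u := S.m + 1) (n := n) t0
    (fun s' hs' => by rw [eval_var, hs' 7 (by decide) (by decide), m_t]) x v
  rw [natCol_congr (nt' 5 (by decide) (by decide) (by decide) (by decide) (by decide)),
    nt' 14 (by decide) (by decide) (by decide) (by decide) (by decide),
    nt' 15 (by decide) (by decide) (by decide) (by decide) (by decide)] at e15
  set t' := (setLow (var 7)).run t with ht'
  have n' : ∀ b, (setLow (var 7)).natWrites b = false → t'.nat b = t.nat b :=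
    fun b hb => Cmd.run_nat hb t
  have l' : t'.natCol n 3 = t.natCol n 3 := natCol_congr (n' 3 (by decide))
  have sk' : IsSkeleton G w ρ S (t'.decomp n) r d cen path := by
    have h2 : (t'.decomp n).pc = (t.decomp n).pc := natCol_congr (n' 2 (by decide))
    have h3 : (t'.decomp n).lab = (t.decomp n).lab := l'
    have h7 : (t'.decomp n).m = (t.decomp n).m := congrFun₂ (n' 7 (by decide)) 0 0
    have h8 : (t'.decomp n).p = (t.decomp n).p := congrFun₂ (n' 8 (by decide)) 0 0
    obtain ⟨a1, a2, a3, a4, a5, a6, a7, a8, a9⟩ := sk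
    constructor <;> simpa only [h2, h3, h7, h8]
  have tree := hT.1
  refine ⟨hH.create hr0 hh hG (by simpa using hc) sk' ?_ ?_ ?_ (top := s.nat 14 0 0) hscan.seen ?_
    ?_ ?_, ?_⟩
  · intro x l y hx hxy hy
    exact tree.lipschitz x ((hvis x).2 ⟨l, hx⟩) y ((hvis y).2 ⟨_, hx.concat hy hxy⟩) hxy
  · intro x l y hx hxy hy
    obtain ⟨a, b, h1, h2, h3⟩ := htouch x y ⟨l, hx⟩ hxy hy ((hle y).trans hm)
    exact ⟨a, b, h1, (congrFun l' a).trans h2, h3⟩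
  · exact fun u hu => hscan.low_le u ((hH.seesLabel_range hu).2.trans hm) hu
  · exact fun j hj => hscan.le_top j ((hH.seesLabel_range hj).2.trans hm) hj
  · intro x hx v
    refine (e15 x v).trans ?_
    rw [(hvis x).2 hx]
    simp only [true_and]
    rfl
  · intro x hx
    funext v
    exact (e15 x v).trans (if_neg fun h => hx ((hvis x).1 h.1))
  · refine Finset.card_lt_card (Finset.ssubset_iff_subset_ne.2 ⟨fun y hy => ?_, fun he => ?_⟩)
    · rw [freeSet, Finset.mem_filter] at hy ⊢
      refine ⟨hy.1, ?_⟩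
      by_contra h
      exact h ((sk'.old y h).1.symm.trans hy.2)
    · have h1 : r ∈ freeSet n s := by simpa [freeSet] using hr0
      rw [← he, freeSet, Finset.mem_filter] at h1
      have h2 : t'.natCol n 3 r = S.m + 1 := sk'.root
      omega

end
end RAM

/-! ### The algorithm -/

namespace RAM

/-- The vertex `x` is unassigned. -/
def rootTest : Test := .natEq (entry 3 (var 31)) (.lit 0)

/-- Process the component of an unassigned vertex. -/
def round : Cmd :=
  .seq (search rootTest never) (.cond (.natLt (var 10) (var 0))
    (.seq (.setNat 9 (.lit 0) (.lit 0) (var 10)) (.seq buildTree (.seq scan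
      (.cond (.natEq (var 12) (.lit 0)) create .skip)))) .skip)

/-- The weight of the current pair of vertices. -/
def pairWeight : RealExpr := .get 1 (var 30) (var 31)

/-- Add four times the weight matrix to the matrix of scaled weights. -/
def scaleOnce : Cmd :=
  .forN 30 (.forN 31 (.setReal 2 (var 30) (var 31) (.add (.get 2 (var 30) (var 31))
    (.add (.add pairWeight pairWeight) (.add pairWeight pairWeight)))))

/-- Compute the scaled weights. -/
def scale : Cmd :=
  .forN 22 (.cond (.natLe (.add (var 22) (.lit 2)) (.get 0 (.lit 0) (.lit 1))) scaleOnce .skip)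

/-- The algorithm. -/
def decompose : Cmd := .seq scale (.forN 20 round)

section

variable {n : ℕ} {G : SimpleGraph (Fin n)} {w : Sym2 (Fin n) → ℝ≥0} {ρ : ℝ} {c : ℕ} {s : State}

theorem round_spec (hs : Loaded G w ρ c s) (hρ : 0 ≤ ρ) {h : ℕ} (hh : 0 < h)
    (hG : CliqueMinorFree G h) (hc : c = min (h - 1) n)
    (hH : ∃ H, Valid G w ρ c (s.decomp n) H) :
    (∃ H, Valid G w ρ c ((round.run s).decomp n) H) ∧
      ((freeSet n (round.run s)).card < (freeSet n s).card ∨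
        (freeSet n (round.run s)).card = 0) := by
  have hsame := search_same rootTest never s
  have hb := find_spec hs.size (φ := rootTest) (fun _ x => s.natCol n 3 x = 0) (by
    intro t ht z x hz hx
    simp only [rootTest, holds_natEq, eval_entry, eval_var, eval_lit, hx, State.natCol]
    rw [ht.1 3 (by decide) (by decide) (by decide) (by decide)])
  rw [round, run_seq]
  set t := (search rootTest never).run s
  have lt : Loaded G w ρ c t := by
    apply hs.congr
    · exact hsame.1 0 (by decide) (by decide) (by decide) (by decide)
    · exact hsame.1 1 (by decide) (by decide) (by decide) (by decide)
    all_goals rw [hsame.2]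
  have dt : t.decomp n = s.decomp n := hsame.decomp n
  have ft : freeSet n t = freeSet n s := freeSet_congr (hsame.natCol n)
  rcases hb with ⟨h1, h2⟩ | ⟨z, r, h1, -, h3⟩
  · rw [run_cond_neg (by simp [h1, lt.size]), run_skip, dt, ft]
    refine ⟨hH, .inr ?_⟩
    rw [freeSet, Finset.card_eq_zero, Finset.filter_eq_empty_iff]
    exact fun x _ => h2 x x
  rw [run_cond_pos (by simp [h1, lt.size]), run_seq, run_seq, run_seq]
  set t₁ := (Cmd.setNat 9 (.lit 0) (.lit 0) (var 10)).run t
  have n₁ : ∀ b, b ≠ 9 → t₁.nat b = t.nat b := fun b h => writeNat_nat_ne _ _ _ _ h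
  have l₁ : Loaded G w ρ c t₁ := lt.congr (n₁ 0 (by decide)) (n₁ 1 (by decide)) rfl rfl rfl
  have d₁ : t₁.decomp n = s.decomp n := by
    rw [← dt]
    apply decomp_congr <;> exact n₁ _ (by decide)
  have h9 : t₁.nat 9 0 0 = r := (writeNat_nat_same ..).trans h1
  have e₁ : t₁.natCol n 3 = s.natCol n 3 := (natCol_congr (n₁ 3 (by decide))).trans (hsame.natCol n)
  obtain ⟨par, rk, hT, hvis⟩ := buildTree_spec l₁ h9 (by rw [e₁]; exact h3)
  set t₂ := buildTree.run t₁
  have n₂ : ∀ b, buildTree.natWrites b = false → t₂.nat b = t₁.nat b :=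
    fun b hb => Cmd.run_nat hb t₁
  have r₂ : ∀ b, buildTree.realWrites b = false → t₂.real b = t₁.real b :=
    fun b hb => Cmd.run_real hb t₁
  have l₂ : Loaded G w ρ c t₂ := l₁.congr (n₂ 0 (by decide)) (n₂ 1 (by decide)) (r₂ 0 (by decide))
    (r₂ 1 (by decide)) (r₂ 2 (by decide))
  have d₂ : t₂.decomp n = s.decomp n := by
    rw [← d₁]
    apply decomp_congr <;> exact n₂ _ (by decide)
  have e₂ : t₂.natCol n 3 = s.natCol n 3 := (natCol_congr (n₂ 3 (by decide))).trans e₁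
  have F₁ : {x | t₁.natCol n 3 x = 0} = (s.decomp n).free := by rw [e₁]; rfl
  rw [F₁] at hT hvis
  have h9₂ : t₂.nat 9 0 0 = r := by rw [n₂ 9 (by decide), h9]
  obtain ⟨hH', hsc⟩ := scan_spec l₂ hρ h9₂ (by rw [e₂]; exact h3) (by rw [d₂]; exact hvis)
    (by rw [d₂]; exact hH)
  set t₃ := scan.run t₂
  have n₃ : ∀ b, scan.natWrites b = false → t₃.nat b = t₂.nat b := fun b hb => Cmd.run_nat hb t₂
  have r₃ : ∀ b, scan.realWrites b = false → t₃.real b = t₂.real b :=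
    fun b hb => Cmd.run_real hb t₂
  have l₃ : Loaded G w ρ c t₃ := l₂.congr (n₃ 0 (by decide)) (n₃ 1 (by decide)) (r₃ 0 (by decide))
    (r₃ 1 (by decide)) (r₃ 2 (by decide))
  rw [freeSet_congr e₂] at hsc
  rcases hsc with ⟨h4, h5⟩ | ⟨h4, h5, h6, h7⟩
  · rw [run_cond_neg (by simpa using h4), run_skip]
    exact ⟨hH', .inl h5⟩
  · rw [run_cond_pos (by simpa using h4)]
    have e₃ : t₃.natCol n 3 = s.natCol n 3 := h5.trans e₂
    have lab₃ : (t₃.decomp n).lab = (s.decomp n).lab := e₃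
    have F₃ : (t₃.decomp n).free = (s.decomp n).free := by
      rw [PartialDecomp.free, lab₃]
      rfl
    obtain ⟨H, hH'⟩ := hH'
    have hT₃ : HoldsTree G w (t₃.decomp n).free r par rk n t₃ := by
      rw [F₃]
      exact hT.congr (natCol_congr (n₃ 5 (by decide))) (natCol_congr (n₃ 6 (by decide)))
        (realCol_congr (r₃ 4 (by decide)))
    obtain ⟨h8, h10⟩ := create_spec l₃ hρ hh hG hc (by rw [n₃ 9 (by decide), h9₂])
      (by rw [e₃]; exact h3) hT₃
      (by rw [F₃, natCol_congr (n₃ 5 (by decide))]; exact hvis) hH'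
      (by
        rw [d₂] at h7
        obtain ⟨a1, a2, a3, a4⟩ := h7
        constructor <;> simpa only [SeesLabel.congr lab₃])
    exact ⟨h8, .inl (by rwa [freeSet_congr e₃] at h10)⟩

theorem scaleOnce_spec (hn : s.nat 0 0 0 = n) (z x : Fin n) :
    (scaleOnce.run s).real 2 z x = s.real 2 z x + 4 * s.real 1 z x := by
  have key : ∀ z x : Fin n, (scaleOnce.run s).real 2 z x =
      s.real 2 z x + if z.1 < n then 4 * s.real 1 z x else 0 := by
    refine Cmd.forN_induct hn (fun k t => ∀ z x : Fin n, t.real 2 z x =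
      s.real 2 z x + if z.1 < k then 4 * s.real 1 z x else 0) (by simp) ?_
    intro k hk t hnt hrt h30 ih
    have inner := Cmd.forN_induct (a := 31) (c := .setReal 2 (var 30) (var 31)
      (.add (.get 2 (var 30) (var 31)) (.add (.add pairWeight pairWeight)
        (.add pairWeight pairWeight)))) (s := t) (n := n)
      (by rw [hnt 0 (by decide), hn])
      (fun i t' => ∀ z x : Fin n, t'.real 2 z x =
        s.real 2 z x + if z.1 < k ∨ z.1 = k ∧ x.1 < i then 4 * s.real 1 z x else 0)
      (by simpa using ih) (by
        intro i hi t' hnt' hrt' h31 ih' z x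
        have e30 : t'.nat 30 0 0 = k := by rw [hnt' 30 (by decide), h30]
        have e1 : t'.real 1 = s.real 1 := (hrt' 1 (by decide)).trans (hrt 1 (by decide))
        rw [writeNat_real, run_setReal, writeReal_real]
        simp only [eval_var, evalR_add, evalR_get, pairWeight, e30, h31, e1]
        by_cases hzx : z.1 = k ∧ x.1 = i
        · rw [if_pos hzx, if_pos (by omega), ← hzx.1, ← hzx.2, ih', if_neg (by omega)]
          ring
        · rw [if_neg hzx, ih']
          congr 1
          refine if_congr ?_ rfl rfl
          omega)
    intro z x
    rw [writeNat_real, inner]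
    congr 1
    refine if_congr ?_ rfl rfl
    have := x.2
    omega
  rw [key, if_pos z.2]

theorem scale_spec (hs : Loaded G w ρ 0 s) {h : ℕ} (hh : s.nat 0 0 1 = h) :
    Loaded G w ρ (min (h - 1) n) (scale.run s) := by
  refine Cmd.forN_induct hs.size (fun k t => Loaded G w ρ (min (h - 1) k) t) ?_ ?_
  · rw [Nat.min_zero]
    exact hs.congr (writeNat_nat_ne _ _ _ _ (by decide)) (writeNat_nat_ne _ _ _ _ (by decide)) rfl
      rfl rfl
  · intro k hk t hnt hrt h22 ih
    have fin : ∀ t, Loaded G w ρ (min (h - 1) (k + 1)) t →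
        Loaded G w ρ (min (h - 1) (k + 1)) (t.writeNat 22 0 0 (k + 1)) := fun t ht =>
      ht.congr (writeNat_nat_ne _ _ _ _ (by decide)) (writeNat_nat_ne _ _ _ _ (by decide)) rfl
        rfl rfl
    apply fin
    have h01 : t.nat 0 0 1 = h := by rw [hnt 0 (by decide), hh]
    by_cases hkh : k + 2 ≤ h
    · rw [run_cond_pos (by simpa [h01, h22] using hkh)]
      have e : ∀ b, scaleOnce.natWrites b = false → (scaleOnce.run t).nat b = t.nat b :=
        fun b hb => Cmd.run_nat hb t
      have er : ∀ b, scaleOnce.realWrites b = false → (scaleOnce.run t).real b = t.real b :=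
        fun b hb => Cmd.run_real hb t
      refine ⟨by rw [e 0 (by decide), ih.size], fun z x => by rw [e 1 (by decide), ih.adj],
        by rw [er 0 (by decide), ih.bound], fun z x hzx => by
          rw [er 1 (by decide), ih.weight z x hzx],
        fun z x hzx => ?_⟩
      rw [scaleOnce_spec ih.size, ih.scaled z x hzx, ih.weight z x hzx, Nat.min_eq_right (by omega),
        Nat.min_eq_right (by omega)]
      push_cast
      ring
    · rw [run_cond_neg (by simpa [h01, h22] using hkh), run_skip]
      rwa [Nat.min_eq_left (by omega), ← Nat.min_eq_left (a := h - 1) (b := k) (by omega)]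

theorem input_loaded (h : ℕ) : Loaded G w ρ 0 (input h G w ρ) := by
  refine ⟨by simp [input], fun z x => ?_, by simp [input], fun z x hzx => ?_, fun z x _ => ?_⟩
  · by_cases hzx : G.Adj z x <;> simp [input, hzx]
  · simp [input, hzx]
  · simp [input]

theorem decompose_spec (hρ : 0 ≤ ρ) {h : ℕ} (hh : 0 < h) (hG : CliqueMinorFree G h) (v₀ : Fin n) :
    (∃ H, Valid G w ρ (min (h - 1) n) ((decompose.run (input h G w ρ)).decomp n) H) ∧
      ∀ v, (decompose.run (input h G w ρ)).natCol n 3 v ≠ 0 := by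
  rw [decompose, run_seq]
  have hs := scale_spec (input_loaded (G := G) (w := w) (ρ := ρ) h) (h := h) (by simp [input])
  set s := scale.run (input h G w ρ)
  have zero : ∀ b, 2 ≤ b → scale.natWrites b = false → ∀ i j, s.nat b i j = 0 := by
    intro b h2 hb i j
    rw [Cmd.run_nat hb]
    simp [input, show b ≠ 0 by omega, show b ≠ 1 by omega]
  have lab0 : ∀ v, (s.decomp n).lab v = 0 := fun v => zero 3 (by decide) (by decide) _ _
  have m0 : (s.decomp n).m = 0 := zero 7 (by decide) (by decide) _ _
  have hV : Valid G w ρ (min (h - 1) n) (s.decomp n)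
      ⟨fun _ => ∅, fun _ => ∅, fun _ => v₀, fun _ => 0, fun _ _ => 0, fun _ => ∅⟩ := by
    have noLab : ∀ {p : Prop} {v}, (s.decomp n).lab v ≠ 0 → p := fun {p v} h => absurd (lab0 v) h
    have noIdx : ∀ {p : Prop} {i}, 1 ≤ i → i ≤ (s.decomp n).m → p := fun {p i} h1 h2 =>
      absurd h2 (by omega)
    have noSee : ∀ {p : Prop} {x j}, SeesLabel G w (s.decomp n) x j → p := fun {p x j} h => by
      obtain ⟨h0, x, l, y, -, -, h1⟩ := h
      exact absurd ((lab0 y).symm.trans h1) h0.symm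
    constructor
    · exact fun v => (lab0 v).trans_le (Nat.zero_le _)
    · exact fun v h => noLab h
    · exact fun v v' h => noLab h
    · exact fun v h => noLab h
    · exact fun i h1 h2 => noIdx h1 h2
    · exact fun i h1 h2 => noIdx h1 h2
    · exact fun i h1 h2 => noIdx h1 h2
    · exact fun i h1 h2 => noIdx h1 h2
    · exact fun i h1 h2 => noIdx h1 h2
    · exact fun i h1 h2 => noIdx h1 h2
    · exact fun i j h1 h2 h3 => noIdx (h1.trans h2.le) h3
    · exact fun i h1 h2 => noIdx h1 h2
    · exact fun i h1 h2 => noIdx h1 h2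
    · exact fun x y h => noLab h
    · exact fun i h1 h2 => noIdx h1 h2
    · exact fun x y l _ x' y' _ _ h => noLab h
    · exact fun z h => noLab h
    · exact fun z h => noLab h
    · exact fun x u _ h => noSee h
    · exact fun z h => noLab h
    · intro x y l _ u
      exact (zero 15 (by decide) (by decide) _ _).trans (zero 15 (by decide) (by decide) _ _).symm
    · exact fun z h => noLab h
    · exact fun i h1 h2 => noIdx h1 h2
    · exact fun z h => noLab h
    · exact fun z z' h => noLab h
  let I : ℕ → State → Prop := fun k t => (∃ H, Valid G w ρ (min (h - 1) n) (t.decomp n) H) ∧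
    ((freeSet n t).card + k ≤ n ∨ (freeSet n t).card = 0)
  have I_congr : ∀ k t, I k t → I k (t.writeNat 20 0 0 k) := by
    intro k t hI
    have e : ∀ b, b ≠ 20 → (t.writeNat 20 0 0 k).nat b = t.nat b :=
      fun b h => writeNat_nat_ne _ _ _ _ h
    have ed : (t.writeNat 20 0 0 k).decomp n = t.decomp n := by
      apply decomp_congr <;> exact e _ (by decide)
    simp only [I, ed, freeSet_congr (natCol_congr (e 3 (by decide)))]
    exact hI
  have key : I n ((Cmd.forN 20 round).run s) := by
    refine Cmd.forN_induct hs.size I (I_congr 0 s ⟨⟨_, hV⟩, .inl ?_⟩) ?_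
    · exact (Finset.card_filter_le _ _).trans_eq (Finset.card_fin n)
    · intro k hk t hnt hrt _ hI
      have lt : Loaded G w ρ (min (h - 1) n) t := hs.congr (hnt 0 (by decide)) (hnt 1 (by decide))
        (hrt 0 (by decide)) (hrt 1 (by decide)) (hrt 2 (by decide))
      obtain ⟨h1, h2⟩ := round_spec lt hρ hh hG rfl hI.1
      refine I_congr _ _ ⟨h1, ?_⟩
      have := hI.2
      omega
  refine ⟨key.1, fun v hv => ?_⟩
  have h0 := key.2
  have : v ∈ freeSet n ((Cmd.forN 20 round).run s) := by simpa [freeSet] using hv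
  have := Finset.card_pos.2 ⟨v, this⟩
  omega

end
end RAM

theorem theorem4 :
    ∃ (A : RAM.Program) (T : Polynomial ℕ),
      ∀ (h : ℕ), 0 < h →
      ∀ (n : ℕ) (G : SimpleGraph (Fin n)) (w : Sym2 (Fin n) → ℝ≥0) (ρ : ℝ),
        CliqueMinorFree G h → 0 < ρ →
        ∃ (t : ℕ) (s : RAM.State) (P : Finpartition (Finset.univ : Finset (Fin n)))
          (ord : LinearOrder {X // X ∈ P.parts}),
          RAM.Runs A (RAM.input h G w ρ) t s ∧
          t ≤ T.eval n ∧
          RAM.IsOutput s P ord ∧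
          (∀ X ∈ P.parts, strongDiam G w (X : Set (Fin n)) ≤ ENNReal.ofReal ρ) ∧
          ∀ r : ℝ, ρ < r →
            (wcol G w P ord r : ℝ) ≤
              ((h + 2 * ⌈4 * (h : ℝ) * (r / ρ)⌉₊ - 2).choose (h - 1) : ℝ) *
                (12 + 8 * (r / ρ)) * ((h : ℝ) - 1) := by
  refine ⟨RAM.decompose.toProgram, RAM.decompose.cost, fun h hh n G w ρ hG hρ => ?_⟩
  obtain ⟨t, ht, hle⟩ := RAM.Cmd.runs (c := RAM.decompose) (by decide) (by decide)
    (RAM.input h G w ρ)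
  have hn : (RAM.input h G w ρ).nat 0 0 0 = n := by simp [RAM.input]
  rw [hn] at hle
  rcases Nat.eq_zero_or_pos n with rfl | hpos
  · obtain ⟨P, ord, -, -⟩ := Valid.exists_order (V := Fin 0) (fun _ => 0)
    have no : ∀ X ∈ P.parts, False := fun X hX => by
      obtain ⟨u, -⟩ := P.nonempty_of_mem_parts hX
      exact u.elim0
    refine ⟨t, _, P, ord, ht, hle, fun X => (no X.1 X.2).elim, fun X hX => (no X hX).elim,
      fun r hr => ?_⟩
    have h0 : wcol G w P ord r = 0 :=
      Nat.le_zero.1 (Finset.sup_le fun X _ => (no X.1 X.2).elim)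
    have h1 : (1 : ℝ) ≤ h := by exact_mod_cast hh
    have h2 : 0 < r / ρ := div_pos (hρ.trans hr) hρ
    rw [h0, Nat.cast_zero]
    exact mul_nonneg (by positivity) (by linarith)
  · obtain ⟨⟨H, hV⟩, hall⟩ := RAM.decompose_spec (w := w) hρ.le hh hG ⟨0, hpos⟩
    obtain ⟨P, ord, h1, h2, h3⟩ := hV.exists_partition hall hρ hh (min_le_left _ _)
    exact ⟨t, _, P, ord, ht, hle, h1, h2, h3⟩
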